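/- Let $G=(V,E)$ be a finite simple undirected graph. A cut $(S,V\setminus S)$ with $S\subseteq V$ has size equal to the number of edges with exactly one endpoint in $S$, and it is called connected if the induced subgraph $G[S]$ is connected (in particular $S\neq\emptyset$). Consider the two decision problems: (1) Connected Maximum Cut: given $G$ and an integer $k\ge 0$, is there a connected cut $(S,V\setminus S)$ of size at least $k$? (2) Connected Maximum $s$-$t$ Cut: given $G$, an integer $k\ge 0$ and $s,t\in V$, is there a connected cut $(S,V\setminus S)$ of size at least $k$ with $s\in S$ and $t\in V\setminus S$? In both problems the input also contains a tree decomposition of $G$, that is, a tree $T$ with node set $I$ and bags $X_i\subseteq V$ $(i\in I)$ such that every vertex lies in some bag, both endpoints of every edge lie in a common bag, and $X_i\cap X_k\subseteq X_j$ whenever $j$ lies on the path from $i$ to $k$ in $T$. Its width is ${\rm tw}=\max_{i\in I}|X_i|-1$ (taken to be $0$ if $V=\emptyset$). **Theorem.** For each of the two problems there is a Monte Carlo algorithm (a randomized random access machine with logarithmic cost and access to independent fair coin flips) and constants $C,d$ such that on every input, of size $N$ bits and with a tree decomposition of width ${\rm tw}$: - for every outcome of the coin flips the algorithm halts within time $C\cdot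 3^{\rm tw}\cdot N^{d}$, that is, in time $O^*(3^{\rm tw})$; - it never gives a false positive: if the answer is "no", then it answers "no" for every outcome of the coin flips; - if the answer is "yes", then it wrongly answers "no" with probability at most $1/2$. -/

import Mathlib

open MeasureTheory

/-! ### Randomized random access machines with logarithmic cost -/

namespace RAM

/-- Arithmetic operations; `lt` and `eq` return the truth value `1` or `0`, and `sub` is truncated
at `0`. -/
inductive Op where
  | add | sub | mul | div | mod | lt | eq

/-- The value of an operation on natural numbers. -/
def Op.eval : Op → ℕ → ℕ → ℕ
  | .add, a, b => a + b
  | .sub, a, b => a - b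
  | .mul, a, b => a * b
  | .div, a, b => a / b
  | .mod, a, b => a % b
  | .lt, a, b => if a < b then 1 else 0
  | .eq, a, b => if a = b then 1 else 0

/-- The cost of an operation: linear in the bit lengths of the operands for addition, subtraction
and comparisons, and the cost of the schoolbook methods for multiplication and division. -/
def Op.cost : Op → ℕ → ℕ → ℕ
  | .mul, a, b => (Nat.size a + 1) * (Nat.size b + 1)
  | .div, a, b => (Nat.size a + 1) * (Nat.size b + 1)
  | .mod, a, b => (Nat.size a + 1) * (Nat.size b + 1)
  | .add, a, b => Nat.size a + Nat.size b + 1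
  | .sub, a, b => Nat.size a + Nat.size b + 1
  | .lt, a, b => Nat.size a + Nat.size b + 1
  | .eq, a, b => Nat.size a + Nat.size b + 1

/-- Expressions: literals, variables, array cells `a[i]`, and operations. The names of variables
and of arrays are natural numbers, fixed in the program text. -/
inductive Expr where
  | lit (c : ℕ)
  | var (x : ℕ)
  | read (a : ℕ) (i : Expr)
  | bin (o : Op) (e₁ e₂ : Expr)

/-- A memory state: the values of the variables, the contents of the arrays, and the number of
random bits consumed so far. -/
@[ext] structure State where
  var : ℕ → ℕ
  arr : ℕ → ℕ → ℕ
  used : ℕ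

/-- The value of an expression in a state. -/
def Expr.eval (s : State) : Expr → ℕ
  | .lit c => c
  | .var x => s.var x
  | .read a i => s.arr a (i.eval s)
  | .bin o e₁ e₂ => o.eval (e₁.eval s) (e₂.eval s)

/-- The logarithmic cost of evaluating an expression: every number and every address that is
handled is charged with its bit length. -/
def Expr.cost (s : State) : Expr → ℕ
  | .lit c => Nat.size c + 1
  | .var x => Nat.size (s.var x) + 1
  | .read a i => i.cost s + Nat.size (i.eval s) + Nat.size (s.arr a (i.eval s)) + 1
  | .bin o e₁ e₂ => e₁.cost s + e₂.cost s + o.cost (e₁.eval s) (e₂.eval s)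

/-- Programs. Conditions are expressions, with `0` for false and other values for true. -/
inductive Program where
  | skip
  /-- `x := e` -/
  | assign (x : ℕ) (e : Expr)
  /-- `a[i] := e` -/
  | write (a : ℕ) (i e : Expr)
  /-- `x :=` a fresh random bit -/
  | flip (x : ℕ)
  | seq (p q : Program)
  /-- `if e then p else q` -/
  | cond (e : Expr) (p q : Program)
  /-- `while e do p` -/
  | loop (e : Expr) (p : Program)

/-- `x := v` -/
def State.setVar (s : State) (x v : ℕ) : State :=
  { s with var := Function.update s.var x v }

/-- `a[i] := v` -/
def State.setArr (s : State) (a i v : ℕ) : State :=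
  { s with arr := Function.update s.arr a (Function.update (s.arr a) i v) }

/-- `x :=` the next bit of the random tape `ω`, which is thereby consumed -/
def State.setFlip (s : State) (ω : ℕ → Bool) (x : ℕ) : State :=
  { s.setVar x (if ω s.used then 1 else 0) with used := s.used + 1 }

/-- `Exec ω p s t s'`: with random tape `ω`, the program `p` started in state `s` halts in
state `s'` at total cost `t`. -/
inductive Exec (ω : ℕ → Bool) : Program → State → ℕ → State → Prop where
  | skip (s : State) : Exec ω .skip s 1 s
  | assign (s : State) (x : ℕ) (e : Expr) :
      Exec ω (.assign x e) s (e.cost s + 1) (s.setVar x (e.eval s))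
  | write (s : State) (a : ℕ) (i e : Expr) :
      Exec ω (.write a i e) s (i.cost s + e.cost s + 1) (s.setArr a (i.eval s) (e.eval s))
  | flip (s : State) (x : ℕ) : Exec ω (.flip x) s 1 (s.setFlip ω x)
  | seq {p q : Program} {s s₁ s₂ : State} {t₁ t₂ : ℕ} :
      Exec ω p s t₁ s₁ → Exec ω q s₁ t₂ s₂ → Exec ω (.seq p q) s (t₁ + t₂) s₂
  | condTrue {e : Expr} {p q : Program} {s s₁ : State} {t : ℕ} :
      e.eval s ≠ 0 → Exec ω p s t s₁ → Exec ω (.cond e p q) s (e.cost s + 1 + t) s₁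
  | condFalse {e : Expr} {p q : Program} {s s₁ : State} {t : ℕ} :
      e.eval s = 0 → Exec ω q s t s₁ → Exec ω (.cond e p q) s (e.cost s + 1 + t) s₁
  | loopTrue {e : Expr} {p : Program} {s s₁ s₂ : State} {t₁ t₂ : ℕ} :
      e.eval s ≠ 0 → Exec ω p s t₁ s₁ → Exec ω (.loop e p) s₁ t₂ s₂ →
      Exec ω (.loop e p) s (e.cost s + 1 + t₁ + t₂) s₂
  | loopFalse {e : Expr} {p : Program} {s : State} :
      e.eval s = 0 → Exec ω (.loop e p) s (e.cost s + 1) s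

/-- For a fixed random tape, execution is deterministic. -/
theorem Exec.deterministic {ω : ℕ → Bool} {p : Program} {s s₁ s₂ : State} {t₁ t₂ : ℕ}
    (h₁ : Exec ω p s t₁ s₁) (h₂ : Exec ω p s t₂ s₂) : t₁ = t₂ ∧ s₁ = s₂ := by
  induction h₁ generalizing t₂ s₂ with
  | skip | assign | write | flip => cases h₂; exact ⟨rfl, rfl⟩
  | seq _ _ ih ih' =>
    cases h₂ with
    | seq h h' =>
      obtain ⟨rfl, rfl⟩ := ih h
      obtain ⟨rfl, rfl⟩ := ih' h'
      exact ⟨rfl, rfl⟩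
  | condTrue he _ ih =>
    cases h₂ with
    | condTrue _ h => obtain ⟨rfl, rfl⟩ := ih h; exact ⟨rfl, rfl⟩
    | condFalse h _ => exact absurd h he
  | condFalse he _ ih =>
    cases h₂ with
    | condTrue h _ => exact absurd he h
    | condFalse _ h => obtain ⟨rfl, rfl⟩ := ih h; exact ⟨rfl, rfl⟩
  | loopTrue he _ _ ih ih' =>
    cases h₂ with
    | loopTrue _ h h' =>
      obtain ⟨rfl, rfl⟩ := ih h
      obtain ⟨rfl, rfl⟩ := ih' h'
      exact ⟨rfl, rfl⟩
    | loopFalse h => exact absurd h he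
  | loopFalse he =>
    cases h₂ with
    | loopTrue h _ _ => exact absurd he h
    | loopFalse _ => exact ⟨rfl, rfl⟩

/-- The initial state: array `0` holds the input word, everything else is `0`. -/
def State.init (w : List ℕ) : State where
  var _ := 0
  arr a i := if a = 0 then w.getD i 0 else 0
  used := 0

/-- With random tape `ω`, the program halts on input `w` after at most `t` steps (counted with
logarithmic cost). -/
def HaltsWithin (p : Program) (ω : ℕ → Bool) (w : List ℕ) (t : ℕ) : Prop :=
  ∃ t' s, Exec ω p (.init w) t' s ∧ t' ≤ t

/-- With random tape `ω`, the program halts on input `w` and answers "yes", that is, with a nonzero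
value of variable `0`. -/
def Accepts (p : Program) (ω : ℕ → Bool) (w : List ℕ) : Prop :=
  ∃ t s, Exec ω p (.init w) t s ∧ s.var 0 ≠ 0

/-- The distribution of the random tape: independent fair coin flips. -/
noncomputable def coin : Measure (ℕ → Bool) :=
  Measure.infinitePi fun _ => (PMF.uniformOfFintype Bool).toMeasure

/-- The number of bits of an input word, with one separator per entry. -/
def inputSize (w : List ℕ) : ℕ := (w.map fun a => Nat.size a + 1).sum

/-- `p` is a Monte Carlo algorithm for the decision problem `yes` on inputs encoded by `enc`, within
the time bound `time`: it always halts in time, it has no false positives, and for every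
yes-instance the probability of a false negative is at most `1/2`. -/
structure MonteCarlo {α : Type} (p : Program) (enc : α → List ℕ) (yes : α → Prop)
    (time : α → ℕ) : Prop where
  halts : ∀ x ω, HaltsWithin p ω (enc x) (time x)
  no_false_positive : ∀ x ω, Accepts p ω (enc x) → yes x
  false_negative : ∀ x, yes x → coin {ω | ¬ Accepts p ω (enc x)} ≤ 1 / 2

end RAM

/-! ### Connected cuts -/

namespace SimpleGraph

variable {V : Type}

/-- The set of edges with exactly one endpoint in `S`. -/
def cutset (G : SimpleGraph V) (S : Set V) : Set (Sym2 V) :=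
  {e | ∃ u v, G.Adj u v ∧ u ∈ S ∧ v ∉ S ∧ e = s(u, v)}

/-- `G` has a cut of size at least `k` with connected first side. -/
def HasConnectedCut (G : SimpleGraph V) (k : ℕ) : Prop :=
  ∃ S : Set V, (G.induce S).Connected ∧ k ≤ (G.cutset S).ncard

/-- `G` has a cut of size at least `k` whose first side is connected, with `s` on the first and `t`
on the second side. -/
def HasConnectedSTCut (G : SimpleGraph V) (s t : V) (k : ℕ) : Prop :=
  ∃ S : Set V, s ∈ S ∧ t ∉ S ∧ (G.induce S).Connected ∧ k ≤ (G.cutset S).ncard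

/-- A tree decomposition of `G` with node set `I`. -/
structure TreeDecomposition (G : SimpleGraph V) (I : Type) where
  tree : SimpleGraph I
  isTree : tree.IsTree
  bag : I → Set V
  cover : ∀ v, ∃ i, v ∈ bag i
  edge : ∀ u v, G.Adj u v → ∃ i, u ∈ bag i ∧ v ∈ bag i
  path : ∀ (i j k : I) (p : tree.Walk i k), p.IsPath → j ∈ p.support → bag i ∩ bag k ⊆ bag j

/-- The width: the maximum size of a bag, minus one. -/
noncomputable def TreeDecomposition.width {G : SimpleGraph V} {I : Type} [Fintype I]
    (D : G.TreeDecomposition I) : ℕ :=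
  (Finset.univ.sup fun i => (D.bag i).ncard) - 1

end SimpleGraph

/-! ### Instances and their encodings -/

open Classical in
/-- A Boolean matrix, written row by row as a word over `0` and `1`. -/
noncomputable def matrixWord {p q : ℕ} (M : Fin p → Fin q → Prop) : List ℕ :=
  List.ofFn fun x : Fin (p * q) => if M x.divNat x.modNat then 1 else 0

/-- A graph on the vertices `0, …, n - 1` together with a tree decomposition with the nodes
`0, …, N - 1`. -/
structure DecomposedGraph where
  n : ℕ
  graph : SimpleGraph (Fin n)
  N : ℕ
  decomp : graph.TreeDecomposition (Fin N)

/-- The adjacency matrix of the graph, the adjacency matrix of the tree, and the incidence matrix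
of nodes and vertices given by the bags. -/
noncomputable def DecomposedGraph.word (D : DecomposedGraph) : List ℕ :=
  matrixWord D.graph.Adj ++ matrixWord D.decomp.tree.Adj ++
    matrixWord (fun i v => v ∈ D.decomp.bag i)

/-- An instance of Connected Maximum Cut, with a tree decomposition. -/
structure CMCInstance extends DecomposedGraph where
  k : ℕ

/-- The input word of an instance of Connected Maximum Cut. -/
noncomputable def CMCInstance.word (x : CMCInstance) : List ℕ :=
  [x.n, x.N, x.k] ++ x.toDecomposedGraph.word

/-- An instance of Connected Maximum `s`-`t` Cut, with a tree decomposition. -/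
structure CMSTCInstance extends DecomposedGraph where
  k : ℕ
  s : Fin n
  t : Fin n

/-- The input word of an instance of Connected Maximum `s`-`t` Cut. -/
noncomputable def CMSTCInstance.word (x : CMSTCInstance) : List ℕ :=
  [x.n, x.N, x.k, x.s, x.t] ++ x.toDecomposedGraph.word

namespace RAM

/-! ### A time-bounded program logic -/

/-! The algorithm is Cut & Count on a tree decomposition. Color the vertices with 0, 1, 2, where 0
means "outside `S`" and the colors 1 and 2 split `S`, and call a coloring consistent if no edge
joins 1 and 2. A set `S` carries 2^c consistent colorings, where c is the number of components of
`G[S]` (`card_consistent`). This power is 1 for the empty set, 2 for connected `S`, and divisible by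
4 otherwise. So in a sum over distinct sets, the parity of half the sum, rounded down, is the parity
of the number of connected sets (`half_sum_consistent`); rounding removes the single possible
contribution of the empty set.

Parity loses an even number of solutions, so vertices get independent random weights. By the
isolation lemma, with probability at least 1/2 the solutions have a unique member of minimum weight.
Each set gets the exponent (cut size) + M * (weight), with M above all cut sizes. The exponent
determines cut size and weight, so an isolated solution is the only connected set with its exponent
that meets the conditions on s and t, and it is counted an odd number of times
(`Detects.of_isolates`). Conversely, an odd count always comes from an actual connected set, whose
cut size is the exponent modulo M. Hence there are no false positives, whatever the coins
(`Detects.exists_cut`).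

The generating function of the exponents over consistent colorings is evaluated at a single integer
Q = 4^(n+1). As there are only 3^n colorings, its coefficients are digits in base Q; since Q is a
power of two and at least 4, the relevant parity is one bit of the result, and it is unaffected by
working modulo Q^J with J above all exponents (`half_digit_eq`). One number of polynomially many
bits thus replaces a table indexed by cut size and weight.

This value is a sum over colorings of products of factors attached to ordered pairs of vertices
(`prod_pairFactor`): a factor Q for a cut edge, 0 for an inconsistent edge, and on the diagonal the
vertex weight and the conditions on s and t. Each nontrivial pair lies in some bag and is charged to
the highest node containing it (`Valid.prod_assigned`). Message passing from the leaves to the root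
(`sum_prod_eq_prod_messages`) then computes the sum, treating each of the at most 3^(tw+1) colorings
of a bag once and multiplying the messages of all children directly, so that joins need no extra
factor.

The remaining work is to verify a concrete program. The predicate `Run` combines a time bound in
instructions, a bound `B` on the bits of all cells, and a postcondition; each instruction costs
O(B^2), and `B` is polynomial in the input size. -/

instance : Add Expr := ⟨.bin .add⟩
instance : Sub Expr := ⟨.bin .sub⟩
instance : Mul Expr := ⟨.bin .mul⟩
instance : Div Expr := ⟨.bin .div⟩
instance : Mod Expr := ⟨.bin .mod⟩
instance (c : ℕ) : OfNat Expr c := ⟨.lit c⟩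

/-- Comparison of two expressions. -/
abbrev Expr.lt (a b : Expr) : Expr := .bin .lt a b

/-- Equality test of two expressions. -/
abbrev Expr.eq (a b : Expr) : Expr := .bin .eq a b

/-- `if c then a else b` as an arithmetic expression. -/
def Expr.ite (c a b : Expr) : Expr := Expr.eq c 0 * b + (1 - Expr.eq c 0) * a

namespace Expr

variable (s : State) (a b c : Expr)

@[simp] theorem eval_add : (a + b).eval s = a.eval s + b.eval s := rfl
@[simp] theorem eval_sub : (a - b).eval s = a.eval s - b.eval s := rfl
@[simp] theorem eval_mul : (a * b).eval s = a.eval s * b.eval s := rfl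
@[simp] theorem eval_div : (a / b).eval s = a.eval s / b.eval s := rfl
@[simp] theorem eval_mod : (a % b).eval s = a.eval s % b.eval s := rfl
@[simp] theorem eval_two : (2 : Expr).eval s = 2 := rfl
@[simp] theorem eval_three : (3 : Expr).eval s = 3 := rfl
@[simp] theorem eval_four : (4 : Expr).eval s = 4 := rfl
@[simp] theorem eval_five : (5 : Expr).eval s = 5 := rfl
@[simp] theorem eval_zero : (0 : Expr).eval s = 0 := rfl
@[simp] theorem eval_one : (1 : Expr).eval s = 1 := rfl
@[simp] theorem eval_var (x : ℕ) : (Expr.var x).eval s = s.var x := rfl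
@[simp] theorem eval_read (x : ℕ) : (Expr.read x a).eval s = s.arr x (a.eval s) := rfl
@[simp] theorem eval_lt : (Expr.lt a b).eval s = if a.eval s < b.eval s then 1 else 0 := rfl
@[simp] theorem eval_eq : (Expr.eq a b).eval s = if a.eval s = b.eval s then 1 else 0 := rfl
@[simp] theorem eval_ite :
    (Expr.ite c a b).eval s = if c.eval s = 0 then b.eval s else a.eval s := by
  by_cases h : c.eval s = 0 <;> simp [Expr.ite, h]

/-- The length of an expression, literals being written in unary. -/
def len : Expr → ℕ
  | lit c => c + 1
  | var _ => 1
  | read _ i => i.len + 1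
  | bin _ a b => a.len + b.len + 1

end Expr

/-- All values stored in the state have at most `B` bits. -/
def State.Bdd (B : ℕ) (s : State) : Prop := (∀ x, s.var x < 2 ^ B) ∧ ∀ a i, s.arr a i < 2 ^ B

/-! ### Bit lengths of values and the cost of expressions. -/

theorem size_add_le (a b : ℕ) : Nat.size (a + b) ≤ Nat.size a + Nat.size b + 1 := by
  rw [Nat.size_le]
  have ha := Nat.lt_size_self a
  have hb := Nat.lt_size_self b
  have h1 : 2 ^ Nat.size a ≤ 2 ^ (Nat.size a + Nat.size b) := Nat.pow_le_pow_right (by simp) (by simp)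
  have h2 : 2 ^ Nat.size b ≤ 2 ^ (Nat.size a + Nat.size b) := Nat.pow_le_pow_right (by simp) (by simp)
  rw [pow_succ]; omega

theorem size_mul_le (a b : ℕ) : Nat.size (a * b) ≤ Nat.size a + Nat.size b := by
  rw [Nat.size_le, pow_add]
  exact Nat.mul_lt_mul'' (Nat.lt_size_self a) (Nat.lt_size_self b)

theorem size_le_self (a : ℕ) : Nat.size a ≤ a := Nat.size_le.2 Nat.lt_two_pow_self

/-- Only addition and multiplication can enlarge numbers, and even a product has at most the sum of
the bit lengths; hence a fixed expression enlarges bit lengths only by a constant factor. -/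
theorem Op.size_eval_le (o : Op) (a b : ℕ) :
    Nat.size (o.eval a b) ≤ Nat.size a + Nat.size b + 1 := by
  have mono {x : ℕ} (h : x ≤ a) : Nat.size x ≤ Nat.size a + Nat.size b + 1 :=
    (Nat.size_le_size h).trans (by omega)
  have bool {p : Prop} [Decidable p] :
      Nat.size (if p then 1 else 0) ≤ Nat.size a + Nat.size b + 1 := by
    split_ifs <;> simp
  cases o
  · exact size_add_le a b
  · exact mono (Nat.sub_le a b)
  · exact (size_mul_le a b).trans (by omega)
  · exact mono (Nat.div_le_self a b)
  · exact mono (Nat.mod_le a b)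
  · exact bool
  · exact bool

theorem Op.cost_le (o : Op) (a b : ℕ) : o.cost a b ≤ (Nat.size a + 1) * (Nat.size b + 1) := by
  cases o <;> simp only [Op.cost] <;> nlinarith [Nat.zero_le (Nat.size a * Nat.size b)]

theorem Expr.size_eval_le {B : ℕ} {s : State} (hs : s.Bdd B) (e : Expr) :
    Nat.size (e.eval s) ≤ e.len * (B + 1) := by
  induction e with
  | lit c =>
    have := size_le_self c
    simp only [Expr.eval, Expr.len]
    nlinarith [Nat.zero_le (c * B)]
  | var x => have := Nat.size_le.2 (hs.1 x); simp only [Expr.eval, Expr.len]; omega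
  | read a i ih =>
    have := Nat.size_le.2 (hs.2 a (i.eval s))
    simp only [Expr.eval, Expr.len]
    nlinarith
  | bin o a b iha ihb =>
    have := o.size_eval_le (a.eval s) (b.eval s)
    simp only [Expr.eval, Expr.len]
    nlinarith

/-- Multiplication and division force a quadratic bound: the cross term in the square of the total
length pays for the schoolbook product of the two operands. -/
theorem Expr.cost_le {B : ℕ} {s : State} (hs : s.Bdd B) (e : Expr) :
    e.cost s ≤ 4 * (e.len * (B + 1)) ^ 2 := by
  induction e with
  | lit c =>
    have := size_le_self c
    have h : (c + 1) * 1 ≤ (c + 1) * (B + 1) := by gcongr; omega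
    simp only [Expr.cost, Expr.len]
    nlinarith
  | var x =>
    have := Nat.size_le.2 (hs.1 x)
    simp only [Expr.cost, Expr.len]
    nlinarith
  | read a i ih =>
    have h1 := Nat.size_le.2 (hs.2 a (i.eval s))
    have h2 := i.size_eval_le hs
    simp only [Expr.cost, Expr.len]
    nlinarith [Nat.zero_le (i.len * (B + 1))]
  | bin o a b iha ihb =>
    have h := o.cost_le (a.eval s) (b.eval s)
    have ha := a.size_eval_le hs
    have hb := b.size_eval_le hs
    have hab : (Nat.size (a.eval s) + 1) * (Nat.size (b.eval s) + 1) ≤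
        (a.len * (B + 1) + 1) * (b.len * (B + 1) + 1) := by gcongr
    simp only [Expr.cost, Expr.len]
    nlinarith [Nat.zero_le (a.len * (B + 1)), Nat.zero_le (b.len * (B + 1)),
      Nat.zero_le ((a.len * (B + 1)) * (b.len * (B + 1)))]

/-- A time bound for one instruction in states with at most `B` bits in each cell. -/
def tick (B : ℕ) : ℕ := 10 ^ 7 * (B + 1) ^ 2

/-- The constant 10^7 absorbs 4 * 1000^2 and the extra unit charged by the instruction around the
expression. The cap 1000 leaves room for every expression in the program text. -/
theorem Expr.cost_le_tick {B : ℕ} {s : State} (hs : s.Bdd B) {e : Expr} (he : e.len ≤ 1000) :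
    e.cost s + 1 ≤ tick B := by
  have h1 := e.cost_le hs
  have h2 : (e.len * (B + 1)) ^ 2 ≤ (1000 * (B + 1)) ^ 2 := by gcongr
  unfold tick
  nlinarith [Nat.zero_le B]

theorem one_le_tick (B : ℕ) : 1 ≤ tick B := Nat.succ_le_of_lt (by unfold tick; positivity)

/-! ### Frames: what a program can change, read off from its text. -/

namespace Program

/-- The variables that a program may change. -/
def vars : Program → List ℕ
  | skip => []
  | assign x _ => [x]
  | write _ _ _ => []
  | flip x => [x]
  | seq p q => p.vars ++ q.vars
  | cond _ p q => p.vars ++ q.vars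
  | loop _ p => p.vars

/-- The arrays that a program may change. -/
def arrs : Program → List ℕ
  | skip => []
  | assign _ _ => []
  | write a _ _ => [a]
  | flip _ => []
  | seq p q => p.arrs ++ q.arrs
  | cond _ p q => p.arrs ++ q.arrs
  | loop _ p => p.arrs

/-- Whether a program contains no coin flips. -/
def flipFree : Program → Bool
  | skip => true
  | assign _ _ => true
  | write _ _ _ => true
  | flip _ => false
  | seq p q => p.flipFree && q.flipFree
  | cond _ p q => p.flipFree && q.flipFree
  | loop _ p => p.flipFree

end Program

/-- `s'` differs from `s` only in places that `p` may change. -/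
structure Frame (p : Program) (s s' : State) : Prop where
  var : ∀ x, x ∉ p.vars → s'.var x = s.var x
  arr : ∀ a, a ∉ p.arrs → s'.arr a = s.arr a
  used : p.flipFree = true → s'.used = s.used

theorem Frame.refl (p : Program) (s : State) : Frame p s s := ⟨by simp, by simp, by simp⟩

theorem Frame.of_sub {p q : Program} {s s' : State} (h : Frame p s s') (hv : p.vars ⊆ q.vars)
    (ha : p.arrs ⊆ q.arrs) (hf : q.flipFree = true → p.flipFree = true) : Frame q s s' :=
  ⟨fun x hx => h.var x fun h' => hx (hv h'), fun x hx => h.arr x fun h' => hx (ha h'),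
    fun hq => h.used (hf hq)⟩

theorem Frame.trans {p : Program} {s s₁ s₂ : State} (h₁ : Frame p s s₁) (h₂ : Frame p s₁ s₂) :
    Frame p s s₂ :=
  ⟨fun x hx => (h₂.var x hx).trans (h₁.var x hx), fun x hx => (h₂.arr x hx).trans (h₁.arr x hx),
    fun hq => (h₂.used hq).trans (h₁.used hq)⟩

namespace State

variable (s : State) (ω : ℕ → Bool) (x y a b i v : ℕ)

@[simp] theorem setVar_var_self : (s.setVar x v).var x = v := by simp [setVar]
@[simp] theorem setVar_arr : (s.setVar x v).arr = s.arr := rfl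
@[simp] theorem setVar_used : (s.setVar x v).used = s.used := rfl
@[simp] theorem setArr_var : (s.setArr a i v).var = s.var := rfl
@[simp] theorem setArr_used : (s.setArr a i v).used = s.used := rfl
@[simp] theorem setArr_arr_self : (s.setArr a i v).arr a = Function.update (s.arr a) i v := by
  simp [setArr]
@[simp] theorem setFlip_var_self :
    (s.setFlip ω x).var x = if ω s.used then 1 else 0 := by simp [setFlip]
@[simp] theorem setFlip_used : (s.setFlip ω x).used = s.used + 1 := rfl

variable {x y a b}

theorem setVar_var_ne (h : y ≠ x) : (s.setVar x v).var y = s.var y := by simp [setVar, h]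
theorem setArr_arr_ne (h : b ≠ a) : (s.setArr a i v).arr b = s.arr b := by simp [setArr, h]
theorem setFlip_var_ne (h : y ≠ x) : (s.setFlip ω x).var y = s.var y := by
  simp [setFlip, setVar, h]

variable {s i v} {B : ℕ}

theorem Bdd.setVar (hs : s.Bdd B) (hv : v < 2 ^ B) : (s.setVar x v).Bdd B := by
  refine ⟨fun y => ?_, hs.2⟩
  by_cases h : y = x
  · subst h; simpa using hv
  · rw [setVar_var_ne _ _ h]; exact hs.1 y

theorem Bdd.setArr (hs : s.Bdd B) (hv : v < 2 ^ B) : (s.setArr a i v).Bdd B := by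
  refine ⟨hs.1, fun b j => ?_⟩
  by_cases h : b = a
  · subst h
    by_cases h' : j = i
    · subst h'; simpa using hv
    · simpa [h'] using hs.2 b j
  · rw [setArr_arr_ne _ _ _ h]; exact hs.2 b j

end State

theorem Exec.frame {ω : ℕ → Bool} {p : Program} {s s' : State} {t : ℕ} (h : Exec ω p s t s') :
    Frame p s s' := by
  induction h with
  | skip s => exact .refl _ _
  | assign s x e =>
    exact ⟨fun y hy => State.setVar_var_ne _ _ (by simpa [Program.vars] using hy),
      fun _ _ => rfl, fun _ => rfl⟩
  | write s a i e =>
    exact ⟨fun _ _ => rfl,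
      fun y hy => State.setArr_arr_ne _ _ _ (by simpa [Program.arrs] using hy), fun _ => rfl⟩
  | flip s x =>
    exact ⟨fun y hy => State.setFlip_var_ne _ _ (by simpa [Program.vars] using hy),
      fun _ _ => rfl, fun h => by simp [Program.flipFree] at h⟩
  | seq _ _ ih₁ ih₂ =>
    exact (ih₁.of_sub (by simp [Program.vars]) (by simp [Program.arrs])
      (by simp +contextual [Program.flipFree])).trans
      (ih₂.of_sub (by simp [Program.vars]) (by simp [Program.arrs])
      (by simp +contextual [Program.flipFree]))
  | condTrue _ _ ih =>
    exact ih.of_sub (by simp [Program.vars]) (by simp [Program.arrs])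
      (by simp +contextual [Program.flipFree])
  | condFalse _ _ ih =>
    exact ih.of_sub (by simp [Program.vars]) (by simp [Program.arrs])
      (by simp +contextual [Program.flipFree])
  | loopTrue _ _ _ ih₁ ih₂ =>
    exact (ih₁.of_sub (by simp [Program.vars]) (by simp [Program.arrs])
      (by simp [Program.flipFree])).trans ih₂
  | loopFalse _ => exact .refl _ _

/-- Started in `s`, the program `p` halts after at most `m` ticks in a state with property `Q`,
provided that cells hold at most `B` bits initially; and then they do so in the end. -/
def Run (ω : ℕ → Bool) (B : ℕ) (p : Program) (s : State) (m : ℕ) (Q : State → Prop) : Prop :=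
  s.Bdd B → ∃ t s', Exec ω p s t s' ∧ t ≤ m * tick B ∧ s'.Bdd B ∧ Q s'

/-- `for x = 0, …, e - 1 do p` -/
def forLoop (x : ℕ) (e : Expr) (p : Program) : Program :=
  .seq (.assign x 0) (.loop (Expr.lt (.var x) e) (.seq p (.assign x (.var x + 1))))

namespace Run

variable {ω : ℕ → Bool} {B : ℕ} {p q : Program} {s : State} {m m₁ m₂ : ℕ} {Q Q₁ : State → Prop}
  {e : Expr}

theorem le (h : Run ω B p s m Q) (hm : m ≤ m₁) : Run ω B p s m₁ Q := fun hs =>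
  let ⟨t, s', h₁, h₂, h₃⟩ := h hs
  ⟨t, s', h₁, h₂.trans (Nat.mul_le_mul_right _ hm), h₃⟩

theorem imp (h : Run ω B p s m Q) (hQ : ∀ s', s'.Bdd B → Frame p s s' → Q s' → Q₁ s') :
    Run ω B p s m Q₁ := fun hs =>
  let ⟨t, s', h₁, h₂, h₃, h₄⟩ := h hs
  ⟨t, s', h₁, h₂, h₃, hQ s' h₃ h₁.frame h₄⟩

/-- Makes the bound on the initial cells available when the time or the loop bound is itself read
from a cell. -/
theorem of_bdd (h : s.Bdd B → Run ω B p s m Q) : Run ω B p s m Q := fun hs => h hs hs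

theorem skip (h : Q s) : Run ω B .skip s 1 Q := fun hs =>
  ⟨1, s, .skip s, by simpa using one_le_tick B, hs, h⟩

theorem assign {x : ℕ} (he : e.len ≤ 1000) (hb : s.Bdd B → e.eval s < 2 ^ B)
    (h : Q (s.setVar x (e.eval s))) : Run ω B (.assign x e) s 1 Q := fun hs =>
  ⟨_, _, .assign s x e, by simpa using e.cost_le_tick hs he, hs.setVar (hb hs), h⟩

theorem write {a : ℕ} {i : Expr} (he : e.len ≤ 1000) (hi : i.len ≤ 1000)
    (hb : s.Bdd B → e.eval s < 2 ^ B) (h : Q (s.setArr a (i.eval s) (e.eval s))) :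
    Run ω B (.write a i e) s 2 Q := fun hs =>
  ⟨_, _, .write s a i e, by
    have := e.cost_le_tick hs he
    have := i.cost_le_tick hs hi
    omega, hs.setArr (hb hs), h⟩

theorem flip {x : ℕ} (hB : 1 ≤ B) (h : Q (s.setFlip ω x)) : Run ω B (.flip x) s 1 Q := fun hs =>
  ⟨_, _, .flip s x, by simpa using one_le_tick B, by
    have hb : (if ω s.used then 1 else 0) < 2 ^ B := by
      have := Nat.one_lt_two_pow (n := B) (by omega)
      split_ifs <;> omega
    exact hs.setVar hb, h⟩

theorem seq (hp : Run ω B p s m₁ Q₁)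
    (hq : ∀ s', Frame p s s' → Q₁ s' → Run ω B q s' m₂ Q) :
    Run ω B (.seq p q) s (m₁ + m₂) Q := fun hs => by
  obtain ⟨t₁, s₁, h₁, ht₁, hs₁, hQ₁⟩ := hp hs
  obtain ⟨t₂, s₂, h₂, ht₂, hs₂, hQ₂⟩ := hq s₁ h₁.frame hQ₁ hs₁
  exact ⟨_, _, .seq h₁ h₂, by rw [add_mul]; exact Nat.add_le_add ht₁ ht₂, hs₂, hQ₂⟩

theorem assign_seq {x : ℕ} (he : e.len ≤ 1000) (hb : s.Bdd B → e.eval s < 2 ^ B)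
    (h : Run ω B q (s.setVar x (e.eval s)) m Q) :
    Run ω B (.seq (.assign x e) q) s (1 + m) Q :=
  .seq (Q₁ := fun s' => s' = s.setVar x (e.eval s)) (.assign he hb rfl)
    (by rintro _ - rfl; exact h)

theorem write_seq {a : ℕ} {i : Expr} (he : e.len ≤ 1000) (hi : i.len ≤ 1000)
    (hb : s.Bdd B → e.eval s < 2 ^ B)
    (h : Run ω B q (s.setArr a (i.eval s) (e.eval s)) m Q) :
    Run ω B (.seq (.write a i e) q) s (2 + m) Q :=
  .seq (Q₁ := fun s' => s' = s.setArr a (i.eval s) (e.eval s)) (.write he hi hb rfl)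
    (by rintro _ - rfl; exact h)

theorem cond (he : e.len ≤ 1000) (hp : e.eval s ≠ 0 → Run ω B p s m Q)
    (hq : e.eval s = 0 → Run ω B q s m Q) : Run ω B (.cond e p q) s (1 + m) Q := fun hs => by
  have hc := e.cost_le_tick hs he
  by_cases h : e.eval s = 0
  · obtain ⟨t, s', h₁, h₂, h₃⟩ := hq h hs
    exact ⟨_, s', .condFalse h h₁, by rw [add_mul]; omega, h₃⟩
  · obtain ⟨t, s', h₁, h₂, h₃⟩ := hp h hs
    exact ⟨_, s', .condTrue h h₁, by rw [add_mul]; omega, h₃⟩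

theorem forLoop {I : ℕ → State → Prop} {x n τ : ℕ} (hx : x ∉ p.vars)
    (he : e.len ≤ 900) (hn : n < 2 ^ B)
    (hev : ∀ s', Frame (forLoop x e p) s s' → e.eval s' = n)
    (h0 : I 0 (s.setVar x 0))
    (hstep : ∀ i < n, ∀ s', Frame (RAM.forLoop x e p) s s' → s'.var x = i → I i s' →
      Run ω B p s' τ fun s'' => Frame p s' s'' → I (i + 1) (s''.setVar x (i + 1))) :
    Run ω B (RAM.forLoop x e p) s (n * (τ + 2) + 2) (I n) := by
  -- Induction on the number `k` of rounds still to come, for an arbitrary current counter `i`.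
  have main : ∀ k i s', n = i + k → Frame (RAM.forLoop x e p) s s' → s'.var x = i → I i s' →
      Run ω B (.loop (Expr.lt (.var x) e) (.seq p (.assign x (.var x + 1)))) s'
        (k * (τ + 2) + 1) (I n) := by
    intro k
    induction k with
    | zero =>
      intro i s' hi hf hxi hI hs
      have hc := (Expr.lt (.var x) e).cost_le_tick hs (by simp only [Expr.len]; omega)
      exact ⟨_, s', .loopFalse (by simp [hev s' hf, hxi, hi]), by simpa using hc, hs,
        by simpa [hi] using hI⟩
    | succ k ih =>
      intro i s' hi hf hxi hI hs
      have hc := (Expr.lt (.var x) e).cost_le_tick hs (by simp only [Expr.len]; omega)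
      obtain ⟨t₁, s₁, h₁, ht₁, hs₁, hQ₁⟩ := hstep i (by omega) s' hf hxi hI hs
      have hx1 : s₁.var x = i := (h₁.frame.var x hx).trans hxi
      have ha : Exec ω (.assign x (.var x + 1)) s₁ _ _ := .assign s₁ x _
      have hca := (Expr.var x + 1).cost_le_tick hs₁ (show 4 ≤ 1000 by decide)
      have hev1 : (Expr.var x + 1).eval s₁ = i + 1 := by simp [hx1]
      rw [hev1] at ha
      have hsa := hs₁.setVar (x := x) (v := i + 1) (by omega)
      have hf1 : Frame (RAM.forLoop x e p) s' (s₁.setVar x (i + 1)) :=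
        (h₁.frame.of_sub (by simp [RAM.forLoop, Program.vars])
          (by simp [RAM.forLoop, Program.arrs])
          (by simp [RAM.forLoop, Program.flipFree])).trans
        (ha.frame.of_sub (by simp [RAM.forLoop, Program.vars])
          (by simp [RAM.forLoop, Program.arrs])
          (by simp [RAM.forLoop, Program.flipFree]))
      obtain ⟨t₂, s₂, h₂, ht₂, hs₂, hQ₂⟩ :=
        ih (i + 1) _ (by omega) (hf.trans hf1) (by simp) (hQ₁ h₁.frame) hsa
      refine ⟨_, s₂, .loopTrue (by simp [hev s' hf, hxi]; omega) (.seq h₁ ha) h₂, ?_, hs₂, hQ₂⟩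
      have : (k + 1) * (τ + 2) + 1 = 1 + (τ + 1) + (k * (τ + 2) + 1) := by ring
      rw [this, add_mul, add_mul, add_mul]
      omega
  refine (Run.assign_seq (m := n * (τ + 2) + 1) (by decide) (fun _ => by simp) ?_).le (by omega)
  refine main n 0 _ (by simp) ?_ (by simp) h0
  exact (Exec.assign (ω := ω) s x 0).frame.of_sub (by simp [RAM.forLoop, Program.vars])
    (by simp [RAM.forLoop, Program.arrs]) (by simp [RAM.forLoop, Program.flipFree])

end Run

end RAM

namespace RAM

/-! ### Registers and arrays of the program -/

namespace Reg
abbrev ans : ℕ := 0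
abbrev n : ℕ := 1
abbrev N : ℕ := 2
abbrev k : ℕ := 3
abbrev s : ℕ := 4
abbrev t : ℕ := 5
abbrev oG : ℕ := 6
abbrev oT : ℕ := 7
abbrev oB : ℕ := 8
abbrev Q : ℕ := 9
abbrev M : ℕ := 10
abbrev R : ℕ := 11
abbrev P : ℕ := 12
abbrev l : ℕ := 13
abbrev J : ℕ := 14
abbrev md : ℕ := 15
abbrev i : ℕ := 16
abbrev u : ℕ := 17
abbrev v : ℕ := 18
abbrev c : ℕ := 19
abbrev r : ℕ := 20
abbrev x : ℕ := 21
abbrev y : ℕ := 22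
abbrev val : ℕ := 23
abbrev code : ℕ := 24
abbrev cnt : ℕ := 25
abbrev size : ℕ := 26
abbrev cur : ℕ := 27
abbrev wt : ℕ := 28
abbrev bit : ℕ := 29
abbrev e : ℕ := 30
abbrev b : ℕ := 31
abbrev j : ℕ := 32
end Reg

namespace Arr
abbrev word : ℕ := 0
abbrev wt : ℕ := 1
abbrev ord : ℕ := 2
abbrev par : ℕ := 3
abbrev vis : ℕ := 4
abbrev col : ℕ := 5
abbrev tab : ℕ := 6
end Arr

infixr:50 " ;; " => Program.seq
infix:60 " ::= " => Program.assign

open RAM.Expr (var read)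
open RAM.Program (write skip cond)

/-! ### Numerical parameters -/

/-- `y := b ^ e`, with counter `i` -/
def powLoop (y i : ℕ) (b e : Expr) : Program := y ::= 1 ;; forLoop i e (y ::= var y * b)

/-- Base and exponent are expressions evaluated afresh in each round, hence the hypotheses over all
states in the frame. With base at least 1 the intermediate powers are bounded by the last one, so
only the final value must fit into a cell. -/
theorem run_powLoop {ω : ℕ → Bool} {B y i bv n : ℕ} {b e : Expr} {s : State} (hyi : y ≠ i)
    (hb : ∀ s', Frame (powLoop y i b e) s s' → b.eval s' = bv)
    (he : ∀ s', Frame (powLoop y i b e) s s' → e.eval s' = n)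
    (hbl : b.len ≤ 900) (hel : e.len ≤ 900)
    (hn : n < 2 ^ B) (h1 : 1 ≤ bv) (hpow : bv ^ n < 2 ^ B) :
    Run ω B (powLoop y i b e) s (n * 3 + 3) fun s' => s'.var y = bv ^ n := by
  have hsub : ∀ s', Frame (forLoop i e (y ::= var y * b)) (s.setVar y 1) s' →
      Frame (powLoop y i b e) s s' := by
    intro s' h
    refine Frame.trans (s₁ := s.setVar y 1)
      ⟨fun x hx => ?_, fun _ _ => rfl, fun _ => rfl⟩
      (h.of_sub (by simp [powLoop, forLoop, Program.vars]) (by simp [powLoop, Program.arrs])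
        (by simp [powLoop, Program.flipFree]))
    exact State.setVar_var_ne _ _ (by rintro rfl; simp [powLoop, Program.vars] at hx)
  have : 1 ≤ bv ^ n := Nat.one_le_pow _ _ h1
  refine (Run.assign_seq (by decide) (fun _ => by rw [Expr.eval_one]; omega) ?_).le
    (m := 1 + (n * (1 + 2) + 2))
    (by omega)
  refine Run.forLoop (I := fun k s' => s'.var y = bv ^ k) (by simpa [Program.vars] using hyi.symm)
    hel hn (fun s' h => he s' (hsub s' h)) ?_ ?_
  · rw [State.setVar_var_ne _ _ hyi]; simp
  · intro k hk s' hf _ hI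
    have hev : (var y * b).eval s' = bv ^ (k + 1) := by simp [hI, hb s' (hsub s' hf), pow_succ]
    refine Run.assign (show 1 + b.len + 1 ≤ 1000 by omega) (fun _ => ?_) fun _ => ?_
    · rw [hev]; exact (Nat.pow_le_pow_right h1 hk).trans_lt hpow
    · rw [State.setVar_var_ne _ _ hyi, hev]; simp

/-- The number of random bits for one weight. -/
def weightBits (n : ℕ) : ℕ := Nat.clog 2 (2 * n)

/-- A strict upper bound for the size of a cut. -/
def cutBound (n : ℕ) : ℕ := n * n + 1

/-- A strict upper bound for the exponents. -/
def expBound (n : ℕ) : ℕ := cutBound n * ((n + 1) * 2 ^ weightBits n + 1)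

/-- The range of weights that the isolation lemma needs for error 1/2. -/
theorem le_two_pow_weightBits (n : ℕ) : 2 * n ≤ 2 ^ weightBits n := Nat.le_pow_clog (by simp) _

theorem weightBits_le (n : ℕ) : weightBits n ≤ 2 * n :=
  Nat.clog_le_of_le_pow Nat.lt_two_pow_self.le

theorem two_pow_weightBits_le (n : ℕ) : 2 ^ weightBits n ≤ 4 * n + 1 := by
  rcases h : weightBits n with _ | l
  · simp
  · have : 2 ^ l < 2 * n := (Nat.lt_clog_iff_pow_lt (by simp)).1 (by unfold weightBits at h; omega)
    rw [pow_succ]; omega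

/-- Computes the numerical parameters. -/
def paramProg : Program :=
  Reg.oT ::= var Reg.oG + var Reg.n * var Reg.n ;;
  Reg.oB ::= var Reg.oT + var Reg.N * var Reg.N ;;
  powLoop Reg.Q Reg.i 4 (var Reg.n + 1) ;;
  Reg.M ::= var Reg.n * var Reg.n + 1 ;;
  powLoop Reg.R Reg.i (var Reg.Q) (var Reg.M) ;;
  Reg.P ::= 1 ;;
  Reg.l ::= 0 ;;
  forLoop Reg.i (2 * var Reg.n) (cond (Expr.lt (var Reg.P) (2 * var Reg.n))
    (Reg.P ::= 2 * var Reg.P ;; Reg.l ::= var Reg.l + 1) skip) ;;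
  Reg.J ::= var Reg.M * ((var Reg.n + 1) * var Reg.P + 1) ;;
  powLoop Reg.md Reg.i (var Reg.Q) (var Reg.J)

/-- Apart from the input offsets, the modulus Q^J is the largest number computed here, so requiring
it to fit into a cell bounds all other parameters. -/
theorem run_paramProg {ω : ℕ → Bool} {B n N o : ℕ} {s : State} (hn : s.var Reg.n = n)
    (hN : s.var Reg.N = N) (ho : s.var Reg.oG = o)
    (hoB : o + n * n + N * N < 2 ^ B) (hB : (4 ^ (n + 1)) ^ expBound n < 2 ^ B) :
    Run ω B paramProg s (3 * n + 3 * cutBound n + 10 * n + 3 * expBound n + 30) fun s' =>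
      s'.var Reg.oT = o + n * n ∧ s'.var Reg.oB = o + n * n + N * N ∧
      s'.var Reg.Q = 4 ^ (n + 1) ∧ s'.var Reg.M = cutBound n ∧
      s'.var Reg.R = (4 ^ (n + 1)) ^ cutBound n ∧ s'.var Reg.l = weightBits n ∧
      s'.var Reg.J = expBound n ∧ s'.var Reg.md = (4 ^ (n + 1)) ^ expBound n := by
  have hP := Nat.one_le_two_pow (n := weightBits n)
  have hM1 : 1 ≤ cutBound n := by simp [cutBound]
  have hMJ : cutBound n ≤ expBound n := Nat.le_mul_of_pos_right _ (by omega)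
  have hnM : n ≤ cutBound n := by unfold cutBound; nlinarith
  have hPJ : 2 ^ weightBits n ≤ expBound n := by
    unfold expBound
    calc 2 ^ weightBits n ≤ (n + 1) * 2 ^ weightBits n + 1 := by nlinarith
      _ ≤ _ := Nat.le_mul_of_pos_left _ hM1
  have hQ1 : 1 ≤ 4 ^ (n + 1) := Nat.one_le_pow _ _ (by simp)
  have hJ : expBound n < 2 ^ B := by
    refine (Nat.lt_pow_self (n := expBound n) (a := 4 ^ (n + 1)) ?_).trans hB
    exact Nat.one_lt_pow (by simp) (by simp)
  have hR : (4 ^ (n + 1)) ^ cutBound n < 2 ^ B := (Nat.pow_le_pow_right hQ1 hMJ).trans_lt hB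
  have hQ : 4 ^ (n + 1) < 2 ^ B := by
    refine lt_of_le_of_lt ?_ hR
    simpa using Nat.pow_le_pow_right hQ1 hM1
  have hn1 : 2 * n + 1 < 2 ^ B := by
    have : 2 * n + 1 < 4 ^ (n + 1) := by
      rw [pow_succ]; have : n < 4 ^ n := Nat.lt_pow_self (by simp)
      omega
    omega
  unfold paramProg
  -- The bound is nested like the program: 3 per round of a power loop, 5 per round of the loop that
  -- doubles `P`, and 1 per assignment.
  refine Run.le (m := 1 + (1 + (((n + 1) * 3 + 3) + (1 + ((cutBound n * 3 + 3) + (1 + (1 +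
    ((2 * n * (3 + 2) + 2) + (1 + (expBound n * 3 + 3)))))))))) ?_ (by omega)
  refine Run.assign_seq (by decide) (fun _ => by simp [hn, ho]; omega) ?_
  refine Run.assign_seq (by decide) (fun _ => by
    simp (disch := decide) [State.setVar_var_ne, hn, hN, ho]; omega) ?_
  refine Run.seq (run_powLoop (bv := 4) (n := n + 1) (by decide) (fun _ _ => by simp) (fun s' h => by
    simp (disch := decide) [h.var, State.setVar_var_ne, hn]) (by decide) (by decide)
    (by omega) (by simp) hQ) fun s₁ f₁ h₁ => ?_
  refine Run.assign_seq (by decide) (fun _ => by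
    simp (disch := decide) [f₁.var, State.setVar_var_ne, hn]
    simp only [cutBound] at hMJ; omega) ?_
  have hMe : (var Reg.n * var Reg.n + 1).eval s₁ = cutBound n := by
    simp (disch := decide) [f₁.var, State.setVar_var_ne, hn, cutBound]
  rw [hMe]
  refine Run.seq (run_powLoop (bv := 4 ^ (n + 1)) (n := cutBound n) (by decide) (fun s' h => by
    simp (disch := decide) [h.var, State.setVar_var_ne, h₁]) (fun s' h => by
    simp (disch := decide) [h.var]) (by decide) (by decide)
    (by omega) hQ1 hR) fun s₂ f₂ h₂ => ?_
  refine Run.assign_seq (by decide) (fun _ => by rw [Expr.eval_one]; omega) ?_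
  refine Run.assign_seq (by decide) (fun _ => by simp) ?_
  refine Run.seq (Run.forLoop (n := 2 * n) (τ := 3) (I := fun i s' =>
    s'.var Reg.l = min i (weightBits n) ∧ s'.var Reg.P = 2 ^ min i (weightBits n))
    (by decide) (by decide) (by omega) (fun s' h => by
    simp (disch := decide) [h.var, State.setVar_var_ne, f₂.var, f₁.var, hn]) ?_ ?_)
    fun s₃ f₃ h₃ => ?_
  · simp (disch := decide) [State.setVar_var_ne]
  · rintro i hi s' f - ⟨hl, hp⟩
    have hn' : s'.var Reg.n = n := by
      simp (disch := decide) [f.var, State.setVar_var_ne, f₂.var, f₁.var, hn]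
    -- The test `P < 2 * n` succeeds exactly while the exponent of `P` is below the rounded-up
    -- logarithm; afterwards the remaining rounds do nothing.
    have hiff : 2 ^ min i (weightBits n) < 2 * n ↔ min i (weightBits n) < weightBits n :=
      (Nat.lt_clog_iff_pow_lt (by simp)).symm
    refine (Run.cond (m := 2) (by decide) (fun h => ?_) (fun h => ?_)).le le_rfl
    · simp only [Expr.eval_lt, Expr.eval_var, hp, Expr.eval_mul, Expr.eval_two, hn', hiff] at h
      have h' : i < weightBits n := by simpa using h
      have e1 : min i (weightBits n) = i := by omega
      have e2 : min (i + 1) (weightBits n) = i + 1 := by omega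
      have hle : 2 ^ (i + 1) ≤ 2 ^ weightBits n := Nat.pow_le_pow_right (by simp) h'
      have hi2 : i + 1 < 2 ^ (i + 1) := Nat.lt_two_pow_self
      rw [e1] at hl hp
      refine Run.assign_seq (m := 1) (by decide) (fun _ => ?_) ?_
      · simp only [Expr.eval_mul, Expr.eval_var, hp, Expr.eval_two]; rw [pow_succ] at hle; omega
      · refine Run.assign (by decide) (fun _ => ?_) fun _ => ?_
        · simp (disch := decide) [State.setVar_var_ne, hl]; omega
        · simp (disch := decide) [State.setVar_var_ne, hl, hp, e2, pow_succ, mul_comm]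
    · simp only [Expr.eval_lt, Expr.eval_var, hp, Expr.eval_mul, Expr.eval_two, hn', hiff] at h
      have h' : weightBits n ≤ i := by simpa using h
      have e1 : min i (weightBits n) = weightBits n := by omega
      have e2 : min (i + 1) (weightBits n) = weightBits n := by omega
      refine (Run.skip fun _ => ?_).le (by simp)
      simp (disch := decide) [State.setVar_var_ne, hl, hp, e1, e2]
  rw [min_eq_right (weightBits_le n)] at h₃
  have hM3 : s₃.var Reg.M = cutBound n := by
    simp (disch := decide) [f₃.var, f₂.var, State.setVar_var_ne]
  have hn3 : s₃.var Reg.n = n := by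
    simp (disch := decide) [f₃.var, f₂.var, f₁.var, State.setVar_var_ne, hn]
  have hJe : (var Reg.M * ((var Reg.n + 1) * var Reg.P + 1)).eval s₃ = expBound n := by
    simp [hM3, hn3, h₃.2, expBound]
  refine Run.assign_seq (by decide) (fun _ => by rwa [hJe]) ?_
  rw [hJe]
  refine (run_powLoop (bv := 4 ^ (n + 1)) (n := expBound n) (by decide) (fun s' h => by
    simp (disch := decide) [h.var, State.setVar_var_ne, f₃.var, f₂.var, h₁]) (fun s' h => by
    simp (disch := decide) [h.var]) (by decide) (by decide)
    hJ hQ1 hB).imp fun s₄ _ f₄ h₄ => ?_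
  simp (disch := decide) [f₄.var, State.setVar_var_ne, f₃.var, f₂.var, f₁.var, h₁, h₂, h₃, h₄,
    hn, hN, ho]

end RAM

namespace RAM
open RAM.Expr (var read)
open RAM.Program (write skip cond)

/-! ### Random weights -/

/-- The weight of `u` written in the `l` random bits with indices `u * l, …, u * l + l - 1`. -/
def weight (ω : ℕ → Bool) (l u : ℕ) : ℕ :=
  ∑ j ∈ Finset.range l, if ω (u * l + j) then 2 ^ j else 0

theorem sum_bits_lt (f : ℕ → Bool) (l : ℕ) :
    ∑ j ∈ Finset.range l, (if f j then 2 ^ j else 0) < 2 ^ l := by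
  induction l with
  | zero => simp
  | succ l ih => rw [Finset.sum_range_succ, pow_succ]; split_ifs <;> omega

/-- Computes the powers of `R` with random weights as exponents. -/
def weightProg : Program :=
  forLoop Reg.u (var Reg.n) (
    Reg.wt ::= 1 ;;
    Reg.cur ::= var Reg.R ;;
    forLoop Reg.i (var Reg.l) (
      .flip Reg.bit ;;
      Reg.wt ::= var Reg.wt * Expr.ite (var Reg.bit) (var Reg.cur) 1 ;;
      Reg.cur ::= var Reg.cur * var Reg.cur) ;;
    write Arr.wt (var Reg.u) (var Reg.wt))

/-- Exponentiation by squaring with the coins as binary digits. The count of consumed coins is part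
of the invariant: it guarantees that vertex `k` reads exactly the block of `l` bits starting at `k *
l`. The register `cur` is squared once more than needed, so R^(2^l) itself has to fit. -/
theorem run_weightProg {ω : ℕ → Bool} {B n l R : ℕ} {s : State} (hn : s.var Reg.n = n)
    (hl : s.var Reg.l = l) (hR : s.var Reg.R = R) (hu : s.used = 0) (hB : 1 ≤ B)
    (hR1 : 1 ≤ R) (hRB : R ^ 2 ^ l < 2 ^ B) (hnB : n < 2 ^ B) (hlB : l < 2 ^ B) :
    Run ω B weightProg s (n * (l * 5 + 8) + 2) fun s' =>
      ∀ u < n, s'.arr Arr.wt u = R ^ weight ω l u := by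
  have hB1 : 1 < 2 ^ B := Nat.one_lt_two_pow (by omega)
  have hle : ∀ a ≤ 2 ^ l, R ^ a < 2 ^ B := fun a ha => (Nat.pow_le_pow_right hR1 ha).trans_lt hRB
  refine Run.le (m := n * ((1 + (1 + ((l * ((1 + (1 + 1)) + 2) + 2) + 2))) + 2) + 2) ?_
    (by ring_nf; omega)
  refine (Run.forLoop (n := n) (I := fun k s' => s'.used = k * l ∧
    ∀ u < k, s'.arr Arr.wt u = R ^ weight ω l u) (by decide) (by decide) hnB
    (fun s' h => by simp (disch := decide) [h.var, hn]) (by simp [hu]) ?_).imp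
    fun s' _ _ h => h.2
  rintro k hk s' f hk' ⟨hu', hw⟩
  refine Run.assign_seq (by decide) (fun _ => by rw [Expr.eval_one]; omega) ?_
  refine Run.assign_seq (by decide) (fun h => h.1 _) ?_
  refine Run.seq (Run.forLoop (n := l) (I := fun i s₁ => s₁.used = k * l + i ∧
    s₁.var Reg.wt = R ^ (∑ j ∈ Finset.range i, if ω (k * l + j) then 2 ^ j else 0) ∧
    s₁.var Reg.cur = R ^ 2 ^ i) (by decide) (by decide) hlB
    (fun s' h => by simp (disch := decide) [h.var, State.setVar_var_ne, f.var, hl]) ?_ ?_)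
    fun s₁ f₁ h₁ => ?_
  · simp (disch := decide) [State.setVar_var_ne, hu', f.var, hR]
  · rintro i hi s₁ f₁ hi' ⟨ha, hb, hc⟩
    have h2i : 2 ^ (i + 1) ≤ 2 ^ l := Nat.pow_le_pow_right (by simp) hi
    have hsum := sum_bits_lt (fun j => ω (k * l + j)) (i + 1)
    refine Run.seq (Run.flip (Q := fun s₂ => s₂ = s₁.setFlip ω Reg.bit) hB rfl) ?_
    rintro _ - rfl
    have hev : (var Reg.wt * Expr.ite (var Reg.bit) (var Reg.cur) 1).eval
        (s₁.setFlip ω Reg.bit) =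
        R ^ (∑ j ∈ Finset.range (i + 1), if ω (k * l + j) then 2 ^ j else 0) := by
      simp (disch := decide) only [Expr.eval_mul, Expr.eval_ite, Expr.eval_var, Expr.eval_one,
        State.setFlip_var_self, State.setFlip_var_ne, hb, hc, ha, Finset.sum_range_succ, pow_add]
      by_cases h : ω (k * l + i) <;> simp [h]
    refine Run.assign_seq (m := 1) (by decide) (fun _ => ?_) ?_
    · rw [hev]; exact hle _ (hsum.le.trans h2i)
    rw [hev]
    have hev2 : (var Reg.cur * var Reg.cur).eval ((s₁.setFlip ω Reg.bit).setVar Reg.wt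
        (R ^ (∑ j ∈ Finset.range (i + 1), if ω (k * l + j) then 2 ^ j else 0))) =
        R ^ 2 ^ (i + 1) := by
      simp (disch := decide) only [Expr.eval_mul, Expr.eval_var, State.setVar_var_ne,
        State.setFlip_var_ne, hc]
      rw [← pow_add, pow_succ, mul_two]
    refine Run.assign (by decide) (fun _ => hev2 ▸ hle _ h2i) fun _ => ?_
    rw [hev2]
    simp (disch := decide) only [State.setVar_var_ne, State.setVar_var_self, State.setVar_used,
      State.setFlip_used, ha, add_assoc, and_self]
  · refine Run.write (by decide) (by decide) (fun h => h.1 _) fun _ => ?_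
    have hku : s₁.var Reg.u = k := by
      simp (disch := decide) [f₁.var, State.setVar_var_ne, hk']
    refine ⟨by simp [h₁.1]; ring, fun u hu2 => ?_⟩
    simp only [State.setVar_arr, State.setArr_arr_self, Expr.eval_var, hku, h₁.2.1]
    rcases Nat.lt_succ_iff_lt_or_eq.1 hu2 with h | rfl
    · rw [Function.update_of_ne h.ne]
      simp (disch := decide) [f₁.arr, hw u h]
    · simp [weight]

/-! ### Ordering the nodes of the tree -/

/-- Orders the nodes of the tree so that each node but the first is adjacent to an earlier one,
its parent. The first node gets the imaginary parent `N`. -/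
def orderProg : Program :=
  write Arr.vis 0 1 ;;
  write Arr.par 0 (var Reg.N) ;;
  write Arr.ord (var Reg.N) (var Reg.N) ;;
  forLoop Reg.cnt (var Reg.N - 1) (
    Reg.r ::= var Reg.cnt + 1 ;;
    Reg.b ::= 0 ;;
    forLoop Reg.e (var Reg.r * var Reg.N) (
      cond (Expr.eq (read Arr.vis (var Reg.e % var Reg.N)) 0 *
          read Arr.word (var Reg.oT + read Arr.ord (var Reg.e / var Reg.N) * var Reg.N +
            var Reg.e % var Reg.N))
        (Reg.b ::= var Reg.e) skip) ;;
    write Arr.ord (var Reg.r) (var Reg.b % var Reg.N) ;;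
    write Arr.par (var Reg.r) (var Reg.b / var Reg.N) ;;
    write Arr.vis (var Reg.b % var Reg.N) 1)

/-- `ord` enumerates the nodes `0, …, N - 1` of the graph with adjacency relation `T` so that each
node but the first is adjacent to an earlier one, whose rank is given by `par`. -/
structure SearchOrder (N : ℕ) (T : ℕ → ℕ → Prop) (ord par : ℕ → ℕ) : Prop where
  ord_lt : ∀ r < N, ord r < N
  inj : ∀ r < N, ∀ r' < N, ord r = ord r' → r = r'
  par_lt : ∀ r < N, r ≠ 0 → par r < r
  adj : ∀ r < N, r ≠ 0 → T (ord (par r)) (ord r)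
  par_zero : par 0 = N
  ord_last : ord N = N

/-- Graph search by brute force: as long as a node is unvisited, connectivity (`hconn`) supplies an
edge leaving the visited set, and the scan over all pairs of a visited rank and a node keeps the
last such edge. The node of rank 0 is node 0. -/
theorem run_orderProg {ω : ℕ → Bool} {B N o : ℕ} {s : State} (hN : s.var Reg.N = N)
    (ho : s.var Reg.oT = o) (hord : s.arr Arr.ord = fun _ => 0)
    (hvis : s.arr Arr.vis = fun _ => 0) (hB : 1 ≤ B) (hN0 : 0 < N) (hNB : N * N < 2 ^ B)
    (hconn : ∀ U : ℕ → Prop, U 0 → (∃ j < N, ¬ U j) →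
      ∃ i < N, ∃ j < N, U i ∧ ¬ U j ∧ s.arr Arr.word (o + i * N + j) ≠ 0) :
    Run ω B orderProg s (N * (N * N * 4 + 12) + 10) fun s' =>
      SearchOrder N (fun i j => s.arr Arr.word (o + i * N + j) ≠ 0)
        (s'.arr Arr.ord) (s'.arr Arr.par) := by
  have hB1 : 1 < 2 ^ B := Nat.one_lt_two_pow (by omega)
  have hNN : N ≤ N * N := Nat.le_mul_of_pos_left _ hN0
  refine Run.le (m := 2 + (2 + (2 + ((N - 1) * ((1 + (1 + ((N * N * ((1 + 1) + 2) + 2) +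
    (2 + (2 + 2))))) + 2) + 2)))) ?_ ?_
  swap
  · have : (N - 1) * (1 + (1 + (N * N * (1 + 1 + 2) + 2 + (2 + (2 + 2)))) + 2) ≤
      N * (N * N * 4 + 12) := Nat.mul_le_mul (by omega) (by omega)
    omega
  unfold orderProg
  refine Run.write_seq (by decide) (by decide) (fun _ => by rw [Expr.eval_one]; omega) ?_
  refine Run.write_seq (by decide) (by decide) (fun h => h.1 _) ?_
  refine Run.write_seq (by decide) (by decide) (fun h => h.1 _) ?_
  refine (Run.forLoop (n := N - 1) (I := fun k s' =>
    (∀ r ≤ k, s'.arr Arr.ord r < N) ∧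
    (∀ r ≤ k, ∀ r' ≤ k, s'.arr Arr.ord r = s'.arr Arr.ord r' → r = r') ∧
    (∀ r ≤ k, r ≠ 0 → s'.arr Arr.par r < r) ∧
    (∀ r ≤ k, r ≠ 0 → s.arr Arr.word
      (o + s'.arr Arr.ord (s'.arr Arr.par r) * N + s'.arr Arr.ord r) ≠ 0) ∧
    s'.arr Arr.par 0 = N ∧ s'.arr Arr.ord N = N ∧ s'.arr Arr.ord 0 = 0 ∧
    ∀ j, s'.arr Arr.vis j ≠ 0 ↔ ∃ r ≤ k, s'.arr Arr.ord r = j) (by decide) (by decide) (by omega)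
    (fun s' h => by simp (disch := decide) [h.var, hN]) ?_ ?_).imp
    fun s' _ _ h => ?_
  · have h0 : Function.update (fun _ : ℕ => 0) N N 0 = 0 := Function.update_of_ne hN0.ne _ _
    simp (disch := decide) [State.setArr_arr_ne, hord, hvis, hN, hN0, h0]
    intro j
    by_cases hj : j = 0
    · subst hj; simp
    · simp [Function.update_of_ne hj, Ne.symm hj]
  · rintro k hk s' f hk' ⟨h1, h2, h3, h4, h5, h6, h7, h8⟩
    have hN' : s'.var Reg.N = N := by simp (disch := decide) [f.var, hN]
    have ho' : s'.var Reg.oT = o := by simp (disch := decide) [f.var, ho]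
    have hw' : s'.arr Arr.word = s.arr Arr.word := by
      simp (disch := decide) [f.arr, State.setArr_arr_ne]
    have hkN : (k + 1) * N ≤ N * N := Nat.mul_le_mul_right _ (by omega)
    refine Run.assign_seq (by decide) (fun _ => by
      simp only [Expr.eval_add, Expr.eval_var, Expr.eval_one, hk']; omega) ?_
    refine Run.assign_seq (by decide) (fun _ => by simp) ?_
    refine Run.seq (m₁ := N * N * ((1 + 1) + 2) + 2) ((Run.forLoop (n := (k + 1) * N) (τ := 1 + 1)
      (I := fun e s₁ =>
      (∃ e' < e, s'.arr Arr.vis (e' % N) = 0 ∧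
        s.arr Arr.word (o + s'.arr Arr.ord (e' / N) * N + e' % N) ≠ 0) →
      s₁.var Reg.b < (k + 1) * N ∧ s'.arr Arr.vis (s₁.var Reg.b % N) = 0 ∧
        s.arr Arr.word (o + s'.arr Arr.ord (s₁.var Reg.b / N) * N + s₁.var Reg.b % N) ≠ 0)
      (by decide) (by decide) (by omega)
      (fun s' h => by simp (disch := decide) [h.var, State.setVar_var_ne, hN', hk']) ?_ ?_).le
        (by gcongr)) fun s₁ f₁ h₁ => ?_
    · rintro ⟨_, h, -⟩; omega
    · rintro e he s₁ f₁ he' hI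
      have hev : (Expr.eq (read Arr.vis (var Reg.e % var Reg.N)) 0 *
          read Arr.word (var Reg.oT + read Arr.ord (var Reg.e / var Reg.N) * var Reg.N +
            var Reg.e % var Reg.N)).eval s₁ ≠ 0 ↔ s'.arr Arr.vis (e % N) = 0 ∧
          s.arr Arr.word (o + s'.arr Arr.ord (e / N) * N + e % N) ≠ 0 := by
        simp (disch := decide) [f₁.var, f₁.arr, State.setVar_var_ne, hN', he', ho', hw']
      refine Run.cond (by decide) (fun h => ?_) (fun h => ?_)
      · rw [hev] at h
        refine Run.assign (by decide) (fun h => h.1 _) fun _ _ => ?_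
        simp (disch := decide) only [State.setVar_var_ne, State.setVar_var_self, Expr.eval_var, he']
        exact ⟨he, h⟩
      · refine Run.skip fun _ => ?_
        rintro ⟨e', he'', h'⟩
        simp (disch := decide) only [State.setVar_var_ne]
        refine hI ⟨e', ?_, h'⟩
        rcases Nat.lt_succ_iff_lt_or_eq.1 he'' with hlt | rfl
        · exact hlt
        · exact absurd h (hev.2 h')
    -- The scan must have succeeded: at most `k + 1 < N` nodes are visited, so an unvisited one
    -- exists, and the crossing edge from rank `r` to node `j` has the number `r * N + j`.
    · obtain ⟨hbl, hbv, hbw⟩ := h₁ (by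
        obtain ⟨i, hi, j, hj, hUi, hUj, hT⟩ := hconn (fun j => s'.arr Arr.vis j ≠ 0)
          ((h8 0).2 ⟨0, by simp, h7⟩) (by
            by_contra! hall
            have hinj : Set.InjOn (s'.arr Arr.ord) (Finset.range (k + 1) : Set ℕ) := by
              intro a ha b hb hab
              simp only [Finset.coe_range, Set.mem_Iio] at ha hb
              exact h2 a (by omega) b (by omega) hab
            have hsub : Finset.range N ⊆ (Finset.range (k + 1)).image (s'.arr Arr.ord) := by
              intro j hj
              obtain ⟨r, hr, hrj⟩ := (h8 j).1 (hall j (Finset.mem_range.1 hj))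
              exact Finset.mem_image.2 ⟨r, Finset.mem_range.2 (by omega), hrj⟩
            have := (Finset.card_le_card hsub).trans Finset.card_image_le
            simp only [Finset.card_range] at this
            omega)
        obtain ⟨r, hr, hri⟩ := (h8 i).1 hUi
        have hm : (r * N + j) % N = j := by
          rw [mul_comm, Nat.mul_add_mod, Nat.mod_eq_of_lt hj]
        have hd : (r * N + j) / N = r := by
          rw [mul_comm, Nat.mul_add_div hN0, Nat.div_eq_of_lt hj, add_zero]
        refine ⟨r * N + j, ?_, ?_⟩
        · calc r * N + j < r * N + N := by omega
            _ = (r + 1) * N := by ring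
            _ ≤ _ := Nat.mul_le_mul_right _ (by omega)
        · rw [hm, hd, hri]
          exact ⟨by simpa using hUj, hT⟩)
      set b := s₁.var Reg.b with hb
      have hrk : s₁.var Reg.r = k + 1 := by
        simp (disch := decide) [f₁.var, State.setVar_var_ne, hk']
      have hN1 : s₁.var Reg.N = N := by
        simp (disch := decide) [f₁.var, State.setVar_var_ne, hN']
      have ha : ∀ a, a ∉ Program.arrs skip → s₁.arr a = s'.arr a := by
        intro a _
        exact f₁.arr a (by simp [forLoop, Program.arrs])
      have hd : b / N < k + 1 := Nat.div_lt_of_lt_mul (by rwa [mul_comm])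
      have hmN : b % N < N := Nat.mod_lt _ hN0
      have hnew : ∀ r ≤ k, s'.arr Arr.ord r ≠ b % N := fun r hr h =>
        absurd hbv ((h8 _).2 ⟨r, hr, h⟩)
      refine Run.write_seq (by decide) (by decide) (fun h => ?_) ?_
      · exact (Nat.mod_le _ _).trans_lt (h.1 _)
      refine Run.write_seq (by decide) (by decide) (fun h => ?_) ?_
      · exact (Nat.div_le_self _ _).trans_lt (h.1 _)
      refine Run.write (by decide) (by decide) (fun _ => by rw [Expr.eval_one]; omega) fun _ => ?_
      simp (disch := decide) only [State.setVar_arr, State.setArr_arr_self, State.setArr_arr_ne,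
        State.setArr_var, Expr.eval_mod, Expr.eval_div, Expr.eval_var, Expr.eval_one, ha, hrk, hN1,
        ← hb]
      have hup : ∀ (g : ℕ → ℕ) (v : ℕ), ∀ r ≤ k, Function.update g (k + 1) v r = g r :=
        fun g v r hr => Function.update_of_ne (by omega) _ _
      have hcase : ∀ r ≤ k + 1, r ≤ k ∨ r = k + 1 := fun r hr => by omega
      refine ⟨?_, ?_, ?_, ?_, ?_, ?_, ?_, ?_⟩
      · intro r hr
        rcases hcase r hr with h | rfl
        · rw [hup _ _ _ h]; exact h1 r h
        · simpa using hmN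
      · intro r hr r' hr' he
        rcases hcase r hr with h | rfl <;> rcases hcase r' hr' with h' | rfl
        · rw [hup _ _ _ h, hup _ _ _ h'] at he; exact h2 r h r' h' he
        · rw [hup _ _ _ h, Function.update_self] at he; exact absurd he (hnew r h)
        · rw [hup _ _ _ h', Function.update_self] at he; exact absurd he.symm (hnew r' h')
        · rfl
      · intro r hr h0
        rcases hcase r hr with h | rfl
        · rw [hup _ _ _ h]; exact h3 r h h0
        · simpa using hd
      · intro r hr h0
        rcases hcase r hr with h | rfl
        · have := h3 r h h0
          rw [hup _ _ _ h, hup _ _ _ h, hup _ _ _ (by omega)]; exact h4 r h h0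
        · rw [Function.update_self, Function.update_self, hup _ _ _ (by omega)]
          exact hbw
      · rw [hup _ _ _ (by omega)]; exact h5
      · rw [Function.update_of_ne (by omega)]; exact h6
      · rw [hup _ _ _ (by omega)]; exact h7
      · intro j
        by_cases hj : j = b % N
        · subst hj
          simp only [Function.update_self, ne_eq, one_ne_zero, not_false_eq_true, true_iff]
          exact ⟨k + 1, le_rfl, by simp⟩
        · rw [Function.update_of_ne hj, h8]
          constructor
          · rintro ⟨r, hr, h⟩; exact ⟨r, by omega, by rw [hup _ _ _ hr]; exact h⟩
          · rintro ⟨r, hr, h⟩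
            rcases hcase r hr with h' | rfl
            · exact ⟨r, h', by rwa [hup _ _ _ h'] at h⟩
            · rw [Function.update_self] at h; exact absurd h.symm hj
  · obtain ⟨h1, h2, h3, h4, h5, h6, h7, h8⟩ := h
    exact ⟨fun r hr => h1 r (by omega), fun r hr r' hr' => h2 r (by omega) r' (by omega),
      fun r hr => h3 r (by omega), fun r hr => h4 r (by omega), h5, h6⟩

end RAM

namespace RAM
open RAM.Expr (var read)
open RAM.Program (write skip cond)

/-! ### Dynamic programming over the tree -/

/-- The data used by the dynamic program: `bag r v` is `1` if the vertex `v` lies in the bag of the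
node with rank `r`, and `0` otherwise; `par r` is the rank of the parent. -/
structure Tables where
  n : ℕ
  N : ℕ
  md : ℕ
  Q : ℕ
  s : ℕ
  t : ℕ
  W : ℕ → ℕ
  g : ℕ → ℕ → ℕ
  bag : ℕ → ℕ → ℕ
  par : ℕ → ℕ

/-- The number of colorings of the vertices below `v` in a bag with indicator function `b`. -/
def bagColorings (b : ℕ → ℕ) (v : ℕ) : ℕ := ∏ u ∈ Finset.range v, (1 + 2 * b u)

/-- The coloring number `x` of a bag with indicator function `b`. -/
def decode (b : ℕ → ℕ) (x v : ℕ) : ℕ := b v * (x / bagColorings b v % 3)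

/-- The code of the restriction of a coloring to the common vertices of two bags. -/
def encode (b b' col : ℕ → ℕ) : ℕ → ℕ
  | 0 => 0
  | v + 1 => 3 * encode b b' col v + b v * b' v * col v

theorem encode_congr {b b' col col' : ℕ → ℕ} {n : ℕ} (h : ∀ v < n, col v = col' v) :
    encode b b' col n = encode b b' col' n := by
  induction n with
  | zero => rfl
  | succ n ih => simp only [encode, h n (by omega), ih fun v hv => h v (by omega)]

theorem encode_lt {b b' col : ℕ → ℕ} {n : ℕ} (hb : ∀ v < n, b v ≤ 1) (hb' : ∀ v < n, b' v ≤ 1)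
    (hc : ∀ v < n, col v < 3) : encode b b' col n < 3 ^ n := by
  induction n with
  | zero => simp [encode]
  | succ n ih =>
    have h := ih (fun v hv => hb v (by omega)) (fun v hv => hb' v (by omega))
      (fun v hv => hc v (by omega))
    have h1 := hb n (by omega)
    have h2 := hb' n (by omega)
    have h3 := hc n (by omega)
    have : b n * b' n * col n ≤ 1 * 1 * 2 := by gcongr; omega
    simp only [encode, pow_succ]; omega

theorem decode_lt {b : ℕ → ℕ} {v : ℕ} (hb : b v ≤ 1) (x : ℕ) : decode b x v < 3 := by
  have : decode b x v ≤ 1 * (x / bagColorings b v % 3) := Nat.mul_le_mul_right _ hb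
  omega

theorem bagColorings_le {b : ℕ → ℕ} {n : ℕ} (hb : ∀ v < n, b v ≤ 1) : bagColorings b n ≤ 3 ^ n := by
  simpa [bagColorings] using Finset.prod_le_pow_card (Finset.range n) (fun u => 1 + 2 * b u) 3
    fun u hu => by have := hb u (Finset.mem_range.1 hu); omega

theorem bagColorings_mono (b : ℕ → ℕ) {v n : ℕ} (h : v ≤ n) :
    bagColorings b v ≤ bagColorings b n :=
  Finset.prod_le_prod_of_subset_of_one_le' (by simpa using h) fun _ _ _ => by omega

namespace Tables

variable (D : Tables)

/-- The factor of a pair of vertices with colors `cu` and `cv`. The pair of a vertex with itself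
carries the weight of the vertex. -/
def pairFactor (u v cu cv : ℕ) : ℕ :=
  if u = v then (if cu = 0 then (if u = D.s then 0 else 1) else if u = D.t then 0 else D.W u)
  else if D.g u v = 0 then 1 else if cu = 0 then 1 else if cv = 0 then D.Q
  else if cu = cv then 1 else 0

/-- The pair number `e` is treated at the node `r`. -/
def Assigned (r e : ℕ) : Prop :=
  D.bag r (e / D.n) * D.bag r (e % D.n) *
    (1 - D.bag (D.par r) (e / D.n) * D.bag (D.par r) (e % D.n)) ≠ 0

instance (r e : ℕ) : Decidable (D.Assigned r e) := by unfold Assigned; infer_instance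

/-- The product of the factors of all pairs treated at the node `r`. -/
def localFactor (r : ℕ) (col : ℕ → ℕ) : ℕ :=
  ∏ e ∈ Finset.range (D.n * D.n), if D.Assigned r e then
    D.pairFactor (e / D.n) (e % D.n) (col (e / D.n)) (col (e % D.n)) else 1

/-- The address of the table entry that a node `r` sends to its parent for a coloring. -/
def address (r : ℕ) (col : ℕ → ℕ) : ℕ := encode (D.bag r) (D.bag (D.par r)) col D.n * D.N + r

/-- The product of the table entries sent to `r`. -/
def childFactor (tab : ℕ → ℕ) (r : ℕ) (col : ℕ → ℕ) : ℕ :=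
  ∏ j ∈ Finset.range D.N, if D.par j = r then tab (D.address j col) else 1

/-- The partial sum over the first `m` colorings of the table entry of the node `r` for `q`. -/
def entrySum (tab : ℕ → ℕ) (r q m : ℕ) : ℕ :=
  ∑ x ∈ Finset.range m, if encode (D.bag r) (D.bag (D.par r)) (decode (D.bag r) x) D.n = q then
    D.localFactor r (decode (D.bag r) x) * D.childFactor tab r (decode (D.bag r) x) else 0

theorem localFactor_congr {r : ℕ} {col col' : ℕ → ℕ} (h : ∀ v < D.n, col v = col' v) :
    D.localFactor r col = D.localFactor r col' := by
  refine Finset.prod_congr rfl fun e he => ?_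
  rw [Finset.mem_range] at he
  have hn : 0 < D.n := Nat.pos_of_ne_zero fun h0 => by simp [h0] at he
  rw [h _ (Nat.div_lt_of_lt_mul he), h _ (Nat.mod_lt _ hn)]

theorem address_congr {r : ℕ} {col col' : ℕ → ℕ} (h : ∀ v < D.n, col v = col' v) :
    D.address r col = D.address r col' := by rw [address, encode_congr h, address]

/-- A node reads only the entries of its children, so later writes to entries of other nodes do not
affect what it has computed. -/
theorem childFactor_congr {tab tab' : ℕ → ℕ} {r : ℕ} {col col' : ℕ → ℕ}
    (h : ∀ v < D.n, col v = col' v)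
    (ht : ∀ j < D.N, D.par j = r → ∀ q, tab (q * D.N + j) = tab' (q * D.N + j)) :
    D.childFactor tab r col = D.childFactor tab' r col' := by
  refine Finset.prod_congr rfl fun j hj => ?_
  split_ifs with hr
  · rw [D.address_congr h]; exact ht j (Finset.mem_range.1 hj) hr _
  · rfl

theorem entrySum_congr {tab tab' : ℕ → ℕ} {r q m : ℕ}
    (ht : ∀ j < D.N, D.par j = r → ∀ q, tab (q * D.N + j) = tab' (q * D.N + j)) :
    D.entrySum tab r q m = D.entrySum tab' r q m :=
  Finset.sum_congr rfl fun _ _ => by rw [D.childFactor_congr (fun _ _ => rfl) ht]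

/-- Size conditions on the tables. -/
structure Ok (B : ℕ) : Prop where
  bag_le : ∀ r ≤ D.N, ∀ v < D.n, D.bag r v ≤ 1
  par_le : ∀ r < D.N, D.par r ≤ D.N
  par_ne : ∀ r < D.N, D.par r ≠ r
  N_lt : D.N < 2 ^ B
  n_lt : D.n * D.n < 2 ^ B
  pow_lt : 3 ^ D.n < 2 ^ B
  md_pos : 0 < D.md
  md_le : D.md ≤ 2 ^ B

theorem Ok.n_lt' {D : Tables} {B : ℕ} (h : D.Ok B) : D.n < 2 ^ B :=
  (Nat.le_mul_self _).trans_lt h.n_lt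

end Tables

/-- The tables contained in a memory state. -/
def State.tables (s : State) : Tables where
  n := s.var Reg.n
  N := s.var Reg.N
  md := s.var Reg.md
  Q := s.var Reg.Q
  s := s.var Reg.s
  t := s.var Reg.t
  W := s.arr Arr.wt
  g u v := s.arr Arr.word (s.var Reg.oG + u * s.var Reg.n + v)
  bag r v := s.arr Arr.word (s.var Reg.oB + s.arr Arr.ord r * s.var Reg.n + v)
  par := s.arr Arr.par

/-- The variables that hold parameters of the tables. -/
def tableVars : List ℕ := [Reg.n, Reg.N, Reg.md, Reg.Q, Reg.s, Reg.t, Reg.oG, Reg.oB]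

/-- The arrays that hold the tables. -/
def tableArrs : List ℕ := [Arr.word, Arr.wt, Arr.ord, Arr.par]

/-- The dynamic program never writes to its input data, so one abstract value of `Tables` serves for
all intermediate states. -/
theorem Frame.tables {p : Program} {s s' : State} (h : Frame p s s')
    (hv : ∀ x ∈ tableVars, x ∉ p.vars) (ha : ∀ a ∈ tableArrs, a ∉ p.arrs) :
    s'.tables = s.tables := by
  simp only [tableVars, tableArrs, List.forall_mem_cons] at hv ha
  obtain ⟨h1, h2, h3, h4, h5, h6, h7, h8, -⟩ := hv
  obtain ⟨a1, a2, a3, a4, -⟩ := ha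
  simp only [State.tables, h.var _ h1, h.var _ h2, h.var _ h3, h.var _ h4, h.var _ h5,
    h.var _ h6, h.var _ h7, h.var _ h8, h.arr _ a1, h.arr _ a2, h.arr _ a3, h.arr _ a4]

theorem State.setVar_tables (s : State) {x : ℕ} (v : ℕ) (hx : x ∉ tableVars) :
    (s.setVar x v).tables = s.tables :=
  (Exec.assign (ω := fun _ => true) s x (.lit v)).frame.tables
    (fun y hy h => hx (by simp [Program.vars] at h; exact h ▸ hy)) (by simp [Program.arrs])

theorem State.setArr_tables (s : State) {a : ℕ} (i v : ℕ) (ha : a ∉ tableArrs) :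
    (s.setArr a i v).tables = s.tables :=
  (Exec.write (ω := fun _ => true) s a (.lit i) (.lit v)).frame.tables (by simp [Program.vars])
    (fun y hy h => ha (by simp [Program.arrs] at h; exact h ▸ hy))

/-- `1` if the vertex `v` lies in the bag of the node with rank `r`, and `0` otherwise -/
def bagExpr (r v : Expr) : Expr :=
  read Arr.word (var Reg.oB + read Arr.ord r * var Reg.n + v)

theorem eval_bagExpr (s : State) (r v : Expr) :
    (bagExpr r v).eval s = s.tables.bag (r.eval s) (v.eval s) := rfl

/-- Computes the code of the current coloring for the node `c`. -/
def encodeProg : Program :=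
  Reg.code ::= 0 ;;
  forLoop Reg.v (var Reg.n) (Reg.code ::= 3 * var Reg.code +
    bagExpr (var Reg.c) (var Reg.v) * bagExpr (read Arr.par (var Reg.c)) (var Reg.v) *
      read Arr.col (var Reg.v))

theorem run_encodeProg {ω : ℕ → Bool} {B : ℕ} {D : Tables} {s : State} (hD : s.tables = D)
    (hok : D.Ok B) (hc : s.var Reg.c < D.N) (hcol : ∀ v < D.n, s.arr Arr.col v < 3) :
    Run ω B encodeProg s (3 * D.n + 3) fun s' => s'.var Reg.code =
      encode (D.bag (s.var Reg.c)) (D.bag (D.par (s.var Reg.c))) (s.arr Arr.col) D.n := by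
  refine Run.le (m := 1 + (D.n * (1 + 2) + 2)) ?_ (by omega)
  refine Run.assign_seq (by decide) (fun _ => by simp) ?_
  refine Run.forLoop (I := fun k s' => s'.var Reg.code =
      encode (D.bag (s.var Reg.c)) (D.bag (D.par (s.var Reg.c))) (s.arr Arr.col) k)
    (by decide) (by decide) hok.n_lt' (fun s' f => ?_) ?_ ?_
  · simp (disch := decide) [f.var, State.setVar_var_ne, ← hD, State.tables]
  · simp (disch := decide) [State.setVar_var_ne, encode]
  · intro k hk s' f hk' hI
    have hD' : s'.tables = D := by
      simp (disch := decide) [f.tables, State.setVar_tables, hD]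
    have hp : s'.arr Arr.par = D.par := congrArg Tables.par hD'
    have hc' : s'.var Reg.c = s.var Reg.c := by
      simp (disch := decide) [f.var, State.setVar_var_ne]
    have ha' : s'.arr Arr.col = s.arr Arr.col := by simp (disch := decide) [f.arr]
    have hev : (3 * var Reg.code +
        bagExpr (var Reg.c) (var Reg.v) * bagExpr (read Arr.par (var Reg.c)) (var Reg.v) *
        read Arr.col (var Reg.v)).eval s' =
        encode (D.bag (s.var Reg.c)) (D.bag (D.par (s.var Reg.c))) (s.arr Arr.col) (k + 1) := by
      simp only [Expr.eval_add, Expr.eval_mul, eval_bagExpr, Expr.eval_var, Expr.eval_read, hD', hp,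
        hc', hk', ha', Expr.eval_three, hI, encode]
    refine Run.assign (by decide) (fun _ => ?_) fun _ => ?_
    · rw [hev]
      refine lt_of_lt_of_le (encode_lt (fun v hv => hok.bag_le _ hc.le v (by omega))
        (fun v hv => hok.bag_le _ (hok.par_le _ hc) v (by omega))
        (fun v hv => hcol v (by omega))) ?_
      exact (Nat.pow_le_pow_right (by simp) hk).trans hok.pow_lt.le
    · simp (disch := decide) [State.setVar_var_ne, hev]

/-- Writes the coloring number `x` of the bag of the node `r`. -/
def decodeProg : Program :=
  Reg.y ::= var Reg.x ;;
  forLoop Reg.v (var Reg.n) (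
    write Arr.col (var Reg.v) (bagExpr (var Reg.r) (var Reg.v) * (var Reg.y % 3)) ;;
    Reg.y ::= var Reg.y / (1 + 2 * bagExpr (var Reg.r) (var Reg.v)))

/-- The coloring number is written in mixed radix, with radix 3 at vertices of the bag and radix 1
elsewhere; `y` holds the quotient after the digits read so far. This is why only 3^|bag| numbers
have to be enumerated. -/
theorem run_decodeProg {ω : ℕ → Bool} {B : ℕ} {D : Tables} {s : State} (hD : s.tables = D)
    (hok : D.Ok B) (hr : s.var Reg.r < D.N) (hB : 2 ≤ B) :
    Run ω B decodeProg s (5 * D.n + 3) fun s' => ∀ v < D.n, s'.arr Arr.col v =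
      decode (D.bag (s.var Reg.r)) (s.var Reg.x) v := by
  have hB2 : 2 ^ 2 ≤ 2 ^ B := Nat.pow_le_pow_right (by simp) hB
  refine Run.le (m := 1 + (D.n * ((2 + 1) + 2) + 2)) ?_ (by omega)
  refine Run.assign_seq (by decide) (fun h => h.1 _) ?_
  refine (Run.forLoop (I := fun k s' =>
      s'.var Reg.y = s.var Reg.x / bagColorings (D.bag (s.var Reg.r)) k ∧
      ∀ v < k, s'.arr Arr.col v = decode (D.bag (s.var Reg.r)) (s.var Reg.x) v)
    (by decide) (by decide) hok.n_lt' (fun s' f => ?_) ?_ ?_).imp fun s' _ _ h => h.2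
  · simp (disch := decide) [f.var, State.setVar_var_ne, ← hD, State.tables]
  · simp (disch := decide) [State.setVar_var_ne, bagColorings]
  · rintro k hk s' f hk' ⟨hI, hI'⟩
    have hD' : s'.tables = D := by
      simp (disch := decide) [f.tables, State.setVar_tables, hD]
    have hr' : s'.var Reg.r = s.var Reg.r := by
      simp (disch := decide) [f.var, State.setVar_var_ne]
    have hev : (bagExpr (var Reg.r) (var Reg.v) * (var Reg.y % 3)).eval s' =
        decode (D.bag (s.var Reg.r)) (s.var Reg.x) k := by
      simp only [Expr.eval_mul, eval_bagExpr, Expr.eval_var, Expr.eval_mod, hD',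
        hr', hk', hI, Expr.eval_three, decode]
    refine Run.write_seq (m := 1) (by decide) (by decide) (fun _ => ?_) ?_
    · rw [hev]
      have := decode_lt (hok.bag_le _ hr.le k hk) (s.var Reg.x)
      omega
    rw [hev]
    refine Run.assign (by decide) (fun h => (Nat.div_le_self _ _).trans_lt (h.1 _)) fun _ => ?_
    have hD2 : (s'.setArr Arr.col (Expr.eval s' (var Reg.v))
        (decode (D.bag (s.var Reg.r)) (s.var Reg.x) k)).tables = D := by
      rw [State.setArr_tables _ _ _ (by decide), hD']
    rw [Expr.eval_var, hk'] at hD2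
    simp (disch := decide) only [State.setVar_var_ne, State.setVar_var_self, Expr.eval_div,
      Expr.eval_add, Expr.eval_one, Expr.eval_two, Expr.eval_mul, eval_bagExpr, hD2, Expr.eval_var,
      State.setArr_var, hk', hr', hI, State.setVar_arr, State.setArr_arr_self]
    refine ⟨?_, fun v hv => ?_⟩
    · rw [Nat.div_div_eq_div_mul, bagColorings, bagColorings, Finset.prod_range_succ]
    · rcases Nat.lt_succ_iff_lt_or_eq.1 hv with h | rfl
      · rw [Function.update_of_ne h.ne]; exact hI' v h
      · simp

/-- The factor of the current pair of vertices. -/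
abbrev pairExpr : Expr :=
  Expr.ite (bagExpr (var Reg.r) (var Reg.u) * bagExpr (var Reg.r) (var Reg.v) *
      (1 - bagExpr (read Arr.par (var Reg.r)) (var Reg.u) *
        bagExpr (read Arr.par (var Reg.r)) (var Reg.v)))
    (Expr.ite (Expr.eq (var Reg.u) (var Reg.v))
      (Expr.ite (read Arr.col (var Reg.u))
        (Expr.ite (Expr.eq (var Reg.u) (var Reg.t)) 0 (read Arr.wt (var Reg.u)))
        (Expr.ite (Expr.eq (var Reg.u) (var Reg.s)) 0 1))
      (Expr.ite (read Arr.word (var Reg.oG + var Reg.u * var Reg.n + var Reg.v))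
        (Expr.ite (read Arr.col (var Reg.u))
          (Expr.ite (read Arr.col (var Reg.v))
            (Expr.eq (read Arr.col (var Reg.u)) (read Arr.col (var Reg.v)))
            (var Reg.Q)) 1) 1)) 1

/-- Multiplies the factors of the pairs of vertices treated at the node `r`. -/
def localProg : Program :=
  Reg.val ::= 1 ;;
  forLoop Reg.e (var Reg.n * var Reg.n) (
    Reg.u ::= var Reg.e / var Reg.n ;;
    Reg.v ::= var Reg.e % var Reg.n ;;
    Reg.val ::= var Reg.val * pairExpr % var Reg.md)

/-- The cell is reduced modulo `md` after each factor to keep it short, so its value is specified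
only in `ZMod D.md`. -/
theorem run_localProg {ω : ℕ → Bool} {B : ℕ} {D : Tables} {s : State} (hD : s.tables = D)
    (hok : D.Ok B) (hB : 1 ≤ B) :
    Run ω B localProg s (5 * (D.n * D.n) + 3) fun s' => (s'.var Reg.val : ZMod D.md) =
      D.localFactor (s.var Reg.r) (s.arr Arr.col) := by
  have hB1 : 1 < 2 ^ B := Nat.one_lt_two_pow (by omega)
  refine Run.le (m := 1 + (D.n * D.n * ((1 + (1 + 1)) + 2) + 2)) ?_ (by omega)
  refine Run.assign_seq (by decide) (fun _ => by rw [Expr.eval_one]; omega) ?_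
  refine Run.forLoop (I := fun k s' => (s'.var Reg.val : ZMod D.md) =
      ((∏ e ∈ Finset.range k, if D.Assigned (s.var Reg.r) e then
    D.pairFactor (e / D.n) (e % D.n) (s.arr Arr.col (e / D.n)) (s.arr Arr.col (e % D.n)) else 1
    : ℕ) : ZMod D.md))
    (by decide) (by decide) hok.n_lt (fun s' f => ?_) ?_ ?_
  · simp (disch := decide) [f.var, State.setVar_var_ne, ← hD, State.tables]
  · simp (disch := decide) [State.setVar_var_ne]
  · intro k hk s' f hk' hI
    have hD' : s'.tables = D := by
      simp (disch := decide) [f.tables, State.setVar_tables, hD]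
    have hn : s'.var Reg.n = D.n := congrArg Tables.n hD'
    have hr' : s'.var Reg.r = s.var Reg.r := by
      simp (disch := decide) [f.var, State.setVar_var_ne]
    have ha' : s'.arr Arr.col = s.arr Arr.col := by simp (disch := decide) [f.arr]
    refine Run.assign_seq (m := 1 + 1) (by decide)
      (fun h => (Nat.div_le_self _ _).trans_lt (h.1 _)) ?_
    refine Run.assign_seq (m := 1) (by decide) (fun h => (Nat.mod_le _ _).trans_lt (h.1 _)) ?_
    simp (disch := decide) only [Expr.eval_div, Expr.eval_mod, Expr.eval_var, State.setVar_var_ne,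
      hk', hn]
    set s₁ := (s'.setVar Reg.u (k / D.n)).setVar Reg.v (k % D.n) with hs₁
    have hD1 : s₁.tables = D := by
      simp (disch := decide) [hs₁, State.setVar_tables, hD']
    have hp1 : s₁.arr Arr.par = D.par := congrArg Tables.par hD1
    have hW1 : s₁.arr Arr.wt = D.W := congrArg Tables.W hD1
    have hQ1 : s₁.var Reg.Q = D.Q := congrArg Tables.Q hD1
    have hm1 : s₁.var Reg.md = D.md := congrArg Tables.md hD1
    have hss1 : s₁.var Reg.s = D.s := congrArg Tables.s hD1
    have ht1 : s₁.var Reg.t = D.t := congrArg Tables.t hD1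
    have hg1 : ∀ u v, s₁.arr Arr.word (s₁.var Reg.oG + u * s₁.var Reg.n + v) = D.g u v :=
      fun u v => congrFun (congrFun (congrArg Tables.g hD1) u) v
    have hu1 : s₁.var Reg.u = k / D.n := by simp (disch := decide) [hs₁, State.setVar_var_ne]
    have hv1 : s₁.var Reg.v = k % D.n := by simp (disch := decide) [hs₁]
    have hr1 : s₁.var Reg.r = s.var Reg.r := by
      simp (disch := decide) [hs₁, State.setVar_var_ne, hr']
    have hval1 : s₁.var Reg.val = s'.var Reg.val := by
      simp (disch := decide) [hs₁, State.setVar_var_ne]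
    have ha1 : s₁.arr Arr.col = s.arr Arr.col := by simp [hs₁, ha']
    have hev : pairExpr.eval s₁ = if D.Assigned (s.var Reg.r) k then
        D.pairFactor (k / D.n) (k % D.n) (s.arr Arr.col (k / D.n)) (s.arr Arr.col (k % D.n))
        else 1 := by
      simp only [Expr.eval_ite, Expr.eval_mul, Expr.eval_sub, eval_bagExpr, Expr.eval_var,
        Expr.eval_read, Expr.eval_add, Expr.eval_one, Expr.eval_zero, Expr.eval_eq, hD1, hp1, hW1,
        hQ1, hss1, ht1, hg1, hu1, hv1, hr1, ha1, Tables.pairFactor, Tables.Assigned, ne_eq,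
        ite_not, ite_eq_right_iff, one_ne_zero, imp_false]
    refine Run.assign (by decide +kernel) (fun _ => ?_) fun _ => ?_
    · simp only [Expr.eval_mod, Expr.eval_var, hm1]
      exact (Nat.mod_lt _ hok.md_pos).trans_le hok.md_le
    · simp (disch := decide) only [State.setVar_var_self, Expr.eval_mod,
        Expr.eval_mul, hev, Expr.eval_var, hm1, ZMod.natCast_mod, hval1, Finset.prod_range_succ]
      rw [Nat.cast_mul, hI, Nat.cast_mul]

/-- Multiplies `val` by the table entries of the children of `r`. -/
def childProg : Program :=
  forLoop Reg.j (var Reg.N) (cond (Expr.eq (read Arr.par (var Reg.j)) (var Reg.r))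
    (Reg.c ::= var Reg.j ;;
      encodeProg ;;
      Reg.val ::= var Reg.val * read Arr.tab (var Reg.code * var Reg.N + var Reg.c) % var Reg.md)
    skip)

theorem run_childProg {ω : ℕ → Bool} {B : ℕ} {D : Tables} {s : State} (hD : s.tables = D)
    (hok : D.Ok B) (hcol : ∀ v < D.n, s.arr Arr.col v < 3) :
    Run ω B childProg s (D.N * (3 * D.n + 8) + 2) fun s' => (s'.var Reg.val : ZMod D.md) =
      s.var Reg.val * D.childFactor (s.arr Arr.tab) (s.var Reg.r) (s.arr Arr.col) := by
  refine Run.le (m := D.N * ((1 + (1 + ((3 * D.n + 3) + 1))) + 2) + 2) ?_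
    (by gcongr ?_ * ?_ + 2 <;> omega)
  refine Run.forLoop (I := fun k s' => (s'.var Reg.val : ZMod D.md) = s.var Reg.val *
      ((∏ j ∈ Finset.range k, if D.par j = s.var Reg.r then
        s.arr Arr.tab (D.address j (s.arr Arr.col)) else 1 : ℕ) : ZMod D.md))
    (by decide) (by decide) hok.N_lt (fun s' f => ?_) ?_ ?_
  · simp (disch := decide) [f.var, ← hD, State.tables]
  · simp (disch := decide) [State.setVar_var_ne]
  · intro k hk s' f hk' hI
    have hD' : s'.tables = D := by
      simp (disch := decide) [f.tables, hD]
    have hp' : s'.arr Arr.par = D.par := congrArg Tables.par hD'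
    have hr' : s'.var Reg.r = s.var Reg.r := by simp (disch := decide) [f.var]
    have ha' : s'.arr Arr.col = s.arr Arr.col := by simp (disch := decide) [f.arr]
    have hev : (Expr.eq (read Arr.par (var Reg.j)) (var Reg.r)).eval s' =
        if D.par k = s.var Reg.r then 1 else 0 := by
      simp only [Expr.eval_eq, Expr.eval_read, Expr.eval_var, hp', hk', hr']
    refine Run.cond (by decide) (fun h => ?_) (fun h => ?_)
    · have hpk : D.par k = s.var Reg.r := by simpa [hev] using h
      refine Run.assign_seq (by decide) (fun h => h.1 _) ?_
      simp only [Expr.eval_var, hk']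
      refine Run.seq (m₂ := 1) (run_encodeProg (D := D) (by
        simp (disch := decide) [State.setVar_tables, hD']) hok (by simpa using hk)
        (by simpa [ha'] using hcol)) fun s₁ f₁ h₁ => ?_
      have hD1 : s₁.tables = D := by
        simp (disch := decide) [f₁.tables, State.setVar_tables, hD']
      have hm1 : s₁.var Reg.md = D.md := congrArg Tables.md hD1
      have hN1 : s₁.var Reg.N = D.N := congrArg Tables.N hD1
      have hc1 : s₁.var Reg.c = k := by simp (disch := decide) [f₁.var]
      have hv1 : s₁.var Reg.val = s'.var Reg.val := by
        simp (disch := decide) [f₁.var, State.setVar_var_ne]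
      have ht1 : s₁.arr Arr.tab = s.arr Arr.tab := by simp (disch := decide) [f₁.arr, f.arr]
      simp only [State.setVar_var_self, State.setVar_arr, ha'] at h₁
      refine Run.assign (by decide) (fun _ => ?_) fun _ => ?_
      · simp only [Expr.eval_mod, Expr.eval_var, hm1]
        exact (Nat.mod_lt _ hok.md_pos).trans_le hok.md_le
      · simp (disch := decide) only [State.setVar_var_ne, State.setVar_var_self, Expr.eval_mod,
          Expr.eval_mul, Expr.eval_read, Expr.eval_add, Expr.eval_var, hm1, ZMod.natCast_mod, hv1,
          Finset.prod_range_succ, h₁, hN1, hc1, ht1, if_pos hpk]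
        rw [Nat.cast_mul, hI, Nat.cast_mul, mul_assoc]
        rfl
    · have hpk : D.par k ≠ s.var Reg.r := by simpa [hev] using h
      refine (Run.skip fun _ => ?_).le (by omega)
      simp (disch := decide) only [State.setVar_var_ne, Finset.prod_range_succ, if_neg hpk, mul_one]
      exact hI

end RAM

namespace RAM
open RAM.Expr (var read)
open RAM.Program (write skip cond)

/-- Adds `val` to the table entry of `r` for the current coloring. -/
def storeProg : Program :=
  Reg.c ::= var Reg.r ;;
  encodeProg ;;
  write Arr.tab (var Reg.code * var Reg.N + var Reg.r)
    ((read Arr.tab (var Reg.code * var Reg.N + var Reg.r) + var Reg.val) % var Reg.md)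

theorem run_storeProg {ω : ℕ → Bool} {B : ℕ} {D : Tables} {s : State} (hD : s.tables = D)
    (hok : D.Ok B) (hr : s.var Reg.r < D.N) (hcol : ∀ v < D.n, s.arr Arr.col v < 3) :
    Run ω B storeProg s (3 * D.n + 6) fun s' => s'.arr Arr.tab =
      Function.update (s.arr Arr.tab) (D.address (s.var Reg.r) (s.arr Arr.col))
        ((s.arr Arr.tab (D.address (s.var Reg.r) (s.arr Arr.col)) + s.var Reg.val) % D.md) := by
  refine Run.le (m := 1 + ((3 * D.n + 3) + 2)) ?_ (by omega)
  refine Run.assign_seq (by decide) (fun h => h.1 _) ?_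
  refine Run.seq (m₂ := 2) (run_encodeProg (D := D) (by
    simp (disch := decide) [State.setVar_tables, hD]) hok (by simpa using hr)
    (by simpa using hcol)) fun s₁ f₁ h₁ => ?_
  have hD1 : s₁.tables = D := by simp (disch := decide) [f₁.tables, State.setVar_tables, hD]
  have hm1 : s₁.var Reg.md = D.md := congrArg Tables.md hD1
  have hN1 : s₁.var Reg.N = D.N := congrArg Tables.N hD1
  have hr1 : s₁.var Reg.r = s.var Reg.r := by
    simp (disch := decide) [f₁.var, State.setVar_var_ne]
  have hv1 : s₁.var Reg.val = s.var Reg.val := by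
    simp (disch := decide) [f₁.var, State.setVar_var_ne]
  have ht1 : s₁.arr Arr.tab = s.arr Arr.tab := by simp (disch := decide) [f₁.arr]
  simp only [State.setVar_var_self, State.setVar_arr, Expr.eval_var] at h₁
  refine Run.write (by decide) (by decide) (fun _ => ?_) ?_
  · simp only [Expr.eval_mod, Expr.eval_var, hm1]
    exact (Nat.mod_lt _ hok.md_pos).trans_le hok.md_le
  · simp only [State.setArr_arr_self, Expr.eval_mod, Expr.eval_mul, Expr.eval_read, Expr.eval_add,
      Expr.eval_var, hm1, hv1, h₁, hN1, hr1, ht1]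
    rfl

/-- Treats all colorings of the bag of the node `r`. -/
def nodeProg : Program :=
  forLoop Reg.x (var Reg.size) (decodeProg ;; localProg ;; childProg ;; storeProg)

/-- A time bound for one coloring. -/
def coloringTime (n N : ℕ) : ℕ := 5 * (n * n) + N * (3 * n + 8) + 8 * n + 14

/-- The residue of an address modulo the number of nodes tells which node owns the entry; entries of
different nodes never collide. -/
theorem Tables.address_mod {D : Tables} {r : ℕ} (hr : r < D.N) (q : ℕ) :
    (q * D.N + r) % D.N = r := by
  rw [mul_comm, Nat.mul_add_mod, Nat.mod_eq_of_lt hr]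

/-- Each coloring of the bag is added to the entry selected by its restriction to the parent's bag.
The second conclusion says that entries of other nodes stay intact. Entries are never initialized
explicitly: cells start at 0, and only addresses that actually occur are touched. -/
theorem run_nodeProg {ω : ℕ → Bool} {B T : ℕ} {D : Tables} {s : State} (hD : s.tables = D)
    (hok : D.Ok B) (hB : 2 ≤ B) (hr : s.var Reg.r < D.N) (hT : s.var Reg.size = T) :
    Run ω B nodeProg s (T * (coloringTime D.n D.N + 2) + 2) fun s' =>
      (∀ q, (s'.arr Arr.tab (q * D.N + s.var Reg.r) : ZMod D.md) =
        s.arr Arr.tab (q * D.N + s.var Reg.r) +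
          D.entrySum (s.arr Arr.tab) (s.var Reg.r) q T) ∧
      ∀ a, a % D.N ≠ s.var Reg.r → s'.arr Arr.tab a = s.arr Arr.tab a := by
  refine Run.of_bdd fun hbdd => ?_
  refine Run.le (m := T * (((5 * D.n + 3) + ((5 * (D.n * D.n) + 3) + ((D.N * (3 * D.n + 8) + 2) +
    (3 * D.n + 6)))) + 2) + 2) ?_ (by gcongr; unfold coloringTime; omega)
  refine Run.forLoop (I := fun k s' => (∀ q, (s'.arr Arr.tab (q * D.N + s.var Reg.r) : ZMod D.md) =
        s.arr Arr.tab (q * D.N + s.var Reg.r) +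
          D.entrySum (s.arr Arr.tab) (s.var Reg.r) q k) ∧
      ∀ a, a % D.N ≠ s.var Reg.r → s'.arr Arr.tab a = s.arr Arr.tab a)
    (by decide) (by decide) (hT ▸ hbdd.1 _) (fun s' f => ?_) ?_ ?_
  · simp (disch := decide) [f.var, hT]
  · simp [Tables.entrySum]
  · rintro k hk s₀ f₀ hk' ⟨hI, hI'⟩
    have hD0 : s₀.tables = D := by simp (disch := decide) [f₀.tables, hD]
    have hr0 : s₀.var Reg.r = s.var Reg.r := by simp (disch := decide) [f₀.var]
    rw [← hr0] at hr hI hI'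
    refine Run.seq (run_decodeProg hD0 hok hr hB) fun s₁ f₁ h₁ => ?_
    rw [hk'] at h₁
    have hD1 : s₁.tables = D := by simp (disch := decide) [f₁.tables, hD0]
    have hr1 : s₁.var Reg.r = s₀.var Reg.r := by simp (disch := decide) [f₁.var]
    refine Run.seq (run_localProg hD1 hok (by omega)) fun s₂ f₂ h₂ => ?_
    have hD2 : s₂.tables = D := by simp (disch := decide) [f₂.tables, hD1]
    have hr2 : s₂.var Reg.r = s₀.var Reg.r := by simp (disch := decide) [f₂.var, hr1]
    have hc2 : s₂.arr Arr.col = s₁.arr Arr.col := by simp (disch := decide) [f₂.arr]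
    have hcol1 : ∀ v < D.n, s₁.arr Arr.col v < 3 := fun v hv => by
      rw [h₁ v hv]; exact decode_lt (hok.bag_le _ hr.le v hv) _
    refine Run.seq (run_childProg hD2 hok (hc2 ▸ hcol1)) fun s₃ f₃ h₃ => ?_
    have hD3 : s₃.tables = D := by simp (disch := decide) [f₃.tables, hD2]
    have hr3 : s₃.var Reg.r = s₀.var Reg.r := by simp (disch := decide) [f₃.var, hr2]
    have hc3 : s₃.arr Arr.col = s₁.arr Arr.col := by simp (disch := decide) [f₃.arr, hc2]
    have ht2 : s₂.arr Arr.tab = s₀.arr Arr.tab := by simp (disch := decide) [f₂.arr, f₁.arr]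
    have ht3 : s₃.arr Arr.tab = s₀.arr Arr.tab := by simp (disch := decide) [f₃.arr, ht2]
    refine (run_storeProg hD3 hok (hr3 ▸ hr) (hc3 ▸ hcol1)).imp fun s₄ _ _ h₄ => ?_
    intro _
    rw [hr1] at h₂
    rw [hr2, hc2, ht2, h₂] at h₃
    rw [hr3, hc3, ht3] at h₄
    rw [← hr0, State.setVar_arr, h₄, D.address_congr h₁]
    -- Writes made for earlier colorings hit only entries owned by `r`, and `r` is not its own
    -- parent, so the children's entries are still the initial ones.
    have hch : D.childFactor (s₀.arr Arr.tab) (s₀.var Reg.r) (s₁.arr Arr.col) =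
        D.childFactor (s.arr Arr.tab) (s₀.var Reg.r) (decode (D.bag (s₀.var Reg.r)) k) := by
      refine D.childFactor_congr h₁ fun j hj hp q => hI' _ ?_
      rw [Tables.address_mod hj]
      rintro rfl
      exact hok.par_ne _ hj hp
    rw [hch, D.localFactor_congr h₁] at h₃
    refine ⟨fun q => ?_, fun a ha => ?_⟩
    · by_cases hq : encode (D.bag (s₀.var Reg.r)) (D.bag (D.par (s₀.var Reg.r)))
          (decode (D.bag (s₀.var Reg.r)) k) D.n = q
      · have ha : D.address (s₀.var Reg.r) (decode (D.bag (s₀.var Reg.r)) k) =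
            q * D.N + s₀.var Reg.r := by rw [Tables.address, hq]
        rw [ha, Function.update_self, ZMod.natCast_mod, Nat.cast_add, hI, h₃, Tables.entrySum,
          Tables.entrySum, Finset.sum_range_succ, if_pos hq]
        push_cast
        ring
      · have ha : q * D.N + s₀.var Reg.r ≠
            D.address (s₀.var Reg.r) (decode (D.bag (s₀.var Reg.r)) k) := by
          intro h
          have hN : 0 < D.N := by omega
          exact hq (Nat.eq_of_mul_eq_mul_right hN (Nat.add_right_cancel h)).symm
        rw [Function.update_of_ne ha, hI, Tables.entrySum, Tables.entrySum, Finset.sum_range_succ,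
          if_neg hq, add_zero]
    · rw [Function.update_of_ne, hI' a ha]
      rintro rfl
      exact ha (Tables.address_mod hr _)

/-- Treats all nodes, the root last. -/
def treeProg : Program :=
  forLoop Reg.cnt (var Reg.N) (
    Reg.r ::= var Reg.N - 1 - var Reg.cnt ;;
    Reg.size ::= 1 ;;
    forLoop Reg.v (var Reg.n)
      (Reg.size ::= var Reg.size * (1 + 2 * bagExpr (var Reg.r) (var Reg.v))) ;;
    nodeProg)

/-- Ranks are treated in decreasing order, so children precede parents. The result is stated as a
recurrence satisfied by the final table alone; this is what message passing needs. -/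
theorem run_treeProg {ω : ℕ → Bool} {B T : ℕ} {D : Tables} {s : State} (hD : s.tables = D)
    (hok : D.Ok B) (hB : 2 ≤ B) (hpar : ∀ j < D.N, D.par j < j ∨ D.par j = D.N)
    (hT : ∀ r < D.N, bagColorings (D.bag r) D.n ≤ T) (htab : s.arr Arr.tab = fun _ => 0) :
    Run ω B treeProg s (D.N * (3 * D.n + T * (coloringTime D.n D.N + 2) + 8) + 2) fun s' =>
      ∀ r < D.N, ∀ q, (s'.arr Arr.tab (q * D.N + r) : ZMod D.md) =
        D.entrySum (s'.arr Arr.tab) r q (bagColorings (D.bag r) D.n) := by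
  have hB1 : 1 < 2 ^ B := Nat.one_lt_two_pow (by omega)
  refine Run.le (m := D.N * ((1 + (1 + ((D.n * (1 + 2) + 2) +
    (T * (coloringTime D.n D.N + 2) + 2)))) + 2) + 2) ?_
    (by gcongr ?_ * ?_ + 2 <;> [exact le_rfl; omega])
  refine (Run.forLoop (I := fun k s' =>
      (∀ r < D.N, D.N ≤ r + k → ∀ q, (s'.arr Arr.tab (q * D.N + r) : ZMod D.md) =
        D.entrySum (s'.arr Arr.tab) r q (bagColorings (D.bag r) D.n)) ∧
      ∀ r < D.N, r + k < D.N → ∀ q, s'.arr Arr.tab (q * D.N + r) = 0)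
    (by decide) (by decide) hok.N_lt (fun s' f => ?_) ?_ ?_).imp
    fun s' _ _ h r hr => h.1 r hr (by omega)
  · simp (disch := decide) [f.var, ← hD, State.tables]
  · refine ⟨fun r h1 h2 => absurd h1 (by omega), fun r _ _ q => by simp [htab]⟩
  · rintro k hk s₀ f₀ hk' ⟨hI, hI'⟩
    have hD0 : s₀.tables = D := by simp (disch := decide) [f₀.tables, hD]
    have hN0 : s₀.var Reg.N = D.N := congrArg Tables.N hD0
    have hn0 : s₀.var Reg.n = D.n := congrArg Tables.n hD0
    have hNB := hok.N_lt
    set r := D.N - 1 - k with hr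
    have hrN : r < D.N := by omega
    have hev : (var Reg.N - 1 - var Reg.cnt).eval s₀ = r := by
      simp only [Expr.eval_sub, Expr.eval_var, Expr.eval_one, hN0, hk', hr]
    refine Run.assign_seq (by decide) (fun _ => by rw [hev]; omega) ?_
    rw [hev]
    refine Run.assign_seq (by decide) (fun _ => by rw [Expr.eval_one]; omega) ?_
    refine Run.seq (m₂ := T * (coloringTime D.n D.N + 2) + 2) (Run.forLoop (n := D.n) (τ := 1)
      (I := fun v s' => s'.var Reg.size = bagColorings (D.bag r) v)
      (by decide) (by decide) hok.n_lt' (fun s' f => ?_) ?_ ?_) fun s₁ f₁ h₁ => ?_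
    · simp (disch := decide) [f.var, State.setVar_var_ne, hn0]
    · simp (disch := decide) [State.setVar_var_ne, bagColorings]
    · intro v hv s₁ f₁ hv' hI1
      have hD1 : s₁.tables = D := by
        simp (disch := decide) [f₁.tables, State.setVar_tables, hD0]
      have hr1 : s₁.var Reg.r = r := by
        simp (disch := decide) [f₁.var, State.setVar_var_ne]
      have hev1 : (var Reg.size * (1 + 2 * bagExpr (var Reg.r) (var Reg.v))).eval s₁ =
          bagColorings (D.bag r) (v + 1) := by
        simp only [Expr.eval_mul, Expr.eval_add, Expr.eval_one, Expr.eval_two, Expr.eval_var,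
          eval_bagExpr, hD1, hr1, hv', hI1, bagColorings, Finset.prod_range_succ]
      refine Run.assign (by decide) (fun _ => ?_) fun _ => ?_
      · rw [hev1]
        exact ((bagColorings_mono _ hv).trans (bagColorings_le (hok.bag_le r hrN.le))).trans_lt
          hok.pow_lt
      · simp (disch := decide) [State.setVar_var_ne, hev1]
    · have hD1 : s₁.tables = D := by
        simp (disch := decide) [f₁.tables, State.setVar_tables, hD0]
      have hr1 : s₁.var Reg.r = r := by
        simp (disch := decide) [f₁.var, State.setVar_var_ne]
      have ht1 : s₁.arr Arr.tab = s₀.arr Arr.tab := by simp (disch := decide) [f₁.arr]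
      refine ((run_nodeProg hD1 hok hB (hr1 ▸ hrN) h₁).le
        (by gcongr; exact hT r hrN)).imp fun s₂ _ f₂ h₂ => ?_
      rintro -
      rw [hr1, ht1] at h₂
      obtain ⟨h2, h3⟩ := h₂
      have hsame : ∀ r' < D.N, r' ≠ r → ∀ q, s₂.arr Arr.tab (q * D.N + r') =
          s₀.arr Arr.tab (q * D.N + r') := fun r' hr' hne q =>
        h3 _ (by rwa [Tables.address_mod hr'])
      rw [State.setVar_arr]
      refine ⟨fun r' hr' hle q => ?_, fun r' hr' hlt q => ?_⟩
      -- For an already finished node, or for `r` itself, every child has larger rank than `r`, so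
      -- its entries did not change in this round.
      · have hcongr : D.entrySum (s₂.arr Arr.tab) r' q (bagColorings (D.bag r') D.n) =
            D.entrySum (s₀.arr Arr.tab) r' q (bagColorings (D.bag r') D.n) := by
          refine D.entrySum_congr fun j hj hp q => hsame j hj ?_ q
          have := hpar j hj
          omega
        rw [hcongr]
        by_cases hrr : r' = r
        · rw [hrr, h2, hI' r hrN (by omega), Nat.cast_zero, zero_add]
        · rw [hsame r' hr' hrr, hI r' hr' (by omega)]
      · rw [hsame r' hr' (by omega), hI' r' hr' (by omega)]

/-! ### Reading off the answer -/

/-- Looks for an exponent `i` with a cut of size at least `k` whose coefficient has an odd half. -/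
def answerProg : Program :=
  Reg.y ::= read Arr.tab 0 ;;
  forLoop Reg.i (var Reg.J) (
    Program.cond ((1 - Expr.lt (var Reg.i % var Reg.M) (var Reg.k)) * (var Reg.y / 2 % 2))
      (Reg.ans ::= 1) skip ;;
    Reg.y ::= var Reg.y / var Reg.Q)

/-- Successive division by `Q` moves each digit to the lowest position, where its second bit is
tested. No search for a best exponent is needed: any odd count with sufficiently large residue
modulo `M` is a witness. -/
theorem run_answerProg {ω : ℕ → Bool} {B J M k Q : ℕ} {s : State} (hJ : s.var Reg.J = J)
    (hM : s.var Reg.M = M) (hk : s.var Reg.k = k) (hQ : s.var Reg.Q = Q)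
    (ha : s.var Reg.ans = 0) (hB : 1 ≤ B) :
    Run ω B answerProg s (J * 5 + 3) fun s' => s'.var Reg.ans ≠ 0 ↔
      ∃ i < J, k ≤ i % M ∧ s.arr Arr.tab 0 / Q ^ i / 2 % 2 = 1 := by
  have hB1 : 1 < 2 ^ B := Nat.one_lt_two_pow (by omega)
  refine Run.of_bdd fun hbdd => ?_
  refine Run.le (m := 1 + (J * (((1 + 1) + 1) + 2) + 2)) ?_ (by omega)
  refine Run.assign_seq (by decide) (fun h => h.2 _ _) ?_
  refine (Run.forLoop (τ := (1 + 1) + 1) (I := fun e s' =>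
      s'.var Reg.y = s.arr Arr.tab 0 / Q ^ e ∧ (s'.var Reg.ans ≠ 0 ↔
      ∃ i < e, k ≤ i % M ∧ s.arr Arr.tab 0 / Q ^ i / 2 % 2 = 1))
    (by decide) (by decide) (hJ ▸ hbdd.1 _) (fun s' f => ?_) ?_ ?_).imp
    fun s' _ _ h => h.2
  · simp (disch := decide) [f.var, State.setVar_var_ne, hJ]
  · simp (disch := decide) [State.setVar_var_ne, ha]
  · rintro e he s₁ f₁ he' ⟨hy, hI⟩
    have hM1 : s₁.var Reg.M = M := by simp (disch := decide) [f₁.var, State.setVar_var_ne, hM]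
    have hk1 : s₁.var Reg.k = k := by simp (disch := decide) [f₁.var, State.setVar_var_ne, hk]
    have hQ1 : s₁.var Reg.Q = Q := by simp (disch := decide) [f₁.var, State.setVar_var_ne, hQ]
    have hev : ((1 - Expr.lt (var Reg.i % var Reg.M) (var Reg.k)) * (var Reg.y / 2 % 2)).eval s₁ ≠ 0
        ↔ k ≤ e % M ∧ s.arr Arr.tab 0 / Q ^ e / 2 % 2 = 1 := by
      simp only [Expr.eval_mul, Expr.eval_sub, Expr.eval_one, Expr.eval_lt, Expr.eval_mod,
        Expr.eval_var, he', hM1, hk1, Expr.eval_div, hy, Expr.eval_two]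
      by_cases h : e % M < k
      · simp [h, Nat.not_le.2 h]
      · simp [h, Nat.not_lt.1 h]
    have hsucc : (∃ i < e + 1, k ≤ i % M ∧ s.arr Arr.tab 0 / Q ^ i / 2 % 2 = 1) ↔
        (∃ i < e, k ≤ i % M ∧ s.arr Arr.tab 0 / Q ^ i / 2 % 2 = 1) ∨
        (k ≤ e % M ∧ s.arr Arr.tab 0 / Q ^ e / 2 % 2 = 1) := by
      constructor
      · rintro ⟨i, hi, h⟩
        rcases Nat.lt_succ_iff_lt_or_eq.1 hi with h' | rfl
        · exact .inl ⟨i, h', h⟩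
        · exact .inr h
      · rintro (⟨i, hi, h⟩ | h)
        · exact ⟨i, by omega, h⟩
        · exact ⟨e, by omega, h⟩
    refine Run.seq (m₁ := 1 + 1) (m₂ := 1) (Q₁ := fun s₂ => s₂.var Reg.ans ≠ 0 ↔
      ∃ i < e + 1, k ≤ i % M ∧ s.arr Arr.tab 0 / Q ^ i / 2 % 2 = 1)
      (Run.cond (m := 1) (by decide) (fun h => ?_) (fun h => ?_)) fun s₂ f₂ h₂ => ?_
    · refine Run.assign (by decide) (fun _ => by rw [Expr.eval_one]; omega) ?_
      rw [hsucc]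
      simp only [State.setVar_var_self, Expr.eval_one]
      exact ⟨fun _ => .inr (hev.1 h), fun _ => one_ne_zero⟩
    · refine Run.skip ?_
      rw [hI, hsucc]
      exact ⟨.inl, fun h' => h'.resolve_right fun h' => hev.2 h' h⟩
    · refine Run.assign (by decide) (fun h => (Nat.div_le_self _ _).trans_lt (h.1 _)) fun _ => ?_
      have hy2 : s₂.var Reg.y = s₁.var Reg.y := by simp (disch := decide) [f₂.var]
      have hQ2 : s₂.var Reg.Q = Q := by simp (disch := decide) [f₂.var, hQ1]
      simp (disch := decide) only [State.setVar_var_ne, State.setVar_var_self, Expr.eval_div,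
        Expr.eval_var, hy2, hQ2, hy]
      exact ⟨by rw [Nat.div_div_eq_div_mul, pow_succ], h₂⟩

end RAM

/-! ### Sums of products over a tree decomposition -/

section SumProduct

variable {V C : Type} [Fintype V] [DecidableEq V] [Fintype C] [DecidableEq C] [Zero C]
  {K : Type} [CommSemiring K]

/-- The colorings that vanish outside `U`. -/
def colorings (C : Type) [Fintype C] [DecidableEq C] [Zero C] (U : Finset V) : Finset (V → C) :=
  {f | ∀ v, v ∉ U → f v = 0}

/-- The coloring that agrees with `f` on `U` and vanishes elsewhere. -/
def restrictColoring (U : Finset V) (f : V → C) (v : V) : C := if v ∈ U then f v else 0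

theorem mem_colorings {U : Finset V} {f : V → C} : f ∈ colorings C U ↔ ∀ v, v ∉ U → f v = 0 := by
  simp [colorings]

theorem restrictColoring_mem (U : Finset V) (f : V → C) :
    restrictColoring U f ∈ colorings C U := by
  rw [mem_colorings]; intro v hv; simp [restrictColoring, hv]

/-- A coloring of a union is a pair of colorings that agree on the overlap, and the overlap of `X`
with `U` is its overlap with `Y`. In the application, `U` is the union of the earlier bags and `Y`
the parent's bag. -/
theorem sum_colorings_union {U X Y : Finset V} (hXU : ∀ v ∈ X, v ∈ U ↔ v ∈ Y)
    (H G : (V → C) → K)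
    (hH : ∀ f f', (∀ v ∈ U, f v = f' v) → H f = H f')
    (hG : ∀ f f', (∀ v ∈ X, f v = f' v) → G f = G f') :
    ∑ f ∈ colorings C (U ∪ X), H f * G f =
      ∑ g ∈ colorings C U, H g * ∑ x ∈ colorings C X with ∀ v ∈ X, v ∈ Y → x v = g v, G x := by
  simp_rw [Finset.mul_sum]
  rw [Finset.sum_sigma']
  refine Finset.sum_bij' (fun f _ => ⟨restrictColoring U f, restrictColoring X f⟩)
    (fun p _ v => if v ∈ U then p.1 v else p.2 v) ?_ ?_ ?_ ?_ ?_
  · intro f _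
    simp only [Finset.mem_sigma, Finset.mem_filter, restrictColoring_mem, true_and]
    intro v hX hY
    simp [restrictColoring, hX, (hXU v hX).2 hY]
  · rintro ⟨g, x⟩ hp
    simp only [Finset.mem_sigma, Finset.mem_filter, mem_colorings] at hp ⊢
    intro v hv
    simp only [Finset.mem_union, not_or] at hv
    simp [hv.1, hp.2.1 v hv.2]
  · intro f hf
    rw [mem_colorings] at hf
    funext v
    simp only [restrictColoring]
    split_ifs with h1 h2
    · rfl
    · rfl
    · exact (hf v (by simp [h1, h2])).symm
  · rintro ⟨g, x⟩ hp
    simp only [Finset.mem_sigma, Finset.mem_filter, mem_colorings] at hp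
    obtain ⟨hg, hx, hgx⟩ := hp
    have e1 : restrictColoring U (fun v => if v ∈ U then g v else x v) = g := by
      funext v
      by_cases h : v ∈ U
      · simp [restrictColoring, h]
      · simp [restrictColoring, h, hg v h]
    have e2 : restrictColoring X (fun v => if v ∈ U then g v else x v) = x := by
      funext v
      by_cases h : v ∈ X
      · by_cases h' : v ∈ U
        · simp [restrictColoring, h, h', hgx v h ((hXU v h).1 h')]
        · simp [restrictColoring, h, h']
      · simp [restrictColoring, h, hx v h]
    simp only [e1, e2]
  · intro f _
    rw [hH f (restrictColoring U f) fun v hv => by simp [restrictColoring, hv],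
      hG f (restrictColoring X f) fun v hv => by simp [restrictColoring, hv]]

/-- Message passing in a forest computes the sum of the products of local factors. -/
theorem sum_prod_eq_prod_messages {N : ℕ} {X : ℕ → Finset V} {par : ℕ → ℕ}
    (hpar : ∀ j < N, par j < j ∨ par j = N) (hXN : X N = ∅)
    (hrip : ∀ r < N, ∀ j < r, ∀ v ∈ X r, v ∈ X j → v ∈ X (par r))
    (φ M : ℕ → (V → C) → K)
    (hφ : ∀ r < N, ∀ f f', (∀ v ∈ X r, f v = f' v) → φ r f = φ r f')
    (hM : ∀ r < N, ∀ g, M r g = ∑ x ∈ colorings C (X r) with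
      ∀ v ∈ X r, v ∈ X (par r) → x v = g v, φ r x * ∏ c ∈ Finset.range N with par c = r, M c x) :
    ∏ c ∈ Finset.range N with par c = N, M c 0 =
      ∑ f ∈ colorings C ((Finset.range N).biUnion X), ∏ r ∈ Finset.range N, φ r f := by
  have hMc : ∀ r < N, ∀ f f', (∀ v ∈ X r, v ∈ X (par r) → f v = f' v) → M r f = M r f' := by
    intro r hr f f' h
    rw [hM r hr, hM r hr]
    refine Finset.sum_congr (Finset.filter_congr fun x _ => ?_) fun _ _ => rfl
    exact forall_congr' fun v => forall_congr' fun h1 => forall_congr' fun h2 => by rw [h v h1 h2]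
  -- The root is unfolded downwards: the first `r` nodes contribute their local factors, and each
  -- subtree hanging below them, or below the imaginary root `N`, contributes its message. At `r =
  -- 0` this is the message of the forest, at `r = N` no messages remain.
  have main : ∀ r ≤ N, ∏ c ∈ Finset.range N with par c = N, M c 0 =
      ∑ f ∈ colorings C ((Finset.range r).biUnion X), (∏ j ∈ Finset.range r, φ j f) *
        ∏ c ∈ Finset.Ico r N with (par c < r ∨ par c = N), M c f := by
    intro r
    induction r with
    | zero =>
      intro _
      have h0 : colorings C ((Finset.range 0).biUnion X) = {0} := by
        ext f; simp [mem_colorings, funext_iff]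
      rw [h0, Finset.sum_singleton]
      simp
    | succ r ih =>
      intro hr
      rw [ih (by omega)]
      have hr' : r < N := hr
      set U := (Finset.range r).biUnion X with hU
      have hU1 : (Finset.range (r + 1)).biUnion X = U ∪ X r := by
        rw [Finset.range_add_one, Finset.biUnion_insert, Finset.union_comm]
      have hXU : ∀ v ∈ X r, v ∈ U ↔ v ∈ X (par r) := by
        intro v hv
        simp only [hU, Finset.mem_biUnion, Finset.mem_range]
        constructor
        · rintro ⟨j, hj, hvj⟩; exact hrip r hr' j hj v hv hvj
        · intro h
          rcases hpar r hr' with h' | h'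
          · exact ⟨_, h', h⟩
          · rw [h', hXN] at h; simp at h
      have hsplit : Finset.filter (fun c => par c < r + 1 ∨ par c = N) (Finset.Ico (r + 1) N) =
          Finset.filter (fun c => par c < r ∨ par c = N) (Finset.Ico (r + 1) N) ∪
          Finset.filter (fun c => par c = r) (Finset.range N) := by
        ext c
        simp only [Finset.mem_filter, Finset.mem_Ico, Finset.mem_union, Finset.mem_range]
        constructor
        · omega
        · rintro (h | ⟨h1, h2⟩)
          · omega
          · have := hpar c h1; omega
      have hdisj : Disjoint
          (Finset.filter (fun c => par c < r ∨ par c = N) (Finset.Ico (r + 1) N))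
          (Finset.filter (fun c => par c = r) (Finset.range N)) := by
        rw [Finset.disjoint_left]
        simp only [Finset.mem_filter, Finset.mem_Ico, Finset.mem_range]
        omega
      have hins : Finset.filter (fun c => par c < r ∨ par c = N) (Finset.Ico r N) =
          insert r (Finset.filter (fun c => par c < r ∨ par c = N) (Finset.Ico (r + 1) N)) := by
        ext c
        simp only [Finset.mem_filter, Finset.mem_Ico, Finset.mem_insert]
        constructor
        · omega
        · rintro (rfl | h)
          · exact ⟨⟨le_rfl, hr'⟩, hpar c hr'⟩
          · omega
      have hnot : r ∉ Finset.filter (fun c => par c < r ∨ par c = N) (Finset.Ico (r + 1) N) := by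
        simp
      rw [hU1, hsplit, hins]
      have hglue := sum_colorings_union (C := C) hXU
        (fun f => (∏ j ∈ Finset.range r, φ j f) *
          ∏ c ∈ Finset.Ico (r + 1) N with (par c < r ∨ par c = N), M c f)
        (fun f => φ r f * ∏ c ∈ Finset.range N with par c = r, M c f) ?_ ?_
      · refine Eq.trans (Finset.sum_congr rfl fun g _ => ?_)
          (hglue.symm.trans (Finset.sum_congr rfl fun f _ => ?_))
        · rw [Finset.prod_insert hnot, hM r hr' g]; ring
        · rw [Finset.prod_union hdisj, Finset.prod_range_succ]; ring
      · intro f f' h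
        have hsub : ∀ j < r, ∀ v ∈ X j, v ∈ U := fun j hj v hv =>
          Finset.mem_biUnion.2 ⟨j, Finset.mem_range.2 hj, hv⟩
        congr 1
        · exact Finset.prod_congr rfl fun j hj =>
            hφ j (by have := Finset.mem_range.1 hj; omega) f f' fun v hv => h v (hsub j (Finset.mem_range.1 hj) v hv)
        · refine Finset.prod_congr rfl fun c hc => ?_
          simp only [Finset.mem_filter, Finset.mem_Ico] at hc
          refine hMc c hc.1.2 f f' fun v _ hv => ?_
          rcases hc.2 with h' | h'
          · exact h v (hsub _ h' v hv)
          · rw [h', hXN] at hv; simp at hv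
      · intro f f' h
        congr 1
        · exact hφ r hr' f f' h
        · refine Finset.prod_congr rfl fun c hc => ?_
          simp only [Finset.mem_filter, Finset.mem_range] at hc
          exact hMc c hc.1 f f' fun v _ hv => h v (hc.2 ▸ hv)
  rw [main N le_rfl]
  simp

end SumProduct

namespace RAM

/-! ### Correctness of the dynamic program -/

/-- A coloring as a function on the natural numbers. -/
def colorFun {n : ℕ} (f : Fin n → Fin 3) (v : ℕ) : ℕ := if h : v < n then f ⟨v, h⟩ else 0

theorem colorFun_coe {n : ℕ} (f : Fin n → Fin 3) (v : Fin n) : colorFun f v = f v := by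
  simp [colorFun]

/-- Uniqueness of ternary digits; vertices outside the common part contribute the digit 0 to both
codes. -/
theorem encode_colorFun_eq_iff {n : ℕ} {b b' : ℕ → ℕ} (hb : ∀ v < n, b v ≤ 1)
    (hb' : ∀ v < n, b' v ≤ 1) (f g : Fin n → Fin 3) :
    encode b b' (colorFun f) n = encode b b' (colorFun g) n ↔
      ∀ v : Fin n, b v = 1 → b' v = 1 → f v = g v := by
  have key : ∀ m ≤ n, encode b b' (colorFun f) m = encode b b' (colorFun g) m ↔
      ∀ v : Fin n, (v : ℕ) < m → b v = 1 → b' v = 1 → f v = g v := by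
    intro m
    induction m with
    | zero => simp [encode]
    | succ m ih =>
      intro hm
      have hf := colorFun_coe f ⟨m, hm⟩
      have hg := colorFun_coe g ⟨m, hm⟩
      have hlf := (f ⟨m, hm⟩).2
      have hlg := (g ⟨m, hm⟩).2
      simp only at hf hg
      have hiff : (∀ v : Fin n, (v : ℕ) < m + 1 → b v = 1 → b' v = 1 → f v = g v) ↔
          (∀ v : Fin n, (v : ℕ) < m → b v = 1 → b' v = 1 → f v = g v) ∧
          (b m = 1 → b' m = 1 → f ⟨m, hm⟩ = g ⟨m, hm⟩) := by
        constructor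
        · exact fun h => ⟨fun v hv => h v (by omega), h ⟨m, hm⟩ (by simp)⟩
        · rintro ⟨h1, h2⟩ v hv
          rcases Nat.lt_succ_iff_lt_or_eq.1 hv with h | h
          · exact h1 v h
          · obtain rfl : v = ⟨m, hm⟩ := Fin.ext h
            exact h2
      rw [hiff, ← ih (by omega)]
      simp only [encode, hf, hg, Fin.ext_iff]
      have h1 := hb m hm
      have h2 := hb' m hm
      have hc : ∀ a ≤ 1, a = 0 ∨ a = 1 := by omega
      rcases hc _ h1 with h1 | h1 <;> rcases hc _ h2 with h2 | h2 <;> (simp [h1, h2]; try omega)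
  rw [key n le_rfl]
  exact forall_congr' fun v => by simp [v.2]

theorem bagColorings_eq {n : ℕ} {b : ℕ → ℕ} (hb : ∀ v < n, b v ≤ 1) :
    bagColorings b n = 3 ^ (Finset.univ.filter fun v : Fin n => b v = 1).card := by
  rw [bagColorings, Finset.prod_range, Finset.card_filter, ← Finset.prod_pow_eq_pow_sum]
  refine Finset.prod_congr rfl fun v _ => ?_
  have := hb v v.2
  have hc : b v = 0 ∨ b v = 1 := by omega
  rcases hc with h | h <;> simp [h]

/-- The coloring number `x` of a bag as a function on the vertices. -/
def decodeFin (n : ℕ) (b : ℕ → ℕ) (x : ℕ) (v : Fin n) : Fin 3 := Fin.ofNat 3 (decode b x v)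

theorem card_colorings_fin_three {n : ℕ} (U : Finset (Fin n)) :
    (colorings (Fin 3) U).card = 3 ^ U.card := by
  have : colorings (Fin 3) U = Fintype.piFinset fun v => if v ∈ U then Finset.univ else {0} := by
    ext f
    rw [mem_colorings, Fintype.mem_piFinset]
    refine forall_congr' fun v => ?_
    by_cases h : v ∈ U <;> simp [h]
  rw [this, Fintype.card_piFinset]
  simp [apply_ite]

/-- Decoding is a bijection from coloring numbers to colorings that vanish outside the bag: it is
injective, and both sides have 3^|bag| elements. -/
theorem sum_decodeFin {n : ℕ} {b : ℕ → ℕ} (hb : ∀ v < n, b v ≤ 1) {K : Type} [AddCommMonoid K]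
    (G : (Fin n → Fin 3) → K) :
    ∑ x ∈ Finset.range (bagColorings b n), G (decodeFin n b x) =
      ∑ f ∈ colorings (Fin 3) (Finset.univ.filter fun v : Fin n => b v = 1), G f := by
  have hinj : Set.InjOn (decodeFin n b) (Finset.range (bagColorings b n) : Set ℕ) := by
    intro x hx y hy hxy
    simp only [Finset.coe_range, Set.mem_Iio] at hx hy
    have hdec : ∀ v < n, decode b x v = decode b y v := by
      intro v hv
      have := congrArg Fin.val (congrFun hxy ⟨v, hv⟩)
      simpa [decodeFin, Fin.ofNat, Nat.mod_eq_of_lt (decode_lt (hb v hv) _)] using this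
    -- Digits are compared from the top: the quotient by the full product is 0, and each step
    -- recovers the previous quotient from its quotient and its remainder. Outside the bag the
    -- divisor is 1.
    have key : ∀ k ≤ n, x / bagColorings b (n - k) = y / bagColorings b (n - k) := by
      intro k
      induction k with
      | zero => intro _; simp [Nat.div_eq_of_lt hx, Nat.div_eq_of_lt hy]
      | succ k ih =>
        intro hk
        obtain ⟨v, hv⟩ : ∃ v, v = n - (k + 1) := ⟨_, rfl⟩
        have h1 := ih (by omega)
        have e : n - k = v + 1 := by omega
        rw [← hv]
        have hb1 := hb v (by omega)
        have hd := hdec v (by omega)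
        rw [e, bagColorings, Finset.prod_range_succ, ← bagColorings, ← Nat.div_div_eq_div_mul,
          ← Nat.div_div_eq_div_mul] at h1
        unfold decode at hd
        generalize x / bagColorings b v = x' at *
        generalize y / bagColorings b v = y' at *
        have hc : b v = 0 ∨ b v = 1 := by omega
        rcases hc with h | h <;> simp only [h] at h1 hd <;> omega
    simpa [bagColorings] using key n le_rfl
  have himg : (Finset.range (bagColorings b n)).image (decodeFin n b) =
      colorings (Fin 3) (Finset.univ.filter fun v : Fin n => b v = 1) := by
    refine Finset.eq_of_subset_of_card_le ?_ ?_
    · intro f hf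
      obtain ⟨x, _, rfl⟩ := Finset.mem_image.1 hf
      rw [mem_colorings]
      intro v hv
      have h0 : b v = 0 := by
        have := hb v v.2
        simp only [Finset.mem_filter, Finset.mem_univ, true_and] at hv
        omega
      simp [decodeFin, decode, h0]
    · rw [Finset.card_image_of_injOn hinj, card_colorings_fin_three, Finset.card_range,
        bagColorings_eq hb]
  rw [← himg, Finset.sum_image hinj]

end RAM

namespace RAM

namespace Tables

/-- The tables describe a rooted tree decomposition. -/
structure Valid (D : Tables) : Prop where
  N_pos : 0 < D.N
  bag_le : ∀ r ≤ D.N, ∀ v < D.n, D.bag r v ≤ 1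
  bag_last : ∀ v < D.n, D.bag D.N v = 0
  par_zero : D.par 0 = D.N
  par_lt : ∀ r < D.N, r ≠ 0 → D.par r < r
  rip : ∀ r < D.N, ∀ j < r, ∀ v < D.n, D.bag r v = 1 → D.bag j v = 1 → D.bag (D.par r) v = 1
  cover : ∀ u < D.n, ∀ v < D.n, u = v ∨ D.g u v ≠ 0 → ∃ r < D.N, D.bag r u = 1 ∧ D.bag r v = 1

variable {D : Tables}

theorem Valid.par_lt_or (h : D.Valid) : ∀ j < D.N, D.par j < j ∨ D.par j = D.N := by
  intro j hj
  rcases eq_or_ne j 0 with rfl | h0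
  · exact .inr h.par_zero
  · exact .inl (h.par_lt j hj h0)

theorem Valid.par_le (h : D.Valid) : ∀ j < D.N, D.par j ≤ D.N := by
  intro j hj
  have := h.par_lt_or j hj
  omega

theorem Valid.assigned_iff (h : D.Valid) {r e : ℕ} (hr : r < D.N) (he : e < D.n * D.n) :
    D.Assigned r e ↔ D.bag r (e / D.n) = 1 ∧ D.bag r (e % D.n) = 1 ∧
      ¬ (D.bag (D.par r) (e / D.n) = 1 ∧ D.bag (D.par r) (e % D.n) = 1) := by
  have hn : 0 < D.n := Nat.pos_of_ne_zero fun h0 => by simp [h0] at he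
  have hu : e / D.n < D.n := Nat.div_lt_of_lt_mul he
  have hv : e % D.n < D.n := Nat.mod_lt _ hn
  have h1 := h.bag_le r hr.le _ hu
  have h2 := h.bag_le r hr.le _ hv
  have h3 := h.bag_le _ (h.par_le r hr) _ hu
  have h4 := h.bag_le _ (h.par_le r hr) _ hv
  have hc : ∀ a ≤ 1, a = 0 ∨ a = 1 := by omega
  unfold Assigned
  rcases hc _ h1 with h1 | h1 <;> rcases hc _ h2 with h2 | h2 <;>
    rcases hc _ h3 with h3 | h3 <;> rcases hc _ h4 with h4 | h4 <;> simp [h1, h2, h3, h4]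

/-- Each pair of vertices is treated at exactly one node, unless its factor is trivial. -/
theorem Valid.prod_assigned (h : D.Valid) {e : ℕ} (he : e < D.n * D.n) (cu cv : ℕ) :
    (∏ r ∈ Finset.range D.N, if D.Assigned r e then
      D.pairFactor (e / D.n) (e % D.n) cu cv else 1) =
      D.pairFactor (e / D.n) (e % D.n) cu cv := by
  have hn : 0 < D.n := Nat.pos_of_ne_zero fun h0 => by simp [h0] at he
  have hu : e / D.n < D.n := Nat.div_lt_of_lt_mul he
  have hv : e % D.n < D.n := Nat.mod_lt _ hn
  by_cases hcov : ∃ r, r < D.N ∧ D.bag r (e / D.n) = 1 ∧ D.bag r (e % D.n) = 1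
  · classical
    obtain ⟨hr, hru, hrv⟩ := Nat.find_spec hcov
    have hmin : ∀ j < Nat.find hcov,
        ¬ (j < D.N ∧ D.bag j (e / D.n) = 1 ∧ D.bag j (e % D.n) = 1) :=
      fun j hj => Nat.find_min hcov hj
    set r₀ := Nat.find hcov
    -- The pair is charged to the node of least rank containing both vertices: its parent has
    -- smaller rank or an empty bag. At any other node containing both, running intersection puts
    -- them into the parent's bag too.
    rw [Finset.prod_eq_single r₀, if_pos]
    · rw [h.assigned_iff hr he]
      refine ⟨hru, hrv, fun hp => ?_⟩
      rcases h.par_lt_or r₀ hr with h' | h'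
      · exact hmin _ h' ⟨by omega, hp⟩
      · rw [h', h.bag_last _ hu] at hp; simp at hp
    · intro r hr' hne
      rw [Finset.mem_range] at hr'
      refine if_neg fun ha => ?_
      obtain ⟨h1, h2, h3⟩ := (h.assigned_iff hr' he).1 ha
      have hlt : r₀ < r := by
        by_contra hle
        exact hmin r (by omega) ⟨hr', h1, h2⟩
      exact h3 ⟨h.rip r hr' r₀ hlt _ hu h1 hru, h.rip r hr' r₀ hlt _ hv h2 hrv⟩
    · intro hnot; exact absurd (Finset.mem_range.2 hr) hnot
  · have hF : D.pairFactor (e / D.n) (e % D.n) cu cv = 1 := by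
      have h1 : ¬ (e / D.n = e % D.n) := fun heq => hcov <| by
        obtain ⟨r, hr, h⟩ := h.cover _ hu _ hv (.inl heq); exact ⟨r, hr, h⟩
      have h2 : D.g (e / D.n) (e % D.n) = 0 := by
        by_contra hg
        obtain ⟨r, hr, h⟩ := h.cover _ hu _ hv (.inr hg); exact hcov ⟨r, hr, h⟩
      simp [pairFactor, h1, h2]
    simp [hF]

/-- The sum over all colorings of the products of the factors of all pairs. -/
def partitionSum (D : Tables) : ℕ :=
  ∑ f : Fin D.n → Fin 3, ∏ u : Fin D.n, ∏ v : Fin D.n, D.pairFactor u v (f u) (f v)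

theorem encode_zero (b b' : ℕ → ℕ) (n m : ℕ) :
    encode b b' (colorFun (0 : Fin m → Fin 3)) n = 0 := by
  induction n with
  | zero => rfl
  | succ n ih => simp [encode, ih, colorFun]

/-- Address 0 is the only entry of the root: the imaginary parent has an empty bag, so every
coloring gets code 0, and the root has rank 0. The recurrence `htab` is the message equation in
`ZMod D.md`. -/
theorem Valid.tab_zero (h : D.Valid) {tab : ℕ → ℕ}
    (htab : ∀ r < D.N, ∀ q, (tab (q * D.N + r) : ZMod D.md) =
      D.entrySum tab r q (bagColorings (D.bag r) D.n)) :
    (tab 0 : ZMod D.md) = D.partitionSum := by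
  have hmain := sum_prod_eq_prod_messages (C := Fin 3) (K := ZMod D.md) (N := D.N)
    (X := fun r => Finset.univ.filter fun v : Fin D.n => D.bag r v = 1) (par := D.par)
    h.par_lt_or ?_ ?_ (fun r f => (D.localFactor r (colorFun f) : ZMod D.md))
    (fun r f => (tab (D.address r (colorFun f)) : ZMod D.md)) ?_ ?_
  · have h0 : Finset.filter (fun c => D.par c = D.N) (Finset.range D.N) = {0} := by
      ext c
      simp only [Finset.mem_filter, Finset.mem_range, Finset.mem_singleton]
      constructor
      · rintro ⟨h1, h2⟩
        by_contra hc
        have := h.par_lt c h1 hc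
        omega
      · rintro rfl; exact ⟨h.N_pos, h.par_zero⟩
    have ha : D.address 0 (colorFun (0 : Fin D.n → Fin 3)) = 0 := by
      simp [address, encode_zero]
    rw [h0, Finset.prod_singleton, ha] at hmain
    rw [hmain, partitionSum]
    have huniv : (Finset.range D.N).biUnion
        (fun r => Finset.univ.filter fun v : Fin D.n => D.bag r v = 1) = Finset.univ := by
      rw [Finset.eq_univ_iff_forall]
      intro v
      obtain ⟨r, hr, hv, _⟩ := h.cover v v.2 v v.2 (.inl rfl)
      exact Finset.mem_biUnion.2 ⟨r, Finset.mem_range.2 hr, by simpa using hv⟩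
    have hcol : colorings (Fin 3) (Finset.univ : Finset (Fin D.n)) = Finset.univ := by
      ext f; simp [mem_colorings]
    rw [huniv, hcol, Nat.cast_sum]
    refine Finset.sum_congr rfl fun f _ => ?_
    rw [← Nat.cast_prod]
    congr 1
    simp only [localFactor]
    rw [Finset.prod_comm, Finset.prod_congr rfl fun e he =>
      h.prod_assigned (Finset.mem_range.1 he) _ _, Finset.prod_range]
    rw [← Finset.prod_product', Finset.univ_product_univ]
    refine (Fintype.prod_equiv finProdFinEquiv.symm _ _ fun e => ?_)
    simp only [finProdFinEquiv_symm_apply, ← colorFun_coe]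
    rfl
  · ext v
    simp [h.bag_last v v.2]
  · intro r hr j hj v hv hv'
    simp only [Finset.mem_filter, Finset.mem_univ, true_and] at hv hv' ⊢
    exact h.rip r hr j hj v v.2 hv hv'
  · intro r hr f f' hff
    refine congrArg Nat.cast (Finset.prod_congr rfl fun e he => ?_)
    rw [Finset.mem_range] at he
    split_ifs with ha
    · have hn : 0 < D.n := Nat.pos_of_ne_zero fun h0 => by simp [h0] at he
      have hu : e / D.n < D.n := Nat.div_lt_of_lt_mul he
      have hv : e % D.n < D.n := Nat.mod_lt _ hn
      obtain ⟨h1, h2, -⟩ := (h.assigned_iff hr he).1 ha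
      have e1 := hff ⟨_, hu⟩ (by simpa using h1)
      have e2 := hff ⟨_, hv⟩ (by simpa using h2)
      simp only [colorFun, hu, hv, dif_pos, e1, e2]
    · rfl
  · intro r hr g
    have hbr := h.bag_le r hr.le
    have hdec : ∀ x, ∀ v < D.n, decode (D.bag r) x v = colorFun (decodeFin D.n (D.bag r) x) v := by
      intro x v hv
      have hlt := decode_lt (hbr v hv) x
      simp [colorFun, hv, decodeFin, Fin.ofNat, Nat.mod_eq_of_lt hlt]
    have hsum : D.entrySum tab r (encode (D.bag r) (D.bag (D.par r)) (colorFun g) D.n)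
        (bagColorings (D.bag r) D.n) = ∑ f ∈ colorings (Fin 3)
          (Finset.univ.filter fun v : Fin D.n => D.bag r v = 1),
        if encode (D.bag r) (D.bag (D.par r)) (colorFun f) D.n =
          encode (D.bag r) (D.bag (D.par r)) (colorFun g) D.n then
          D.localFactor r (colorFun f) * D.childFactor tab r (colorFun f) else 0 := by
      rw [← sum_decodeFin hbr]
      refine Finset.sum_congr rfl fun x _ => ?_
      rw [encode_congr (hdec x), D.localFactor_congr (hdec x),
        D.childFactor_congr (hdec x) fun _ _ _ _ => rfl]
    refine (htab r hr _).trans ?_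
    rw [hsum, ← Finset.sum_filter, Nat.cast_sum]
    refine Finset.sum_congr ?_ fun f _ => ?_
    · ext f
      simp only [Finset.mem_filter]
      refine and_congr_right fun _ => ?_
      rw [encode_colorFun_eq_iff hbr (h.bag_le _ (h.par_le r hr))]
      simp
    · rw [childFactor, ← Finset.prod_filter]
      push_cast
      rfl

end Tables

end RAM

/-! ### The isolation lemma -/

section Isolation

variable {n l : ℕ}

/-- The number with binary digits `x`. -/
def bitsValue (x : Fin l → Bool) : ℕ := ∑ j, if x j then 2 ^ (j : ℕ) else 0

theorem bitsValue_injective : Function.Injective (bitsValue (l := l)) := by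
  intro x y h
  have key : ∀ z : Fin l → Bool, bitsValue z = finFunctionFinEquiv (m := 2) fun j => if z j then 1 else 0 := by
    intro z
    rw [finFunctionFinEquiv_apply]
    refine Finset.sum_congr rfl fun j _ => ?_
    by_cases hz : z j <;> simp [hz]
  rw [key, key] at h
  have h2 := finFunctionFinEquiv.injective (Fin.ext h)
  funext j
  have := congrFun h2 j
  by_cases hx : x j <;> by_cases hy : y j <;> simp_all

/-- The family `F` has a unique member of minimum weight. -/
def Isolates (F : Finset (Finset (Fin n))) (w : Fin n → ℕ) : Prop :=
  ∃ A ∈ F, ∀ B ∈ F, B ≠ A → ∑ v ∈ A, w v < ∑ v ∈ B, w v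

/-- Members of minimum weight with and without the element `v` exist. -/
def Ambiguous (F : Finset (Finset (Fin n))) (w : Fin n → ℕ) (v : Fin n) : Prop :=
  ∃ A ∈ F, ∃ B ∈ F, v ∈ A ∧ v ∉ B ∧ ∀ C ∈ F, ∑ u ∈ A, w u ≤ ∑ u ∈ C, w u ∧
    ∑ u ∈ B, w u ≤ ∑ u ∈ C, w u

theorem exists_ambiguous {F : Finset (Finset (Fin n))} (hF : F.Nonempty) {w : Fin n → ℕ}
    (h : ¬ Isolates F w) : ∃ v, Ambiguous F w v := by
  obtain ⟨A, hA, hmin⟩ := F.exists_min_image (fun A => ∑ v ∈ A, w v) hF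
  simp only [Isolates, not_exists, not_and, not_forall, not_lt] at h
  obtain ⟨B, hB, hne, hle⟩ := h A hA
  have hminB : ∀ C ∈ F, ∑ u ∈ B, w u ≤ ∑ u ∈ C, w u := fun C hC => hle.trans (hmin C hC)
  by_cases hsub : A ⊆ B
  · obtain ⟨v, hvB, hvA⟩ := Finset.exists_of_ssubset (hsub.ssubset_of_ne hne.symm)
    exact ⟨v, B, hB, A, hA, hvB, hvA, fun C hC => ⟨hminB C hC, hmin C hC⟩⟩
  · obtain ⟨v, hvA, hvB⟩ := Finset.not_subset.1 hsub
    exact ⟨v, A, hA, B, hB, hvA, hvB, fun C hC => ⟨hmin C hC, hminB C hC⟩⟩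

/-- If the weights off `v` are fixed, ambiguity says that the cheapest member avoiding `v` costs as
much as the cheapest one containing it. The former does not depend on the weight of `v` and the
latter increases with it, so at most one value of that weight is ambiguous. -/
theorem Ambiguous.eq_of_eq_off {F : Finset (Finset (Fin n))} {w w' : Fin n → ℕ} {v : Fin n}
    (h : Ambiguous F w v) (h' : Ambiguous F w' v) (hw : ∀ u, u ≠ v → w u = w' u) : w v = w' v := by
  obtain ⟨A, hA, B, hB, hvA, hvB, hmin⟩ := h
  obtain ⟨A', hA', B', hB', hvA', hvB', hmin'⟩ := h'
  have hout : ∀ C, v ∉ C → ∑ u ∈ C, w u = ∑ u ∈ C, w' u := fun C hC =>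
    Finset.sum_congr rfl fun u hu => hw u fun h => hC (h ▸ hu)
  have hin : ∀ C, v ∈ C → ∑ u ∈ C, w u + w' v = ∑ u ∈ C, w' u + w v := by
    intro C hC
    rw [← Finset.sum_erase_add _ w hC, ← Finset.sum_erase_add _ w' hC,
      hout _ (Finset.notMem_erase v C)]
    ring
  have e1 := hin A hvA
  have e2 := hin A' hvA'
  have e3 := hout B hvB
  have e4 := hout B' hvB'
  have i1 := (hmin A' hA').1
  have i2 := (hmin B' hB').2
  have i3 := (hmin' A hA).1
  have i4 := (hmin' B hB).2
  have i5 := (hmin B hB).1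
  have i6 := (hmin A hA).2
  have i7 := (hmin' B' hB').1
  have i8 := (hmin' A' hA').2
  omega

open Classical in
/-- If all elements get independent random weights with `l` bits, where `2 * n ≤ 2 ^ l`, then a
nonempty family is isolated with probability at least `1 / 2`. -/
theorem isolation {F : Finset (Finset (Fin n))} (hF : F.Nonempty) (hl : 2 * n ≤ 2 ^ l) :
    2 * (Finset.univ.filter fun x : Fin n → Fin l → Bool =>
      ¬ Isolates F fun u => bitsValue (x u)).card ≤ 2 ^ (n * l) := by
  -- An ambiguous assignment together with an arbitrary new value at `v` can be recovered from the
  -- modified assignment, since the old value at `v` is forced. So ambiguity at `v` has probability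
  -- at most 2^(-l); a union bound over the vertices finishes the proof.
  have hamb : ∀ v : Fin n, (Finset.univ.filter fun x : Fin n → Fin l → Bool =>
      Ambiguous F (fun u => bitsValue (x u)) v).card * 2 ^ l ≤ 2 ^ (n * l) := by
    intro v
    have hcard : Fintype.card (Fin n → Fin l → Bool) = 2 ^ (n * l) := by
      simp [← pow_mul, mul_comm]
    have hcl : (Finset.univ : Finset (Fin l → Bool)).card = 2 ^ l := by simp
    rw [← hcard, ← hcl, ← Finset.card_product]
    refine Finset.card_le_card_of_injOn (fun p => Function.update p.1 v p.2)
      (fun _ _ => Finset.mem_univ _) ?_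
    rintro ⟨x, y⟩ hx ⟨x', y'⟩ hx' heq
    simp only [Finset.coe_product, Set.mem_prod, Finset.mem_coe, Finset.mem_filter,
      Finset.mem_univ, true_and, and_true] at hx hx'
    have hoff : ∀ u, u ≠ v → x u = x' u := fun u hu => by
      have := congrFun heq u
      simpa [Function.update_of_ne hu] using this
    have hv : x v = x' v := bitsValue_injective
      (hx.eq_of_eq_off hx' fun u hu => by rw [hoff u hu])
    have hy : y = y' := by simpa using congrFun heq v
    rw [hy, Prod.mk.injEq]
    refine ⟨funext fun u => ?_, rfl⟩
    by_cases hu : u = v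
    · rw [hu, hv]
    · exact hoff u hu
  have hsub : (Finset.univ.filter fun x : Fin n → Fin l → Bool =>
      ¬ Isolates F fun u => bitsValue (x u)) ⊆ Finset.univ.biUnion fun v : Fin n =>
      Finset.univ.filter fun x : Fin n → Fin l → Bool =>
        Ambiguous F (fun u => bitsValue (x u)) v := by
    intro x hx
    simp only [Finset.mem_filter, Finset.mem_univ, true_and] at hx
    obtain ⟨v, hv⟩ := exists_ambiguous hF hx
    simpa using ⟨v, hv⟩
  have hle := (Finset.card_le_card hsub).trans Finset.card_biUnion_le
  have hsum : (∑ v : Fin n, (Finset.univ.filter fun x : Fin n → Fin l → Bool =>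
      Ambiguous F (fun u => bitsValue (x u)) v).card) * 2 ^ l ≤ n * 2 ^ (n * l) := by
    rw [Finset.sum_mul]
    simpa using Finset.sum_le_sum fun v (_ : v ∈ Finset.univ) => hamb v
  have h1 := Nat.mul_le_mul_right (2 ^ l) hle
  have h2 : (2 * (Finset.univ.filter fun x : Fin n → Fin l → Bool =>
      ¬ Isolates F fun u => bitsValue (x u)).card) * 2 ^ l ≤ 2 ^ (n * l) * 2 ^ l := by
    calc _ ≤ 2 * (n * 2 ^ (n * l)) := by linarith
      _ = 2 ^ (n * l) * (2 * n) := by ring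
      _ ≤ _ := Nat.mul_le_mul_left _ hl
  exact Nat.le_of_mul_le_mul_right h2 (by positivity)

end Isolation

/-! ### Isolation for the infinite random tape. -/

namespace RAM

theorem coin_cylinder (K : ℕ) (x : ℕ → Bool) :
    coin {ω | ∀ i < K, ω i = x i} = (2 ^ K : ENNReal)⁻¹ := by
  have h : {ω : ℕ → Bool | ∀ i < K, ω i = x i} =
      Set.pi (Finset.range K : Set ℕ) fun i => {x i} := by
    ext ω; simp [Set.mem_pi]
  rw [h, coin, Measure.infinitePi_pi _ fun i _ => MeasurableSet.singleton _]
  simp [ENNReal.inv_pow]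

theorem weight_eq_bitsValue (ω : ℕ → Bool) (l u : ℕ) :
    weight ω l u = bitsValue fun j : Fin l => ω (u * l + j) := by
  rw [weight, Finset.sum_range, bitsValue]

/-- Random weights isolate a nonempty family with probability at least `1 / 2`. -/
theorem coin_not_isolates_le {n l : ℕ} {F : Finset (Finset (Fin n))} (hF : F.Nonempty)
    (hl : 2 * n ≤ 2 ^ l) : coin {ω | ¬ Isolates F fun u => weight ω l u} ≤ 1 / 2 := by
  classical
  set bad := Finset.univ.filter fun x : Fin n → Fin l → Bool =>
    ¬ Isolates F fun u => bitsValue (x u) with hbad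
  -- Only the first `n * l` coins matter, so the bad event is covered by the cylinders over the bad
  -- finite assignments, each of measure 2^(-(n * l)).
  have hsub : {ω | ¬ Isolates F fun u => weight ω l u} ⊆
      ⋃ x ∈ bad, {ω : ℕ → Bool | ∀ (u : Fin n) (j : Fin l), ω (u * l + j) = x u j} := by
    intro ω hω
    simp only [Set.mem_ofPred_eq, weight_eq_bitsValue] at hω
    simp only [Set.mem_iUnion]
    exact ⟨fun u j => ω (u * l + j), by simpa [hbad] using hω, fun _ _ => rfl⟩
  have hcyl : ∀ x : Fin n → Fin l → Bool,
      coin {ω : ℕ → Bool | ∀ (u : Fin n) (j : Fin l), ω (u * l + j) = x u j} = (2 ^ (n * l) : ENNReal)⁻¹ := by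
    intro x
    rw [← coin_cylinder (n * l) fun i => if h : i < n * l then
      x (Fin.divNat ⟨i, h⟩) (Fin.modNat ⟨i, h⟩) else true]
    congr 1
    ext ω
    simp only [Set.mem_ofPred_eq]
    constructor
    · intro h i hi
      rw [dif_pos hi, ← h]
      congr 1
      simp [Nat.div_add_mod']
    · intro h u j
      have hi : (u * l + j : ℕ) < n * l := by
        calc (u * l + j : ℕ) < u * l + l := by have := j.2; omega
          _ = (u + 1) * l := by ring
          _ ≤ _ := Nat.mul_le_mul_right _ u.2
      have hl0 : 0 < l := j.pos
      rw [h _ hi, dif_pos hi]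
      congr 1
      · ext
        simp [Nat.mul_comm _ l, Nat.mul_add_div hl0]
      · ext
        simp [Nat.mod_eq_of_lt j.2]
  have hle : coin {ω | ¬ Isolates F fun u => weight ω l u} ≤
      bad.card * (2 ^ (n * l) : ENNReal)⁻¹ := by
    refine (measure_mono hsub).trans ((measure_biUnion_finset_le _ _).trans ?_)
    simp [hcyl]
  refine hle.trans ?_
  have hiso := isolation (l := l) hF hl
  rw [← hbad] at hiso
  have h2 : (2 : ENNReal) * bad.card ≤ 2 ^ (n * l) := by exact_mod_cast hiso
  rw [← div_eq_mul_inv]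
  refine ENNReal.div_le_of_le_mul ?_
  rw [one_div, mul_comm, ← div_eq_mul_inv, ENNReal.le_div_iff_mul_le (by simp) (by simp), mul_comm]
  exact h2

end RAM

/-! ### Counting consistent cuts -/

namespace SimpleGraph

variable {n : ℕ} (G : SimpleGraph (Fin n))

/-- The vertices with a nonzero color. -/
def side (f : Fin n → Fin 3) : Finset (Fin n) := {v | f v ≠ 0}

/-- Adjacent vertices with nonzero colors have the same color. -/
def Consistent (f : Fin n → Fin 3) : Prop := ∀ u v, G.Adj u v → f u ≠ 0 → f v ≠ 0 → f u = f v

open Classical in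
/-- The number of edges that leave `S`. -/
noncomputable def cutSize (S : Finset (Fin n)) : ℕ :=
  ∑ u : Fin n, ∑ v : Fin n, if G.Adj u v ∧ u ∈ S ∧ v ∉ S then 1 else 0

/-- Orienting a cut edge from `S` to its complement makes ordered pairs and edges correspond one to
one; no factor 2 arises. -/
theorem ncard_cutset (S : Finset (Fin n)) : (G.cutset (S : Set (Fin n))).ncard = G.cutSize S := by
  classical
  have h : G.cutset (S : Set (Fin n)) = ((Finset.univ.filter fun p : Fin n × Fin n =>
      G.Adj p.1 p.2 ∧ p.1 ∈ S ∧ p.2 ∉ S).image fun p => s(p.1, p.2) : Finset (Sym2 (Fin n))) := by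
    ext e
    simp only [cutset, Set.mem_ofPred_eq, Finset.coe_image, Set.mem_image, Finset.mem_coe,
      Finset.mem_filter, Finset.mem_univ, true_and, Prod.exists]
    constructor
    · rintro ⟨u, v, h1, h2, h3, rfl⟩; exact ⟨u, v, ⟨h1, h2, h3⟩, rfl⟩
    · rintro ⟨u, v, ⟨h1, h2, h3⟩, rfl⟩; exact ⟨u, v, h1, h2, h3, rfl⟩
  rw [h, Set.ncard_coe_finset, Finset.card_image_of_injOn, Finset.card_filter, cutSize,
    ← Finset.univ_product_univ, Finset.sum_product]
  rintro ⟨u, v⟩ hp ⟨u', v'⟩ hp' heq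
  simp only [Finset.coe_filter, Finset.mem_univ, true_and, Set.mem_ofPred_eq] at hp hp'
  rcases Sym2.eq_iff.1 heq with ⟨h1, h2⟩ | ⟨h1, h2⟩
  · simp only at h1 h2; rw [h1, h2]
  · simp only at h1 h2; subst h1 h2; exact absurd hp.2.1 hp'.2.2

theorem cutSize_le (S : Finset (Fin n)) : G.cutSize S ≤ n * n := by
  classical
  calc G.cutSize S ≤ ∑ _u : Fin n, ∑ _v : Fin n, 1 := by
        unfold cutSize
        gcongr with u _ v _
        split_ifs <;> simp
    _ = n * n := by simp

open Classical in
/-- The number of consistent colorings with a given set of colored vertices. -/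
theorem card_consistent (S : Finset (Fin n)) :
    (Finset.univ.filter fun f : Fin n → Fin 3 => G.Consistent f ∧ side f = S).card =
      2 ^ Fintype.card (G.induce (S : Set (Fin n))).ConnectedComponent := by
  have hone : ∀ a : Fin 3, a ≠ 0 → a ≠ 1 → a = 2 := by decide
  rw [← Fintype.card_bool, ← Fintype.card_fun, ← Fintype.card_coe]
  -- Consistency means that the color is constant on each component of `G[S]`, so such a coloring is
  -- a choice between 1 and 2 for every component.
  refine Fintype.card_congr ⟨fun f => ConnectedComponent.lift
    (fun v => decide (f.1 v = 1)) ?_, fun c => ⟨fun v => if h : v ∈ S then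
      (if c (connectedComponentMk _ ⟨v, h⟩) then 1 else 2) else 0, ?_⟩, ?_, ?_⟩
  · obtain ⟨f, hf⟩ := f
    simp only [Finset.mem_filter, Finset.mem_univ, true_and] at hf
    rintro v w p -
    induction p with
    | nil => rfl
    | cons h _ ih =>
      rename_i u v w _
      refine Eq.trans ?_ ih
      have hu : f u ≠ 0 := by
        have : (u : Fin n) ∈ side f := hf.2 ▸ u.2
        simpa [side] using this
      have hv : f v ≠ 0 := by
        have : (v : Fin n) ∈ side f := hf.2 ▸ v.2
        simpa [side] using this
      have huv : f u = f v := hf.1 _ _ h hu hv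
      simp only [huv]
  · simp only [Finset.mem_filter, Finset.mem_univ, true_and]
    constructor
    · intro u v huv hu hv
      have hu' : u ∈ S := by by_contra h; simp [h] at hu
      have hv' : v ∈ S := by by_contra h; simp [h] at hv
      have hadj : (G.induce (S : Set (Fin n))).Adj ⟨u, hu'⟩ ⟨v, hv'⟩ := huv
      simp only [hu', hv', dif_pos, ConnectedComponent.eq.2 hadj.reachable]
    · ext v
      by_cases h : v ∈ S
      · simp only [side, Finset.mem_filter, Finset.mem_univ, true_and, h, dif_pos, iff_true]
        split_ifs <;> decide
      · simp [side, h]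
  · rintro ⟨f, hf⟩
    simp only [Finset.mem_filter, Finset.mem_univ, true_and] at hf
    ext v : 2
    by_cases h : v ∈ S
    · have hv : f v ≠ 0 := by rw [← hf.2] at h; simpa [side] using h
      by_cases h1 : f v = 1
      · simp [h, h1]
      · simp [h, hone _ hv h1]
    · have hv : f v = 0 := by rw [← hf.2] at h; simpa [side] using h
      simp [h, hv]
  · intro c
    funext k
    induction k using ConnectedComponent.ind with
    | h v =>
      obtain ⟨v, hv⟩ := v
      simp only [Finset.mem_coe] at hv
      by_cases hc : c (connectedComponentMk _ ⟨v, hv⟩) <;> simp [hc]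

theorem card_connectedComponent_eq_one_iff {V : Type} (H : SimpleGraph V)
    [Fintype H.ConnectedComponent] :
    Fintype.card H.ConnectedComponent = 1 ↔ H.Connected := by
  rw [Fintype.card_eq_one_iff_nonempty_unique, connected_iff]
  constructor
  · rintro ⟨hu⟩
    refine ⟨fun u v => ConnectedComponent.eq.1 (Subsingleton.elim _ _), ?_⟩
    obtain ⟨v, _⟩ := (default : H.ConnectedComponent).exists_rep
    exact ⟨v⟩
  · rintro ⟨hp, ⟨v⟩⟩
    have := hp.subsingleton_connectedComponent
    exact ⟨⟨⟨H.connectedComponentMk v⟩, fun _ => Subsingleton.elim _ _⟩⟩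

open Classical in
/-- Half the number of consistent colorings, for a family of vertex sets, has the same parity as
the number of connected sets. -/
theorem half_sum_consistent (F : Finset (Finset (Fin n))) :
    (∑ S ∈ F, 2 ^ Fintype.card (G.induce (S : Set (Fin n))).ConnectedComponent) / 2 % 2 =
      (F.filter fun S : Finset (Fin n) => (G.induce (S : Set (Fin n))).Connected).card % 2 := by
  -- The power of two is split by the number of components: none, one, or at least two. In the sum
  -- over `F` the empty set occurs at most once, so the odd part is at most 1 and is lost on
  -- halving.
  have hterm : ∀ S : Finset (Fin n), ∃ x,
      2 ^ Fintype.card (G.induce (S : Set (Fin n))).ConnectedComponent =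
      (if S = ∅ then 1 else 0) + 2 * (if (G.induce (S : Set (Fin n))).Connected then 1 else 0) +
        4 * x := by
    intro S
    have hempty : Fintype.card (G.induce (S : Set (Fin n))).ConnectedComponent = 0 ↔ S = ∅ := by
      rw [Fintype.card_eq_zero_iff]
      constructor
      · intro h
        by_contra hS
        obtain ⟨v, hv⟩ := Finset.nonempty_iff_ne_empty.2 hS
        exact h.elim (connectedComponentMk _ ⟨v, hv⟩)
      · rintro hS
        refine ⟨fun c => ?_⟩
        obtain ⟨v, _⟩ := c.exists_rep
        have := v.2
        simp [hS] at this
    have hconn := card_connectedComponent_eq_one_iff (G.induce (S : Set (Fin n)))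
    generalize Fintype.card (G.induce (S : Set (Fin n))).ConnectedComponent = c at hempty hconn
    simp only [← hempty, ← hconn]
    rcases c with _ | _ | m
    · exact ⟨0, by simp⟩
    · exact ⟨0, by simp⟩
    · exact ⟨2 ^ m, by simp [pow_succ]; ring⟩
  choose x hx using hterm
  rw [Finset.sum_congr rfl fun S _ => hx S, Finset.sum_add_distrib, Finset.sum_add_distrib,
    ← Finset.mul_sum, ← Finset.mul_sum, Finset.card_filter]
  have h1 : ∑ S ∈ F, (if S = ∅ then 1 else 0) ≤ 1 := by
    rw [Finset.sum_ite_eq']; split_ifs <;> simp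
  omega

end SimpleGraph

namespace RAM

/-! ### Digits -/

theorem sum_div_pow_mod (a : ℕ → ℕ) {Q J j : ℕ} (ha : ∀ i, a i < Q) (hj : j < J) :
    (∑ i ∈ Finset.range J, a i * Q ^ i) / Q ^ j % Q = a j := by
  induction j generalizing a J with
  | zero =>
    obtain ⟨J, rfl⟩ : ∃ J', J = J' + 1 := ⟨J - 1, by omega⟩
    rw [Finset.sum_range_succ', pow_zero, Nat.div_one, mul_one, Nat.add_mod,
      Finset.sum_nat_mod]
    simp [pow_succ, ← mul_assoc, Nat.mod_eq_of_lt (ha 0)]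
  | succ j ih =>
    obtain ⟨J, rfl⟩ : ∃ J', J = J' + 1 := ⟨J - 1, by omega⟩
    have hQ : 0 < Q := (Nat.zero_le _).trans_lt (ha 0)
    have h1 : ∑ i ∈ Finset.range (J + 1), a i * Q ^ i =
        a 0 + Q * ∑ i ∈ Finset.range J, a (i + 1) * Q ^ i := by
      rw [Finset.sum_range_succ', Finset.mul_sum, add_comm]
      congr 1
      · simp
      · exact Finset.sum_congr rfl fun i _ => by ring
    rw [h1, pow_succ', ← Nat.div_div_eq_div_mul, Nat.add_mul_div_left _ _ hQ,
      Nat.div_eq_of_lt (ha 0), zero_add]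
    exact ih (fun i => a (i + 1)) (fun i => ha (i + 1)) (by omega)

/-- The second lowest bit of a digit in base `2 ^ b` survives reduction modulo a larger power. -/
theorem half_digit_eq (a : ℕ → ℕ) {b J j z : ℕ} (hb : 2 ≤ b) (ha : ∀ i, a i < 2 ^ b) (hj : j < J)
    (hz : z ≡ ∑ i ∈ Finset.range J, a i * (2 ^ b) ^ i [MOD (2 ^ b) ^ J]) :
    z / (2 ^ b) ^ j / 2 % 2 = a j / 2 % 2 := by
  -- The tested parity is bit `b * j + 1`, which lies below the modulus 2^(b * J). It agrees with
  -- the second bit of digit `j` because the base is divisible by 4.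
  have key : ∀ y : ℕ, y / (2 ^ b) ^ j / 2 % 2 = 1 ↔ y.testBit (b * j + 1) = true := by
    intro y
    rw [Nat.testBit_eq_decide_div_mod_eq, decide_eq_true_iff, pow_succ, pow_mul,
      Nat.div_div_eq_div_mul]
  have hlt : b * j + 1 < b * J := by
    have : b * (j + 1) ≤ b * J := Nat.mul_le_mul_left _ hj
    rw [mul_add] at this; omega
  have hbit : ∀ y : ℕ, (y % (2 ^ b) ^ J).testBit (b * j + 1) = y.testBit (b * j + 1) := by
    intro y
    rw [← pow_mul, Nat.testBit_mod_two_pow]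
    simp [hlt]
  have h1 : z / (2 ^ b) ^ j / 2 % 2 = 1 ↔
      (∑ i ∈ Finset.range J, a i * (2 ^ b) ^ i) / (2 ^ b) ^ j / 2 % 2 = 1 := by
    rw [key, key, ← hbit, hz, hbit]
  have hd := sum_div_pow_mod a ha hj
  obtain ⟨b', rfl⟩ : ∃ b', b = b' + 2 := ⟨b - 2, by omega⟩
  have h2 : (∑ i ∈ Finset.range J, a i * (2 ^ (b' + 2)) ^ i) / (2 ^ (b' + 2)) ^ j / 2 % 2 =
      a j / 2 % 2 := by
    set y := (∑ i ∈ Finset.range J, a i * (2 ^ (b' + 2)) ^ i) / (2 ^ (b' + 2)) ^ j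
    have h4 : 2 ^ (b' + 2) = 4 * 2 ^ b' := by ring
    have := Nat.div_add_mod y (2 ^ (b' + 2))
    rw [hd, h4, mul_assoc] at this
    omega
  omega

end RAM

/-! ### Cut and count: from digits to connected cuts. -/

namespace RAM

open SimpleGraph

/-- Membership conditions for the vertices with numbers `s` and `t`, if there are such vertices. -/
def Separates {n : ℕ} (s t : ℕ) (S : Finset (Fin n)) : Prop :=
  ∀ v : Fin n, ((v : ℕ) = s → v ∈ S) ∧ ((v : ℕ) = t → v ∉ S)

/-- The exponent that belongs to a vertex set. -/
noncomputable def exponent {n : ℕ} (G : SimpleGraph (Fin n)) (M : ℕ) (w : Fin n → ℕ)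
    (S : Finset (Fin n)) : ℕ := G.cutSize S + M * ∑ v ∈ S, w v

open Classical in
-- A zero factor records a violated condition. Otherwise the product adds exponents: off the
-- diagonal, only the order with the first vertex in `S` and the second outside contributes, so each
-- cut edge counts once; the diagonal contributes the weights.
theorem Tables.prod_pairFactor {D : Tables} (G : SimpleGraph (Fin D.n)) (w : Fin D.n → ℕ) (M : ℕ)
    (hg : ∀ u v : Fin D.n, D.g u v ≠ 0 ↔ G.Adj u v)
    (hW : ∀ u : Fin D.n, D.W u = D.Q ^ (M * w u)) (f : Fin D.n → Fin 3) :
    ∏ u : Fin D.n, ∏ v : Fin D.n, D.pairFactor u v (f u) (f v) =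
      if G.Consistent f ∧ Separates D.s D.t (side f) then D.Q ^ exponent G M w (side f) else 0 := by
  have hpair : ∀ u v : Fin D.n, D.pairFactor u v (f u) (f v) =
      if (G.Adj u v → f u ≠ 0 → f v ≠ 0 → f u = f v) ∧
        (u = v → ((u : ℕ) = D.s → u ∈ side f) ∧ ((u : ℕ) = D.t → u ∉ side f)) then
        D.Q ^ ((if G.Adj u v ∧ u ∈ side f ∧ v ∉ side f then 1 else 0) +
          if u = v then (if u ∈ side f then M * w u else 0) else 0) else 0 := by
    intro u v
    have hz : ∀ a : Fin 3, (a : ℕ) = 0 ↔ a = 0 := by decide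
    by_cases huv : u = v
    · subst huv
      by_cases hu : f u = 0
      · by_cases hs : (u : ℕ) = D.s <;> simp [pairFactor, side, hu, hs]
      · by_cases ht : (u : ℕ) = D.t <;> simp [pairFactor, side, hu, ht, hz, ← hW]
    · have huv' : (u : ℕ) ≠ v := fun h => huv (Fin.ext h)
      by_cases hadj : G.Adj u v
      · have hg' := (hg u v).2 hadj
        by_cases hu : f u = 0
        · simp [pairFactor, side, hu, huv, huv', hg']
        · by_cases hv : f v = 0
          · simp [pairFactor, side, hu, hv, huv, huv', hg', hadj, hz]
          · by_cases hfuv : f u = f v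
            · simp [pairFactor, side, hv, huv, huv', hg', hz, hfuv]
            · have : (f u : ℕ) ≠ f v := fun h => hfuv (Fin.ext h)
              simp [pairFactor, side, hu, hv, huv, huv', hg', hadj, hz, hfuv, this]
      · have hg' : D.g u v = 0 := by by_contra h; exact hadj ((hg u v).1 h)
        simp [pairFactor, huv, huv', hg', hadj]
  simp only [hpair, Finset.prod_ite_zero, Finset.prod_pow_eq_pow_sum]
  refine if_congr ?_ ?_ rfl
  · simp only [Finset.mem_univ, true_implies]
    constructor
    · intro h
      exact ⟨fun u v => (h u v).1, fun v => (h v v).2 rfl⟩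
    · rintro ⟨h1, h2⟩ u v
      exact ⟨h1 u v, fun _ => h2 u⟩
  · congr 1
    simp only [exponent, cutSize, Finset.sum_add_distrib, Finset.sum_ite_eq, Finset.mem_univ,
      if_true, Finset.mul_sum]
    rw [← Finset.sum_filter]
    congr 2
    ext v; simp

open Classical in
/-- The bits of the result tell the parities of the numbers of connected vertex sets with a given
exponent. -/
theorem Tables.bit_partitionSum {D : Tables} {n : ℕ} (hn : D.n = n) (G : SimpleGraph (Fin n))
    (w : Fin n → ℕ) {M J j z : ℕ} (hg : ∀ u v : Fin n, D.g u v ≠ 0 ↔ G.Adj u v)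
    (hW : ∀ u : Fin n, D.W u = D.Q ^ (M * w u)) (hQ : D.Q = 4 ^ (n + 1))
    (hJ : ∀ S, exponent G M w S < J) (hj : j < J) (hz : z ≡ D.partitionSum [MOD D.Q ^ J]) :
    z / D.Q ^ j / 2 % 2 = (Finset.univ.filter fun S : Finset (Fin n) =>
      Separates D.s D.t S ∧ exponent G M w S = j ∧
        (G.induce (S : Set (Fin n))).Connected).card % 2 := by
  subst hn
  set F : ℕ → Finset (Finset (Fin D.n)) := fun j => Finset.univ.filter fun S =>
    Separates D.s D.t S ∧ exponent G M w S = j with hF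
  set a : ℕ → ℕ := fun j => ∑ S ∈ F j,
    2 ^ Fintype.card (G.induce (S : Set (Fin D.n))).ConnectedComponent with ha
  have hsum : D.partitionSum = ∑ i ∈ Finset.range J, a i * D.Q ^ i := by
    unfold partitionSum
    simp only [prod_pairFactor G w M hg hW]
    -- Colorings are grouped by their colored set, which determines the exponent; later the sets are
    -- grouped by exponent.
    rw [← Finset.sum_fiberwise Finset.univ (fun f : Fin D.n → Fin 3 => side f)]
    have h1 : ∀ S : Finset (Fin D.n), (∑ f : Fin D.n → Fin 3 with side f = S,
        if G.Consistent f ∧ Separates D.s D.t (side f) then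
          D.Q ^ exponent G M w (side f) else 0) =
        if Separates D.s D.t S then
          2 ^ Fintype.card (G.induce (S : Set (Fin D.n))).ConnectedComponent *
            D.Q ^ exponent G M w S else 0 := by
      intro S
      rw [← card_consistent]
      by_cases hS : Separates D.s D.t S
      · rw [if_pos hS, ← smul_eq_mul, ← Finset.sum_const, Finset.sum_filter, Finset.sum_filter]
        refine Finset.sum_congr rfl fun f _ => ?_
        by_cases hf : side f = S
        · simp [hf, hS]
        · simp [hf]
      · rw [if_neg hS]
        refine Finset.sum_eq_zero fun f hf => ?_
        rw [Finset.mem_filter] at hf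
        simp [hf.2, hS]
    rw [Finset.sum_congr rfl fun S _ => h1 S, ← Finset.sum_filter,
      ← Finset.sum_fiberwise_of_maps_to (t := Finset.range J) (g := exponent G M w)
      fun S _ => Finset.mem_range.2 (hJ S)]
    refine Finset.sum_congr rfl fun i _ => ?_
    rw [ha, Finset.sum_mul, Finset.filter_filter]
    refine Finset.sum_congr rfl fun S hS => ?_
    rw [(Finset.mem_filter.1 hS).2.2]
  -- There is no carry between digits: all consistent colorings together number at most 3^n, below
  -- the base.
  have hlt : ∀ i, a i < 4 ^ (D.n + 1) := by
    intro i
    have h1 : a i ≤ ∑ S : Finset (Fin D.n), (Finset.univ.filter fun f : Fin D.n → Fin 3 =>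
        side f = S).card := by
      refine (Finset.sum_le_sum_of_subset (Finset.subset_univ _)).trans
        (Finset.sum_le_sum fun S _ => ?_)
      rw [← card_consistent]
      exact Finset.card_le_card (Finset.monotone_filter_right _ fun f _ h => h.2)
    rw [← Finset.card_eq_sum_card_fiberwise fun f _ => Finset.mem_univ _] at h1
    have h2 : 3 ^ D.n < 4 ^ (D.n + 1) :=
      (Nat.pow_le_pow_left (by simp) _).trans_lt (Nat.pow_lt_pow_right (by simp) (by simp))
    simp only [Finset.card_univ, Fintype.card_fun, Fintype.card_fin] at h1
    omega
  have h4 : 4 ^ (D.n + 1) = 2 ^ (2 * (D.n + 1)) := by rw [pow_mul]; norm_num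
  rw [h4] at hlt
  rw [hsum, hQ, h4] at hz
  rw [hQ, h4, half_digit_eq a (by omega) hlt hj hz, ha, half_sum_consistent, hF,
    Finset.filter_filter]
  simp only [and_assoc]

theorem exponent_mod {n : ℕ} (G : SimpleGraph (Fin n)) (w : Fin n → ℕ) (S : Finset (Fin n)) :
    exponent G (cutBound n) w S % cutBound n = G.cutSize S := by
  rw [exponent, Nat.add_mul_mod_self_left, Nat.mod_eq_of_lt]
  exact Nat.lt_succ_of_le (G.cutSize_le S)

theorem exponent_lt {n : ℕ} (G : SimpleGraph (Fin n)) {w : Fin n → ℕ}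
    (hw : ∀ v, w v < 2 ^ weightBits n) (S : Finset (Fin n)) :
    exponent G (cutBound n) w S < expBound n := by
  have h1 : ∑ v ∈ S, w v ≤ n * 2 ^ weightBits n :=
    calc ∑ v ∈ S, w v ≤ ∑ v : Fin n, 2 ^ weightBits n :=
          (Finset.sum_le_sum_of_subset (Finset.subset_univ _)).trans
            (Finset.sum_le_sum fun v _ => (hw v).le)
      _ = _ := by simp
  have h2 : G.cutSize S < cutBound n := Nat.lt_succ_of_le (G.cutSize_le S)
  have h3 : ∑ v ∈ S, w v + 1 ≤ (n + 1) * 2 ^ weightBits n + 1 := by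
    have : n * 2 ^ weightBits n ≤ (n + 1) * 2 ^ weightBits n := Nat.mul_le_mul_right _ (by omega)
    omega
  calc exponent G (cutBound n) w S < cutBound n * (∑ v ∈ S, w v + 1) := by
        unfold exponent; rw [mul_add]; omega
    _ ≤ _ := Nat.mul_le_mul_left _ h3

/-- The condition checked by the algorithm. -/
def Detects {n : ℕ} (G : SimpleGraph (Fin n)) (s t k : ℕ) (w : Fin n → ℕ) : Prop :=
  open Classical in
  ∃ j < expBound n, k ≤ j % cutBound n ∧ (Finset.univ.filter fun S : Finset (Fin n) =>
    Separates s t S ∧ exponent G (cutBound n) w S = j ∧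
      (G.induce (S : Set (Fin n))).Connected).card % 2 = 1

theorem Detects.exists_cut {n : ℕ} {G : SimpleGraph (Fin n)} {s t k : ℕ} {w : Fin n → ℕ}
    (h : Detects G s t k w) : ∃ S : Finset (Fin n), Separates s t S ∧
      (G.induce (S : Set (Fin n))).Connected ∧ k ≤ G.cutSize S := by
  classical
  obtain ⟨j, _, hk, hodd⟩ := h
  have hpos : ∀ c, c % 2 = 1 → 0 < c := by omega
  obtain ⟨S, hS⟩ := Finset.card_pos.1 (hpos _ hodd)
  simp only [Finset.mem_filter, Finset.mem_univ, true_and] at hS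
  refine ⟨S, hS.1, hS.2.2, ?_⟩
  rwa [← hS.2.1, exponent_mod] at hk

open Classical in
-- A connected set satisfying the conditions on s and t with the same exponent as the isolated one
-- has the same cut size, hence lies in the family, and has the same weight. Strict minimality
-- forces equality, so the count is 1. Isolation is applied to all cuts of size at least `k`, not
-- only to maximum ones.
theorem Detects.of_isolates {n : ℕ} {G : SimpleGraph (Fin n)} {s t k : ℕ} {w : Fin n → ℕ}
    (hw : ∀ v, w v < 2 ^ weightBits n)
    (h : Isolates (Finset.univ.filter fun S : Finset (Fin n) => Separates s t S ∧
      (G.induce (S : Set (Fin n))).Connected ∧ k ≤ G.cutSize S) w) : Detects G s t k w := by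
  obtain ⟨S, hS, hmin⟩ := h
  simp only [Finset.mem_filter, Finset.mem_univ, true_and] at hS hmin
  refine ⟨_, exponent_lt G hw S, by rw [exponent_mod]; exact hS.2.2, ?_⟩
  have : (Finset.univ.filter fun A : Finset (Fin n) => Separates s t A ∧
      exponent G (cutBound n) w A = exponent G (cutBound n) w S ∧
      (G.induce (A : Set (Fin n))).Connected) = {S} := by
    ext A
    simp only [Finset.mem_filter, Finset.mem_univ, true_and, Finset.mem_singleton]
    constructor
    · rintro ⟨h1, h2, h3⟩
      by_contra hne
      have hcut : G.cutSize A = G.cutSize S := by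
        rw [← exponent_mod G w A, h2, exponent_mod]
      have hlt := hmin A ⟨h1, h3, hcut ▸ hS.2.2⟩ hne
      unfold exponent at h2
      rw [hcut] at h2
      have := Nat.eq_of_mul_eq_mul_left (by simp [cutBound]) (Nat.add_left_cancel h2)
      omega
    · rintro rfl; exact ⟨hS.1, rfl, hS.2.1⟩
  rw [this]; simp

theorem weight_lt (ω : ℕ → Bool) (l u : ℕ) : weight ω l u < 2 ^ l :=
  sum_bits_lt (fun j => ω (u * l + j)) l

theorem coin_not_detects_le {n : ℕ} {G : SimpleGraph (Fin n)} {s t k : ℕ} {S : Finset (Fin n)}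
    (hS : Separates s t S) (hc : (G.induce (S : Set (Fin n))).Connected) (hk : k ≤ G.cutSize S) :
    coin {ω | ¬ Detects G s t k fun u => weight ω (weightBits n) u} ≤ 1 / 2 := by
  classical
  refine (measure_mono ?_).trans (coin_not_isolates_le
    (F := Finset.univ.filter fun S : Finset (Fin n) => Separates s t S ∧
      (G.induce (S : Set (Fin n))).Connected ∧ k ≤ G.cutSize S)
    ⟨S, by simpa using ⟨hS, hc, hk⟩⟩ (le_two_pow_weightBits n))
  intro ω hω hi
  exact hω (.of_isolates (fun v => weight_lt _ _ _) hi)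

end RAM

/-! ### Reading the input -/

namespace DecomposedGraph

open Classical in
/-- The array `a` holds the matrices of `D` from the address `o` on. -/
structure Layout (D : DecomposedGraph) (a : ℕ → ℕ) (o : ℕ) : Prop where
  adj : ∀ u v : Fin D.n, a (o + u * D.n + v) ≠ 0 ↔ D.graph.Adj u v
  tree : ∀ i j : Fin D.N, a (o + D.n * D.n + i * D.N + j) ≠ 0 ↔ D.decomp.tree.Adj i j
  bag : ∀ (i : Fin D.N) (v : Fin D.n), a (o + D.n * D.n + D.N * D.N + i * D.n + v) =
    if v ∈ D.decomp.bag i then 1 else 0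
  last : ∀ v : Fin D.n, a (o + D.n * D.n + D.N * D.N + D.N * D.n + v) = 0

end DecomposedGraph

theorem length_matrixWord {p q : ℕ} (M : Fin p → Fin q → Prop) :
    (matrixWord M).length = p * q := by simp [matrixWord]

theorem mul_add_lt_mul {p q : ℕ} (i : Fin p) (j : Fin q) : (i * q + j : ℕ) < p * q := by
  calc (i * q + j : ℕ) < i * q + q := by have := j.2; omega
    _ = (i + 1) * q := by ring
    _ ≤ _ := Nat.mul_le_mul_right _ i.2

open Classical in
theorem getD_matrixWord {p q : ℕ} (M : Fin p → Fin q → Prop) (i : Fin p) (j : Fin q) :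
    (matrixWord M).getD (i * q + j) 0 = if M i j then 1 else 0 := by
  have hlt := mul_add_lt_mul i j
  have hq : 0 < q := j.pos
  have h1 : Fin.divNat (⟨i * q + j, hlt⟩ : Fin (p * q)) = i := by
    ext; simp [Nat.mul_comm _ q, Nat.mul_add_div hq]
  have h2 : Fin.modNat (⟨i * q + j, hlt⟩ : Fin (p * q)) = j := by
    ext; simp [Nat.mod_eq_of_lt j.2]
  rw [List.getD_eq_getElem _ _ (by rwa [length_matrixWord])]
  simp only [matrixWord, List.getElem_ofFn, h1, h2]

theorem getD_append_add (l l' : List ℕ) (i : ℕ) : (l ++ l').getD (l.length + i) 0 = l'.getD i 0 := by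
  rw [List.getD_append_right _ _ _ _ (by omega), Nat.add_sub_cancel_left]

/-- The `last` condition concerns addresses past the end of the input, where the memory holds 0;
this gives the imaginary node `N` an empty bag without any code. -/
theorem DecomposedGraph.layout (D : DecomposedGraph) (pre : List ℕ) :
    D.Layout (fun i => (pre ++ D.word).getD i 0) pre.length := by
  have hadj : ∀ u v : Fin D.n, (pre ++ D.word).getD (pre.length + u * D.n + v) 0 =
      (matrixWord D.graph.Adj).getD (u * D.n + v) 0 := by
    intro u v
    rw [add_assoc, getD_append_add, DecomposedGraph.word, List.append_assoc,
      List.getD_append _ _ _ _ (by rw [length_matrixWord]; exact mul_add_lt_mul u v)]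
  have htree : ∀ i j : Fin D.N, (pre ++ D.word).getD (pre.length + D.n * D.n + i * D.N + j) 0 =
      (matrixWord D.decomp.tree.Adj).getD (i * D.N + j) 0 := by
    intro i j
    have e : pre.length + D.n * D.n + i * D.N + j =
      pre.length + ((matrixWord D.graph.Adj).length + (i * D.N + j)) := by
      rw [length_matrixWord]; ring
    rw [e, getD_append_add, DecomposedGraph.word, List.append_assoc, getD_append_add,
      List.getD_append _ _ _ _ (by rw [length_matrixWord]; exact mul_add_lt_mul i j)]
  have hbag : ∀ m, (pre ++ D.word).getD (pre.length + D.n * D.n + D.N * D.N + m) 0 =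
      (matrixWord fun i v => v ∈ D.decomp.bag i).getD m 0 := by
    intro m
    have e : pre.length + D.n * D.n + D.N * D.N + m = pre.length +
      ((matrixWord D.graph.Adj).length + ((matrixWord D.decomp.tree.Adj).length + m)) := by
      rw [length_matrixWord, length_matrixWord]; ring
    rw [e, getD_append_add, DecomposedGraph.word, List.append_assoc, getD_append_add,
      getD_append_add]
  refine ⟨fun u v => ?_, fun i j => ?_, fun i v => ?_, fun v => ?_⟩
  · rw [hadj, getD_matrixWord]; simp
  · rw [htree, getD_matrixWord]; simp
  · rw [add_assoc _ _ (v : ℕ), hbag, getD_matrixWord]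
  · rw [add_assoc _ _ (v : ℕ), hbag, List.getD_eq_default]
    rw [length_matrixWord]; omega

namespace RAM

theorem length_le_inputSize (l : List ℕ) : l.length ≤ inputSize l := by
  induction l with
  | nil => simp [inputSize]
  | cons a l ih => simp only [inputSize, List.map_cons, List.sum_cons, List.length_cons] at ih ⊢; omega

theorem getD_lt_two_pow_inputSize (l : List ℕ) (i : ℕ) : l.getD i 0 < 2 ^ inputSize l := by
  induction l generalizing i with
  | nil => simp
  | cons a l ih =>
    have e : inputSize (a :: l) = Nat.size a + 1 + inputSize l := by simp [inputSize]
    rw [e]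
    cases i with
    | zero =>
      exact (Nat.lt_size_self a).trans_le (Nat.pow_le_pow_right (by simp) (by omega))
    | succ i => exact (ih i).trans_le (Nat.pow_le_pow_right (by simp) (by omega))

/-! ### Search orders of tree decompositions -/

section

variable {n N : ℕ} {G : SimpleGraph (Fin n)} (D : G.TreeDecomposition (Fin N)) {ord par : ℕ → ℕ}
  {T : ℕ → ℕ → Prop}

theorem SearchOrder.exists_equiv (h : SearchOrder N T ord par) :
    ∃ e : Fin N ≃ Fin N, ∀ r : Fin N, (e r : ℕ) = ord r := by
  have hinj : Function.Injective fun r : Fin N => (⟨ord r, h.ord_lt r r.2⟩ : Fin N) := by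
    intro r r' hr
    exact Fin.ext (h.inj r r.2 r' r'.2 (congrArg Fin.val hr))
  exact ⟨Equiv.ofBijective _ (Finite.injective_iff_bijective.1 hinj), fun _ => rfl⟩

/-- Following parents reaches the root through strictly decreasing ranks. -/
theorem SearchOrder.exists_walk (h : SearchOrder N T ord par) {H : SimpleGraph (Fin N)}
    (hT : ∀ i j : Fin N, T i j → H.Adj i j) (e : Fin N ≃ Fin N) (he : ∀ r : Fin N, (e r : ℕ) = ord r)
    (hN : 0 < N) (r : Fin N) :
    ∃ p : H.Walk (e r) (e ⟨0, hN⟩), ∀ x ∈ p.support, ∃ a ≤ r, e a = x := by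
  obtain ⟨r, hr⟩ := r
  induction r using Nat.strong_induction_on with
  | _ r ih =>
    rcases eq_or_ne r 0 with rfl | h0
    · exact ⟨.nil, fun x hx => ⟨_, le_rfl, (SimpleGraph.Walk.mem_support_nil_iff.1 hx).symm⟩⟩
    · have hp := h.par_lt r hr h0
      obtain ⟨p, hps⟩ := ih (par r) hp (by omega)
      have hadj : H.Adj (e ⟨r, hr⟩) (e ⟨par r, by omega⟩) := by
        refine (hT _ _ ?_).symm
        rw [he, he]
        exact h.adj r hr h0
      refine ⟨.cons hadj p, fun x hx => ?_⟩
      rcases (SimpleGraph.Walk.mem_support_iff _).1 hx with rfl | hx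
      · exact ⟨_, le_rfl, rfl⟩
      · obtain ⟨a, ha, hax⟩ := hps x (by simpa using hx)
        exact ⟨a, ha.trans (by simpa using hp.le), hax⟩

/-- The running intersection property. -/
theorem SearchOrder.rip (h : SearchOrder N T ord par)
    (hT : ∀ i j : Fin N, T i j → D.tree.Adj i j) (e : Fin N ≃ Fin N)
    (he : ∀ r : Fin N, (e r : ℕ) = ord r) {r j p : Fin N} (hj : j < r) (hp : (p : ℕ) = par r)
    {v : Fin n} (hr : v ∈ D.bag (e r)) (hv : v ∈ D.bag (e j)) : v ∈ D.bag (e p) := by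
  classical
  have hN : 0 < N := r.pos
  have h0 : (r : ℕ) ≠ 0 := by have : (j : ℕ) < r := hj; omega
  have hpr : p < r := by
    have := h.par_lt r r.2 h0
    exact Fin.lt_def.2 (by omega)
  obtain ⟨p₁, hp₁⟩ := h.exists_walk hT e he hN p
  obtain ⟨p₂, hp₂⟩ := h.exists_walk hT e he hN j
  have hadj : D.tree.Adj (e r) (e p) := by
    refine (hT _ _ ?_).symm
    rw [he, he, hp]
    exact h.adj r r.2 h0
  -- The parent and the earlier node are joined through the root using only ranks below `r`.
  -- Prefixing the edge from `r` to its parent therefore gives a path, and the path axiom puts `v`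
  -- into the parent's bag.
  let q := (p₁.append p₂.reverse).toPath
  have hq : ∀ x ∈ (q : D.tree.Walk (e p) (e j)).support, ∃ a < r, e a = x := by
    intro x hx
    have hx' := SimpleGraph.Walk.support_toPath_subset_support _ hx
    rw [SimpleGraph.Walk.mem_support_append_iff, SimpleGraph.Walk.support_reverse,
      List.mem_reverse] at hx'
    rcases hx' with hx' | hx'
    · obtain ⟨a, ha, hax⟩ := hp₁ x hx'; exact ⟨a, ha.trans_lt hpr, hax⟩
    · obtain ⟨a, ha, hax⟩ := hp₂ x hx'; exact ⟨a, ha.trans_lt hj, hax⟩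
  refine D.path (e r) (e p) (e j) (.cons hadj q) ?_ ?_ ⟨hr, hv⟩
  · refine SimpleGraph.Walk.IsPath.cons q.2 fun hmem => ?_
    obtain ⟨a, ha, hax⟩ := hq _ hmem
    exact ha.ne (e.injective hax)
  · simp

theorem exists_crossing {H : SimpleGraph (Fin N)} (hH : H.Connected) (hN : 0 < N) (U : ℕ → Prop)
    (h0 : U 0) (hU : ∃ j < N, ¬ U j) : ∃ i j : Fin N, U i ∧ ¬ U j ∧ H.Adj i j := by
  obtain ⟨j, hj, hUj⟩ := hU
  obtain ⟨p⟩ := hH.preconnected (⟨0, hN⟩ : Fin N) ⟨j, hj⟩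
  obtain ⟨d, _, h1, h2⟩ := p.exists_boundary_dart {i : Fin N | U i} h0 hUj
  exact ⟨d.fst, d.snd, h1, h2, d.adj⟩

end

end RAM

namespace RAM
open RAM.Expr (var read)
open RAM.Program (write skip cond)

/-! ### The algorithm -/

/-- Decides the problem with the parameters and the position of the matrices already in their
registers. -/
def coreProg : Program := paramProg ;; weightProg ;; orderProg ;; treeProg ;; answerProg

/-- A time bound for `coreProg`, where each bag has at most `T` colorings. -/
def coreTime (n N T : ℕ) : ℕ :=
  (3 * n + 3 * cutBound n + 10 * n + 3 * expBound n + 30) + ((n * (weightBits n * 5 + 8) + 2) +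
    ((N * (N * N * 4 + 12) + 10) + ((N * (3 * n + T * (coloringTime n N + 2) + 8) + 2) +
      (expBound n * 5 + 3))))

/-- Transfers the axioms of the decomposition from nodes to ranks. The exponent is width plus one
because that bounds every bag size. -/
theorem valid_tables {D : DecomposedGraph} {s : State} {o : ℕ}
    (hlay : D.Layout (s.arr Arr.word) o) (hn : s.var Reg.n = D.n) (hN : s.var Reg.N = D.N)
    (hoG : s.var Reg.oG = o) (hoB : s.var Reg.oB = o + D.n * D.n + D.N * D.N)
    (hord : SearchOrder D.N (fun i j => s.arr Arr.word (o + D.n * D.n + i * D.N + j) ≠ 0)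
      (s.arr Arr.ord) (s.arr Arr.par)) :
    s.tables.Valid ∧ ∀ r < D.N, bagColorings (s.tables.bag r) D.n ≤ 3 ^ (D.decomp.width + 1) := by
  classical
  have htn : s.tables.n = D.n := hn
  have htN : s.tables.N = D.N := hN
  have hN0 : 0 < D.N := by
    obtain ⟨i⟩ := D.decomp.isTree.1.nonempty
    exact i.pos
  obtain ⟨e, he⟩ := hord.exists_equiv
  have hT : ∀ i j : Fin D.N, s.arr Arr.word (o + D.n * D.n + i * D.N + j) ≠ 0 →
      D.decomp.tree.Adj i j := fun i j h => (hlay.tree i j).1 h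
  have hbag : ∀ (r : Fin D.N) (v : Fin D.n),
      s.tables.bag r v = if v ∈ D.decomp.bag (e r) then 1 else 0 := by
    intro r v
    rw [← hlay.bag, he]
    simp only [State.tables, hn, hoB]
  have hbag1 : ∀ (r : Fin D.N) (v : Fin D.n), s.tables.bag r v = 1 ↔ v ∈ D.decomp.bag (e r) := by
    intro r v
    rw [hbag]; split_ifs with h <;> simp [h]
  have hlast : ∀ v : Fin D.n, s.tables.bag D.N v = 0 := by
    intro v
    rw [← hlay.last v]
    simp only [State.tables, hn, hoB, hord.ord_last]
  refine ⟨⟨?_, ?_, ?_, ?_, ?_, ?_, ?_⟩, fun r hr => ?_⟩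
  · rwa [htN]
  · rw [htN, htn]
    intro r hr v hv
    rcases hr.lt_or_eq with h | rfl
    · rw [hbag ⟨r, h⟩ ⟨v, hv⟩]; split_ifs <;> simp
    · rw [hlast ⟨v, hv⟩]; simp
  · rw [htN, htn]
    exact fun v hv => hlast ⟨v, hv⟩
  · rw [htN]; exact hord.par_zero
  · rw [htN]; exact hord.par_lt
  · rw [htN, htn]
    intro r hr j hj v hv h1 h2
    have hp := hord.par_lt r hr (by omega)
    rw [hbag1 ⟨r, hr⟩ ⟨v, hv⟩] at h1
    rw [hbag1 ⟨j, by omega⟩ ⟨v, hv⟩] at h2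
    exact (hbag1 ⟨s.arr Arr.par r, by omega⟩ ⟨v, hv⟩).2
      (hord.rip D.decomp hT e he (r := ⟨r, hr⟩) (j := ⟨j, by omega⟩) hj rfl h1 h2)
  · rw [htN, htn]
    intro u hu v hv huv
    obtain ⟨i, h1, h2⟩ : ∃ i, (⟨u, hu⟩ : Fin D.n) ∈ D.decomp.bag i ∧
        (⟨v, hv⟩ : Fin D.n) ∈ D.decomp.bag i := by
      rcases huv with rfl | hg
      · obtain ⟨i, hi⟩ := D.decomp.cover ⟨u, hu⟩; exact ⟨i, hi, hi⟩
      · refine D.decomp.edge _ _ ((hlay.adj ⟨u, hu⟩ ⟨v, hv⟩).1 ?_)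
        simpa only [State.tables, hn, hoG] using hg
    refine ⟨e.symm i, (e.symm i).2, ?_, ?_⟩
    · exact (hbag1 _ ⟨u, hu⟩).2 (by simpa using h1)
    · exact (hbag1 _ ⟨v, hv⟩).2 (by simpa using h2)
  · rw [bagColorings_eq fun v hv => by rw [hbag ⟨r, hr⟩ ⟨v, hv⟩]; split_ifs <;> simp]
    refine Nat.pow_le_pow_right (by simp) ?_
    have hcard : (Finset.univ.filter fun v : Fin D.n => s.tables.bag r v = 1).card =
        (D.decomp.bag (e ⟨r, hr⟩)).ncard := by
      rw [Set.ncard_eq_toFinset_card']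
      congr 1
      ext v
      simp [hbag1 ⟨r, hr⟩ v]
    have hsup := Finset.le_sup (f := fun i => (D.decomp.bag i).ncard) (Finset.mem_univ (e ⟨r, hr⟩))
    rw [hcard]
    unfold SimpleGraph.TreeDecomposition.width
    change _ ≤ (Finset.univ.sup fun i => (D.decomp.bag i).ncard) at hsup
    omega

theorem run_coreProg {ω : ℕ → Bool} {B o k σ τ : ℕ} {D : DecomposedGraph} {s : State}
    (hlay : D.Layout (s.arr Arr.word) o) (hn : s.var Reg.n = D.n) (hN : s.var Reg.N = D.N)
    (hk : s.var Reg.k = k) (hσ : s.var Reg.s = σ) (hτ : s.var Reg.t = τ)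
    (hoG : s.var Reg.oG = o) (hans : s.var Reg.ans = 0) (hused : s.used = 0)
    (harr : ∀ a, a ≠ Arr.word → s.arr a = fun _ => 0)
    (hB2 : 2 ≤ B) (hoB : o + D.n * D.n + D.N * D.N < 2 ^ B)
    (hmd : (4 ^ (D.n + 1)) ^ expBound D.n < 2 ^ B) :
    Run ω B coreProg s (coreTime D.n D.N (3 ^ (D.decomp.width + 1))) fun s' =>
      s'.var Reg.ans ≠ 0 ↔
        Detects D.graph σ τ k fun u => weight ω (weightBits D.n) u := by
  classical
  have hN0 : 0 < D.N := by
    obtain ⟨i⟩ := D.decomp.isTree.1.nonempty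
    exact i.pos
  have hQ1 : 1 ≤ 4 ^ (D.n + 1) := Nat.one_le_pow _ _ (by simp)
  have hcut1 : 1 ≤ cutBound D.n := by simp [cutBound]
  have hexp1 : 1 ≤ expBound D.n := Nat.succ_le_of_lt (Nat.mul_pos hcut1 (by positivity))
  have hQle : 4 ^ (D.n + 1) ≤ (4 ^ (D.n + 1)) ^ expBound D.n := by
    simpa using Nat.pow_le_pow_right hQ1 hexp1
  refine Run.seq (run_paramProg hn hN hoG hoB hmd) fun s₁ f₁ h₁ => ?_
  obtain ⟨ho1, ho1', hQ', hM', hR', hl', hJ', hmd'⟩ := h₁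
  have hn1 : s₁.var Reg.n = D.n := by simp (disch := decide) [f₁.var, hn]
  have hN1 : s₁.var Reg.N = D.N := by simp (disch := decide) [f₁.var, hN]
  have hk1 : s₁.var Reg.k = k := by simp (disch := decide) [f₁.var, hk]
  have hσ1 : s₁.var Reg.s = σ := by simp (disch := decide) [f₁.var, hσ]
  have hτ1 : s₁.var Reg.t = τ := by simp (disch := decide) [f₁.var, hτ]
  have hoG1 : s₁.var Reg.oG = o := by simp (disch := decide) [f₁.var, hoG]
  have hans1 : s₁.var Reg.ans = 0 := by simp (disch := decide) [f₁.var, hans]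
  have harr1 : s₁.arr = s.arr := funext fun a => f₁.arr a (by simp [show paramProg.arrs = [] from rfl])
  have hused1 : s₁.used = 0 := (f₁.used (by decide)).trans hused
  refine Run.seq (run_weightProg hn1 hl' hR' hused1 (by omega) (Nat.one_le_pow _ _ hQ1) ?_ ?_ ?_)
    fun s₂ f₂ h₂ => ?_
  -- The largest power used for the weights is Q^(M * 2^l), and M * 2^l is at most the exponent
  -- bound J.
  · refine lt_of_le_of_lt ?_ hmd
    rw [← pow_mul]
    refine Nat.pow_le_pow_right hQ1 (Nat.mul_le_mul_left _ ?_)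
    have : 1 * 2 ^ weightBits D.n ≤ (D.n + 1) * 2 ^ weightBits D.n :=
      Nat.mul_le_mul_right _ (by omega)
    omega
  · have := Nat.le_mul_self D.n; omega
  · have h1 : weightBits D.n < 2 ^ weightBits D.n := Nat.lt_two_pow_self
    have h2 : 2 ^ weightBits D.n ≤ 4 * D.n + 1 := two_pow_weightBits_le _
    have h3 : D.n < 4 ^ D.n := Nat.lt_pow_self (by simp)
    have h4 : 4 ^ (D.n + 1) = 4 ^ D.n * 4 := pow_succ _ _
    omega
  have hw2 : s₂.arr Arr.word = s.arr Arr.word := by simp (disch := decide) [f₂.arr, harr1]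
  have hN2 : s₂.var Reg.N = D.N := by simp (disch := decide) [f₂.var, hN1]
  have ho2 : s₂.var Reg.oT = o + D.n * D.n := by simp (disch := decide) [f₂.var, ho1]
  have ho2' : s₂.arr Arr.ord = fun _ => 0 := by
    rw [f₂.arr _ (by decide), harr1]; exact harr _ (by decide)
  have hv2 : s₂.arr Arr.vis = fun _ => 0 := by
    rw [f₂.arr _ (by decide), harr1]; exact harr _ (by decide)
  refine Run.seq (run_orderProg hN2 ho2 ho2' hv2 (by omega) hN0 (by omega) ?_)
    fun s₃ f₃ h₃ => ?_
  · intro U h0 hU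
    obtain ⟨i, j, h1, h2, h3⟩ := exists_crossing D.decomp.isTree.1 hN0 U h0 hU
    exact ⟨i, i.2, j, j.2, h1, h2, by rw [hw2]; exact (hlay.tree i j).2 h3⟩
  have hw3 : s₃.arr Arr.word = s.arr Arr.word := by simp (disch := decide) [f₃.arr, hw2]
  have hn3 : s₃.var Reg.n = D.n := by simp (disch := decide) [f₃.var, f₂.var, hn1]
  have hN3 : s₃.var Reg.N = D.N := by simp (disch := decide) [f₃.var, hN2]
  have hk3 : s₃.var Reg.k = k := by simp (disch := decide) [f₃.var, f₂.var, hk1]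
  have hσ3 : s₃.var Reg.s = σ := by simp (disch := decide) [f₃.var, f₂.var, hσ1]
  have hτ3 : s₃.var Reg.t = τ := by simp (disch := decide) [f₃.var, f₂.var, hτ1]
  have hoG3 : s₃.var Reg.oG = o := by simp (disch := decide) [f₃.var, f₂.var, hoG1]
  have hans3 : s₃.var Reg.ans = 0 := by simp (disch := decide) [f₃.var, f₂.var, hans1]
  have hoB3 : s₃.var Reg.oB = o + D.n * D.n + D.N * D.N := by
    simp (disch := decide) [f₃.var, f₂.var, ho1']
  have hQ3 : s₃.var Reg.Q = 4 ^ (D.n + 1) := by simp (disch := decide) [f₃.var, f₂.var, hQ']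
  have hM3 : s₃.var Reg.M = cutBound D.n := by simp (disch := decide) [f₃.var, f₂.var, hM']
  have hJ3 : s₃.var Reg.J = expBound D.n := by simp (disch := decide) [f₃.var, f₂.var, hJ']
  have hmd3 : s₃.var Reg.md = (4 ^ (D.n + 1)) ^ expBound D.n := by
    simp (disch := decide) [f₃.var, f₂.var, hmd']
  have hwt3 : s₃.arr Arr.wt = s₂.arr Arr.wt := by simp (disch := decide) [f₃.arr]
  have htab3 : s₃.arr Arr.tab = fun _ => 0 := by
    rw [f₃.arr _ (by decide), f₂.arr _ (by decide), harr1]; exact harr _ (by decide)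
  rw [hw2, ← hw3] at h₃
  obtain ⟨hvalid, hcols⟩ := valid_tables (hw3.symm ▸ hlay) hn3 hN3 hoG3 hoB3 h₃
  have htn : s₃.tables.n = D.n := hn3
  have htN : s₃.tables.N = D.N := hN3
  have htmd : s₃.tables.md = (4 ^ (D.n + 1)) ^ expBound D.n := hmd3
  have htQ : s₃.tables.Q = 4 ^ (D.n + 1) := hQ3
  have hok : s₃.tables.Ok B := by
    refine ⟨hvalid.bag_le, hvalid.par_le, fun r hr => ?_, ?_, ?_, ?_, ?_, ?_⟩
    · have := hvalid.par_lt_or r hr; omega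
    · rw [htN]; have := Nat.le_mul_self D.N; omega
    · rw [htn]; omega
    · rw [htn]
      have h2 : 3 ^ D.n < 4 ^ (D.n + 1) :=
        (Nat.pow_le_pow_left (by simp) _).trans_lt (Nat.pow_lt_pow_right (by simp) (by simp))
      omega
    · rw [htmd]; positivity
    · rw [htmd]; exact hmd.le
  refine Run.seq (m₁ := D.N * (3 * D.n + 3 ^ (D.decomp.width + 1) *
    (coloringTime D.n D.N + 2) + 8) + 2) ((run_treeProg rfl hok hB2 hvalid.par_lt_or
      (fun r hr => by rw [htn]; exact hcols r (htN ▸ hr)) htab3).le (by rw [htn, htN])) fun s₄ f₄ h₄ => ?_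
  -- Equality in `ZMod` becomes a congruence modulo Q^J, the form required for reading off bits.
  have hz := hvalid.tab_zero h₄
  rw [ZMod.natCast_eq_natCast_iff, htmd, ← htQ] at hz
  refine (run_answerProg (J := expBound D.n) (M := cutBound D.n) (k := k) (Q := 4 ^ (D.n + 1))
    (by simp (disch := decide) [f₄.var, hJ3]) (by simp (disch := decide) [f₄.var, hM3])
    (by simp (disch := decide) [f₄.var, hk3]) (by simp (disch := decide) [f₄.var, hQ3])
    (by simp (disch := decide) [f₄.var, hans3]) (by omega)).imp fun s₅ _ _ h₅ => ?_
  rw [h₅, Detects]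
  refine exists_congr fun j => and_congr_right fun hj => and_congr_right fun _ => ?_
  have hbit := Tables.bit_partitionSum htn D.graph (fun u => weight ω (weightBits D.n) u)
    (M := cutBound D.n) (J := expBound D.n) (j := j) (z := s₄.arr Arr.tab 0) ?_ ?_ htQ
    (exponent_lt D.graph fun v => weight_lt _ _ _) hj hz
  · rw [htQ] at hbit
    rw [hbit, show s₃.tables.s = σ from hσ3, show s₃.tables.t = τ from hτ3]
  · intro u v
    rw [← hlay.adj, ← hw3]
    simp only [State.tables, hn3, hoG3]
  · intro u
    rw [pow_mul, htQ, ← h₂ u u.2, ← hwt3]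
    rfl

end RAM

namespace RAM
open RAM.Expr (var read)
open RAM.Program (write skip cond)

/-! ### The running time -/

/-- The dominant term is one node times one coloring times the quadratic time per coloring. The
summand 6 pays for the header that reads the parameters. -/
theorem coreTime_le {n N L T : ℕ} (hn : n ≤ L) (hN : N ≤ L) (hL : 1 ≤ L) (hT : 1 ≤ T)
    (hc : cutBound n ≤ 2 * L) (hw : weightBits n ≤ 2 * L) (hJ : expBound n ≤ 22 * L ^ 3) :
    6 + coreTime n N T ≤ 400 * T * L ^ 3 := by
  have hL2 : L ≤ L ^ 2 := Nat.le_self_pow (by simp) L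
  have hL3 : L ^ 2 ≤ L ^ 3 := Nat.pow_le_pow_right hL (by simp)
  have hTL : L ^ 3 ≤ T * L ^ 3 := Nat.le_mul_of_pos_left _ hT
  have h1 : n * (weightBits n * 5 + 8) ≤ 18 * L ^ 2 := by
    calc n * (weightBits n * 5 + 8) ≤ L * (18 * L) := Nat.mul_le_mul hn (by omega)
      _ = _ := by ring
  have h2 : N * (N * N * 4 + 12) ≤ 16 * L ^ 3 := by
    have : N * N ≤ L ^ 2 := by rw [sq]; exact Nat.mul_le_mul hN hN
    calc N * (N * N * 4 + 12) ≤ L * (16 * L ^ 2) := Nat.mul_le_mul hN (by omega)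
      _ = _ := by ring
  have h3 : coloringTime n N + 2 ≤ 40 * L ^ 2 := by
    have e1 : n * n ≤ L ^ 2 := by rw [sq]; exact Nat.mul_le_mul hn hn
    have e2 : N * (3 * n + 8) ≤ 11 * L ^ 2 := by
      calc N * (3 * n + 8) ≤ L * (11 * L) := Nat.mul_le_mul hN (by omega)
        _ = _ := by ring
    unfold coloringTime
    omega
  have h4 : N * (3 * n + T * (coloringTime n N + 2) + 8) ≤ 51 * (T * L ^ 3) := by
    have e1 : T * (coloringTime n N + 2) ≤ 40 * (T * L ^ 2) :=
      (Nat.mul_le_mul_left T h3).trans_eq (by ring)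
    have e2 : L ^ 2 ≤ T * L ^ 2 := Nat.le_mul_of_pos_left _ hT
    calc N * (3 * n + T * (coloringTime n N + 2) + 8) ≤ L * (51 * (T * L ^ 2)) :=
          Nat.mul_le_mul hN (by omega)
      _ = _ := by ring
  unfold coreTime
  rw [mul_assoc 400]
  omega

theorem le_inputSize (D : DecomposedGraph) (pre : List ℕ) :
    pre.length + D.n * D.n + D.N * D.N ≤ inputSize (pre ++ D.word) := by
  refine le_trans ?_ (length_le_inputSize _)
  simp only [List.length_append, DecomposedGraph.word, length_matrixWord]
  omega

/-! ### Monte Carlo algorithms -/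

/-- A program that puts the parameters and the position of the matrices into the registers, followed
by `coreProg`, is a Monte Carlo algorithm. -/
theorem monteCarlo_seq_coreProg {α : Type} {hd : Program} {D : α → DecomposedGraph}
    {pre : α → List ℕ} {k σ τ : α → ℕ} {yes : α → Prop} (hpre : ∀ x, 3 ≤ (pre x).length)
    (harrs : hd.arrs = []) (hflip : hd.flipFree = true) (hans : Reg.ans ∉ hd.vars)
    (hhd : ∀ x ω B, 3 ≤ B → Run ω B hd (.init (pre x ++ (D x).word)) 6 fun s =>
      s.var Reg.n = (D x).n ∧ s.var Reg.N = (D x).N ∧ s.var Reg.k = k x ∧ s.var Reg.s = σ x ∧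
        s.var Reg.t = τ x ∧ s.var Reg.oG = (pre x).length)
    (hyes : ∀ x, yes x ↔ ∃ S : Finset (Fin (D x).n), Separates (σ x) (τ x) S ∧
      ((D x).graph.induce (S : Set (Fin (D x).n))).Connected ∧ k x ≤ (D x).graph.cutSize S) :
    MonteCarlo (hd ;; coreProg) (fun x => pre x ++ (D x).word) yes fun x =>
      10 ^ 15 * 3 ^ (D x).decomp.width * inputSize (pre x ++ (D x).word) ^ 11 := by
  have key : ∀ x ω, ∃ t s, Exec ω (hd ;; coreProg) (.init (pre x ++ (D x).word)) t s ∧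
      t ≤ 10 ^ 15 * 3 ^ (D x).decomp.width * inputSize (pre x ++ (D x).word) ^ 11 ∧
      (s.var Reg.ans ≠ 0 ↔ Detects (D x).graph (σ x) (τ x) (k x) fun u =>
        weight ω (weightBits (D x).n) u) := by
    intro x ω
    have hlen := le_inputSize (D x) (pre x)
    have hpre := hpre x
    have hget := getD_lt_two_pow_inputSize (pre x ++ (D x).word)
    generalize hL : inputSize (pre x ++ (D x).word) = L at hlen hget ⊢
    have hn2 := Nat.le_mul_self (D x).n
    have hN2 := Nat.le_mul_self (D x).N
    have hc : cutBound (D x).n ≤ 2 * L := by unfold cutBound; omega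
    have hw : weightBits (D x).n ≤ 2 * L := (weightBits_le _).trans (by omega)
    have hJ : expBound (D x).n ≤ 22 * L ^ 3 := by
      have e1 : ((D x).n + 1) * 2 ^ weightBits (D x).n ≤ 10 * L ^ 2 := by
        have := two_pow_weightBits_le (D x).n
        calc ((D x).n + 1) * 2 ^ weightBits (D x).n ≤ (2 * L) * (5 * L) :=
              Nat.mul_le_mul (by omega) (by omega)
          _ = _ := by ring
      have e2 : 1 ≤ L ^ 2 := Nat.one_le_pow _ _ (by omega)
      calc expBound (D x).n ≤ (2 * L) * (11 * L ^ 2) := Nat.mul_le_mul hc (by omega)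
        _ = _ := by ring
    -- The modulus is 2^(2 * (n + 1) * J), which gives the first summand; `L` accommodates the input
    -- numbers, and the 1 makes the inequality for the modulus strict.
    obtain ⟨B, hB⟩ : ∃ B, B = 2 * (((D x).n + 1) * expBound (D x).n) + L + 1 := ⟨_, rfl⟩
    have hLB : 2 ^ L ≤ 2 ^ B := Nat.pow_le_pow_right (by simp) (by omega)
    have hBle : B + 1 ≤ 92 * L ^ 4 := by
      have e1 : 2 * (((D x).n + 1) * expBound (D x).n) ≤ 88 * L ^ 4 := by
        calc 2 * (((D x).n + 1) * expBound (D x).n) ≤ 2 * ((2 * L) * (22 * L ^ 3)) :=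
              Nat.mul_le_mul_left 2 (Nat.mul_le_mul (by omega) hJ)
          _ = _ := by ring
      have e2 : L ≤ L ^ 4 := Nat.le_self_pow (by simp) L
      omega
    have hinit : (State.init (pre x ++ (D x).word)).Bdd B := by
      refine ⟨fun _ => by simp [State.init], fun a i => ?_⟩
      simp only [State.init]
      split_ifs
      · exact (hget i).trans_le hLB
      · positivity
    have hrun := Run.seq (hhd x ω B (by omega)) (fun s f h =>
      run_coreProg (ω := ω) (B := B) (D := D x) (s := s) (o := (pre x).length)
        (by rw [f.arr _ (by simp [harrs])]; exact (D x).layout (pre x))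
        h.1 h.2.1 h.2.2.1 h.2.2.2.1 h.2.2.2.2.1 h.2.2.2.2.2 (f.var _ hans) (f.used hflip)
        (fun a ha => by
          rw [f.arr _ (by simp [harrs])]
          funext i
          exact if_neg ha)
        (by omega) (hlen.trans_lt (Nat.lt_two_pow_self.trans_le hLB))
        (by
          rw [show 4 = 2 ^ 2 from rfl, ← pow_mul, ← pow_mul]
          exact Nat.pow_lt_pow_right (by simp) (by omega)))
    obtain ⟨t, s, he, ht, _, hs⟩ := hrun hinit
    refine ⟨t, s, he, ht.trans ?_, hs⟩
    have hT : 1 ≤ 3 ^ ((D x).decomp.width + 1) := Nat.one_le_pow _ _ (by simp)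
    -- The exponent 11 is 3 from the number of instructions plus 2 * 4 from the quadratic cost on
    -- cells of O(L^4) bits; the extra 3 in 3^(tw+1) goes into the constant.
    calc _ ≤ (400 * 3 ^ ((D x).decomp.width + 1) * L ^ 3) * (10 ^ 7 * (92 * L ^ 4) ^ 2) :=
          Nat.mul_le_mul (coreTime_le (by omega) (by omega) (by omega) hT hc hw hJ)
            (Nat.mul_le_mul_left _ (Nat.pow_le_pow_left hBle 2))
      _ = 1200 * 10 ^ 7 * 92 ^ 2 * 3 ^ (D x).decomp.width * L ^ 11 := by ring
      _ ≤ _ := by gcongr; norm_num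
  have hacc : ∀ x ω, Accepts (hd ;; coreProg) ω (pre x ++ (D x).word) ↔
      Detects (D x).graph (σ x) (τ x) (k x) fun u => weight ω (weightBits (D x).n) u := by
    intro x ω
    obtain ⟨t, s, he, _, hs⟩ := key x ω
    rw [← hs]
    constructor
    · rintro ⟨t', s', he', hs'⟩
      rwa [(he.deterministic he').2]
    · exact fun h => ⟨t, s, he, h⟩
  refine ⟨fun x ω => ?_, fun x ω h => ?_, fun x hx => ?_⟩
  · obtain ⟨t, s, he, ht, _⟩ := key x ω
    exact ⟨t, s, he, ht⟩
  · exact (hyes x).2 ((hacc x ω).1 h).exists_cut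
  · obtain ⟨S, hS, hS', hk⟩ := (hyes x).1 hx
    simp only [hacc]
    exact coin_not_detects_le hS hS' hk

/-- Reads the parameters of an instance of Connected Maximum Cut. The registers for `s` and `t` get
the value `n`, which is not the number of a vertex. -/
def cutHeader : Program :=
  Reg.n ::= read Arr.word 0 ;; Reg.N ::= read Arr.word 1 ;; Reg.k ::= read Arr.word 2 ;;
    Reg.s ::= var Reg.n ;; Reg.t ::= var Reg.n ;; Reg.oG ::= 3

/-- Reads the parameters of an instance of Connected Maximum `s`-`t` Cut. -/
def stCutHeader : Program :=
  Reg.n ::= read Arr.word 0 ;; Reg.N ::= read Arr.word 1 ;; Reg.k ::= read Arr.word 2 ;;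
    Reg.s ::= read Arr.word 3 ;; Reg.t ::= read Arr.word 4 ;; Reg.oG ::= 5

theorem run_cutHeader {ω : ℕ → Bool} {B n N k : ℕ} {w : List ℕ} (hB : 3 ≤ B) :
    Run ω B cutHeader (.init ([n, N, k] ++ w)) 6 fun s =>
      s.var Reg.n = n ∧ s.var Reg.N = N ∧ s.var Reg.k = k ∧ s.var Reg.s = n ∧ s.var Reg.t = n ∧
        s.var Reg.oG = 3 := by
  have hB8 : 2 ^ 3 ≤ 2 ^ B := Nat.pow_le_pow_right (by simp) hB
  refine Run.assign_seq (m := 5) (by decide) (fun h => h.2 _ _) ?_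
  refine Run.assign_seq (m := 4) (by decide) (fun h => h.2 _ _) ?_
  refine Run.assign_seq (m := 3) (by decide) (fun h => h.2 _ _) ?_
  refine Run.assign_seq (m := 2) (by decide) (fun h => h.1 _) ?_
  refine Run.assign_seq (m := 1) (by decide) (fun h => h.1 _) ?_
  refine Run.assign (by decide) (fun _ => by rw [Expr.eval_three]; omega) ?_
  exact ⟨rfl, rfl, rfl, rfl, rfl, rfl⟩

theorem run_stCutHeader {ω : ℕ → Bool} {B n N k σ τ : ℕ} {w : List ℕ} (hB : 3 ≤ B) :
    Run ω B stCutHeader (.init ([n, N, k, σ, τ] ++ w)) 6 fun s =>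
      s.var Reg.n = n ∧ s.var Reg.N = N ∧ s.var Reg.k = k ∧ s.var Reg.s = σ ∧ s.var Reg.t = τ ∧
        s.var Reg.oG = 5 := by
  have hB8 : 2 ^ 3 ≤ 2 ^ B := Nat.pow_le_pow_right (by simp) hB
  refine Run.assign_seq (m := 5) (by decide) (fun h => h.2 _ _) ?_
  refine Run.assign_seq (m := 4) (by decide) (fun h => h.2 _ _) ?_
  refine Run.assign_seq (m := 3) (by decide) (fun h => h.2 _ _) ?_
  refine Run.assign_seq (m := 2) (by decide) (fun h => h.2 _ _) ?_
  refine Run.assign_seq (m := 1) (by decide) (fun h => h.2 _ _) ?_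
  refine Run.assign (by decide) (fun _ => by rw [Expr.eval_five]; omega) ?_
  exact ⟨rfl, rfl, rfl, rfl, rfl, rfl⟩

/-- Numbers that name no vertex impose no condition, so the version without terminals is the same
program with both terminals set to `n`. -/
theorem separates_of_le {n s t : ℕ} (hs : n ≤ s) (ht : n ≤ t) (S : Finset (Fin n)) :
    Separates s t S := fun v => ⟨fun h => by have := v.2; omega, fun h => by have := v.2; omega⟩

theorem separates_iff {n : ℕ} (s t : Fin n) (S : Finset (Fin n)) :
    Separates s t S ↔ s ∈ S ∧ t ∉ S := by
  constructor
  · exact fun h => ⟨(h s).1 rfl, (h t).2 rfl⟩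
  · rintro ⟨hs, ht⟩ v
    exact ⟨fun h => Fin.ext h ▸ hs, fun h => Fin.ext h ▸ ht⟩

end RAM

theorem SimpleGraph.hasConnectedCut_iff {n : ℕ} (G : SimpleGraph (Fin n)) (k : ℕ) :
    G.HasConnectedCut k ↔ ∃ S : Finset (Fin n),
      (G.induce (S : Set (Fin n))).Connected ∧ k ≤ G.cutSize S := by
  constructor
  · rintro ⟨S, hS, hk⟩
    lift S to Finset (Fin n) using S.toFinite
    exact ⟨S, hS, by rwa [← G.ncard_cutset]⟩
  · rintro ⟨S, hS, hk⟩
    exact ⟨S, hS, by rwa [G.ncard_cutset]⟩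

theorem SimpleGraph.hasConnectedSTCut_iff {n : ℕ} (G : SimpleGraph (Fin n)) (s t : Fin n) (k : ℕ) :
    G.HasConnectedSTCut s t k ↔ ∃ S : Finset (Fin n), (s ∈ S ∧ t ∉ S) ∧
      (G.induce (S : Set (Fin n))).Connected ∧ k ≤ G.cutSize S := by
  constructor
  · rintro ⟨S, hs, ht, hS, hk⟩
    lift S to Finset (Fin n) using S.toFinite
    exact ⟨S, ⟨by simpa using hs, by simpa using ht⟩, hS, by rwa [← G.ncard_cutset]⟩
  · rintro ⟨S, ⟨hs, ht⟩, hS, hk⟩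
    exact ⟨S, by simpa using hs, by simpa using ht, hS, by rwa [G.ncard_cutset]⟩

theorem mainTheorem5 :
    (∃ (p : RAM.Program) (C d : ℕ),
      RAM.MonteCarlo p CMCInstance.word
        (fun x => x.graph.HasConnectedCut x.k)
        (fun x => C * 3 ^ x.decomp.width * RAM.inputSize x.word ^ d)) ∧
    (∃ (p : RAM.Program) (C d : ℕ),
      RAM.MonteCarlo p CMSTCInstance.word
        (fun x => x.graph.HasConnectedSTCut x.s x.t x.k)
        (fun x => C * 3 ^ x.decomp.width * RAM.inputSize x.word ^ d)) := by

  refine ⟨⟨.seq RAM.cutHeader RAM.coreProg, 10 ^ 15, 11, ?_⟩,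
    ⟨.seq RAM.stCutHeader RAM.coreProg, 10 ^ 15, 11, ?_⟩⟩
  · exact RAM.monteCarlo_seq_coreProg (D := CMCInstance.toDecomposedGraph)
      (pre := fun x => [x.n, x.N, x.k]) (k := fun x => x.k) (σ := fun x => x.n) (τ := fun x => x.n)
      (fun _ => le_rfl) rfl rfl (by decide) (fun x ω B hB => RAM.run_cutHeader hB) fun x => by
        rw [x.graph.hasConnectedCut_iff]
        simp [RAM.separates_of_le]
  · exact RAM.monteCarlo_seq_coreProg (D := CMSTCInstance.toDecomposedGraph)
      (pre := fun x => [x.n, x.N, x.k, x.s, x.t]) (k := fun x => x.k) (σ := fun x => x.s)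
      (τ := fun x => x.t) (fun _ => by simp) rfl rfl (by decide)
      (fun x ω B hB => RAM.run_stCutHeader hB) fun x => by
        rw [x.graph.hasConnectedSTCut_iff]
        simp only [RAM.separates_iff]
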